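/- Let $(M,g)$ be a compact connected Riemannian manifold (smooth, without boundary) of dimension $n\ge 2$ with Levi-Civita connection $\nabla$ and volume measure $dv_g$, and let $(\bar M,\bar g)$ be a complete Riemannian manifold of dimension $m\ge 2$. For a smooth map $f:M\to\bar M$ put $g^*:=f^*\bar g$, $e(f):=\operatorname{trace}_g g^*$ and $E_U(f):=\tfrac12\int_U e(f)\,dv_g$ for open $U\subset M$, $E(f):=E_M(f)$; $f$ is harmonic if for every relatively compact open $U$ it is a critical point of $E_U$ with respect to all smooth variations with compact support in $U$. For a symmetric two-tensor $\varphi$ and a one-form $\theta$ on $M$ let $(\delta\varphi)(Y)=-\sum_i(\nabla_{X_i}\varphi)(X_i,Y)$ and $\delta\theta=-\sum_i(\nabla_{X_i}\theta)(X_i)$, where $X_1,\dots,X_n$ is a local orthonormal frame, let $\delta^*\theta=\tfrac12 L_{\theta^\#}g$, where $\theta^\#$ is the vector field $g$-dual to $\theta$, and let $\Delta_S\theta:=2\,\delta\delta^*\theta-d\,\delta\theta$ be the Sampson Laplacian. A vector field $\xi$ on $M$ is an infinitesimal harmonic transformation if the local transformations $\Phi_t$ generated by $\xi$ (so that $\Phi_0=\mathrm{id}$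 and $\partial_t\Phi_t|_{t=0}=\xi$) are harmonic to first order, i.e. the $t$-derivative of their tension field vanishes at $t=0$; equivalently, $\operatorname{trace}_g(L_\xi\nabla)=0$. Let $f:(M,g)\to(\bar M,\bar g)$ be harmonic, and let $$g^*=(\delta^*\theta+\lambda g)+\varphi_{TT}$$ be a York decomposition of $g^*$, with $\theta$ a smooth one-form, $\lambda\in C^\infty(M)$, and $\varphi_{TT}$ a smooth symmetric two-tensor such that $\delta\varphi_{TT}=0$ and $\operatorname{trace}_g\varphi_{TT}=0$. Then $$\Delta_S\theta=-(n-2)\,d\lambda .$$ Moreover: 1. if $n=2$, then $\theta^\#$ is an infinitesimal harmonic transformation; 2. if $n>2$, then $\theta^\#$ is an infinitesimal harmonic transformation if and only if $\lambda$ is constant; 3. if $n>2$ and $\theta^\#$ is an infinitesimal harmonic transformation, then $\lambda$ is a constant, $\lambda\ge 0$, and $E(f)=\tfrac n2\,\lambda\operatorname{Vol}(M,g)$. -/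

import Mathlib

open scoped Manifold ContDiff Topology Bundle
open MeasureTheory Set Filter

noncomputable section

namespace RiemGeom

/-- The model space `ℝⁿ` with its Euclidean norm. -/
abbrev Rn (n : ℕ) : Type := EuclideanSpace ℝ (Fin n)

/-- A smooth Riemannian metric on the tangent bundle of a (boundaryless) `n`-manifold. -/
abbrev RiemMetric (n : ℕ) (M : Type*) [TopologicalSpace M] [ChartedSpace (Rn n) M]
    [IsManifold (𝓡 n) ∞ M] : Type _ :=
  Bundle.ContMDiffRiemannianMetric (𝓡 n) ∞ (Rn n) (fun x : M ↦ TangentSpace (𝓡 n) x)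

/-- Smooth one-forms. -/
abbrev OneForm (n : ℕ) (M : Type*) [TopologicalSpace M] [ChartedSpace (Rn n) M]
    [IsManifold (𝓡 n) ∞ M] : Type _ :=
  ContMDiffSection (𝓡 n) (Rn n →L[ℝ] ℝ) ∞ (fun x : M ↦ TangentSpace (𝓡 n) x →L[ℝ] ℝ)

/-- Smooth covariant two-tensor fields. -/
abbrev TwoTensor (n : ℕ) (M : Type*) [TopologicalSpace M] [ChartedSpace (Rn n) M]
    [IsManifold (𝓡 n) ∞ M] : Type _ :=
  ContMDiffSection (𝓡 n) (Rn n →L[ℝ] Rn n →L[ℝ] ℝ) ∞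
    (fun x : M ↦ TangentSpace (𝓡 n) x →L[ℝ] TangentSpace (𝓡 n) x →L[ℝ] ℝ)

section Coordinates

variable {n : ℕ} {M : Type*} [TopologicalSpace M] [ChartedSpace (Rn n) M]

/-- Partial derivative `∂ᵢ F` of a function of `n` real variables. -/
def pd (i : Fin n) (F : Rn n → ℝ) (y : Rn n) : ℝ :=
  fderiv ℝ F y (EuclideanSpace.single i 1)

/-- The coordinate vector `∂ᵢ` of the chart at `p`, at the point with coordinates `y`. -/
def coordVec (p : M) (y : Rn n) (i : Fin n) :
    TangentSpace (𝓡 n) ((extChartAt (𝓡 n) p).symm y) :=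
  mfderiv (𝓡 n) (𝓡 n) (extChartAt (𝓡 n) p).symm y (EuclideanSpace.single i (1 : ℝ) : Rn n)

/-- The components `vⁱ` at `p`, in the chart at `p`, of a tangent vector `v` at `p`. -/
def vecComp (p : M) (v : TangentSpace (𝓡 n) p) (i : Fin n) : ℝ :=
  let c : Rn n := mfderiv (𝓡 n) (𝓡 n) (extChartAt (𝓡 n) p) p v
  c i

/-- The components `ξⁱ(y)` of a vector field in the chart at `p`. -/
def coordField (ξ : ∀ x : M, TangentSpace (𝓡 n) x) (p : M) (y : Rn n) (i : Fin n) : ℝ :=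
  let c : Rn n := mfderiv (𝓡 n) (𝓡 n) (extChartAt (𝓡 n) p) ((extChartAt (𝓡 n) p).symm y)
    (ξ ((extChartAt (𝓡 n) p).symm y))
  c i

/-- The components `θᵢ(y)` of a one-form in the chart at `p`. -/
def coordForm (θ : ∀ x : M, TangentSpace (𝓡 n) x → ℝ) (p : M) (y : Rn n) (i : Fin n) : ℝ :=
  θ _ (coordVec p y i)

/-- The components `hᵢⱼ(y)` of a two-tensor field in the chart at `p`. -/
def coordTensor (h : ∀ x : M, TangentSpace (𝓡 n) x → TangentSpace (𝓡 n) x → ℝ)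
    (p : M) (y : Rn n) : Matrix (Fin n) (Fin n) ℝ :=
  Matrix.of fun i j ↦ h _ (coordVec p y i) (coordVec p y j)

variable [IsManifold (𝓡 n) ∞ M] (g : RiemMetric n M)

/-- The components `gᵢⱼ(y)` of the metric in the chart at `p`. -/
def coordMetric (p : M) (y : Rn n) : Matrix (Fin n) (Fin n) ℝ :=
  coordTensor (fun x v w ↦ g.inner x v w) p y

/-- The components `gⁱʲ(y)` of the inverse metric in the chart at `p`. -/
def coordInv (p : M) (y : Rn n) : Matrix (Fin n) (Fin n) ℝ :=
  (coordMetric g p y)⁻¹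

/-- The Christoffel symbols `Γᵏᵢⱼ(y)` of the Levi-Civita connection in the chart at `p`. -/
def christoffel (p : M) (k i j : Fin n) (y : Rn n) : ℝ :=
  (1 / 2) * ∑ l, coordInv g p y k l *
    (pd i (fun z ↦ coordMetric g p z j l) y + pd j (fun z ↦ coordMetric g p z i l) y
      - pd l (fun z ↦ coordMetric g p z i j) y)

/-- `trace_g h = gⁱʲ hᵢⱼ`, computed at `x` in the chart at `x`. -/
def metricTrace (h : ∀ x : M, TangentSpace (𝓡 n) x → TangentSpace (𝓡 n) x → ℝ) (x : M) : ℝ :=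
  ∑ i, ∑ j, coordInv g x (extChartAt (𝓡 n) x x) i j *
    coordTensor h x (extChartAt (𝓡 n) x x) i j

/-- The components `(∇h)ᵢⱼₖ = ∇ᵢ hⱼₖ` of the covariant derivative of a two-tensor field, in the
chart at `p`. -/
def covTensor (h : ∀ x : M, TangentSpace (𝓡 n) x → TangentSpace (𝓡 n) x → ℝ)
    (p : M) (i j k : Fin n) (y : Rn n) : ℝ :=
  pd i (fun z ↦ coordTensor h p z j k) y
    - ∑ l, christoffel g p l i j y * coordTensor h p y l k
    - ∑ l, christoffel g p l i k y * coordTensor h p y j l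

/-- The components `∇ᵢ θⱼ` of the covariant derivative of a one-form, in the chart at `p`. -/
def covForm (θ : ∀ x : M, TangentSpace (𝓡 n) x → ℝ) (p : M) (i j : Fin n) (y : Rn n) : ℝ :=
  pd i (fun z ↦ coordForm θ p z j) y - ∑ l, christoffel g p l i j y * coordForm θ p y l

/-- The divergence of a two-tensor field: `(δh)(w) = - gⁱʲ (∇ᵢ hⱼₖ) wᵏ`. -/
def divTensor (h : ∀ x : M, TangentSpace (𝓡 n) x → TangentSpace (𝓡 n) x → ℝ)
    (x : M) (w : TangentSpace (𝓡 n) x) : ℝ :=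
  -∑ k, (∑ i, ∑ j, coordInv g x (extChartAt (𝓡 n) x x) i j *
    covTensor g h x i j k (extChartAt (𝓡 n) x x)) * vecComp x w k

/-- The codifferential of a one-form: `δθ = - gⁱʲ ∇ᵢ θⱼ`. -/
def divForm (θ : ∀ x : M, TangentSpace (𝓡 n) x → ℝ) (x : M) : ℝ :=
  -∑ i, ∑ j, coordInv g x (extChartAt (𝓡 n) x x) i j *
    covForm g θ x i j (extChartAt (𝓡 n) x x)

/-- The Lie derivative of the metric,
`(L_ξ g)ᵢⱼ = ξᵏ ∂ₖ gᵢⱼ + gₖⱼ ∂ᵢ ξᵏ + gᵢₖ ∂ⱼ ξᵏ`, as a two-tensor field. -/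
def lieMetric (ξ : ∀ x : M, TangentSpace (𝓡 n) x) (x : M) (v w : TangentSpace (𝓡 n) x) : ℝ :=
  let y := extChartAt (𝓡 n) x x
  ∑ i, ∑ j, (∑ k, (coordField ξ x y k * pd k (fun z ↦ coordMetric g x z i j) y
      + coordMetric g x y k j * pd i (fun z ↦ coordField ξ x z k) y
      + coordMetric g x y i k * pd j (fun z ↦ coordField ξ x z k) y)) * vecComp x v i * vecComp x w j

/-- The value of the metric at `x` as a bilinear form. -/
def bilin (x : M) : LinearMap.BilinForm ℝ (TangentSpace (𝓡 n) x) :=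
  LinearMap.mk₂ ℝ (fun v w ↦ g.inner x v w) (by simp) (by simp) (by simp) (by simp)

theorem bilin_nondegenerate (x : M) : (bilin g x).Nondegenerate := by
  constructor
  · intro v hv
    by_contra h
    exact (g.pos x v h).ne' (hv v)
  · intro v hv
    by_contra h
    exact (g.pos x v h).ne' (hv v)

instance (x : M) : FiniteDimensional ℝ (TangentSpace (𝓡 n) x) :=
  inferInstanceAs (FiniteDimensional ℝ (Rn n))

/-- The vector field `θ^#`, determined by `g(θ^#, v) = θ(v)`. -/
def sharp (θ : OneForm n M) (x : M) : TangentSpace (𝓡 n) x :=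
  ((bilin g x).toDual (bilin_nondegenerate g x)).symm (θ x : TangentSpace (𝓡 n) x →ₗ[ℝ] ℝ)

theorem inner_sharp (θ : OneForm n M) (x : M) (v : TangentSpace (𝓡 n) x) :
    g.inner x (sharp g θ x) v = θ x v :=
  LinearMap.BilinForm.apply_toDual_symm_apply (hB := bilin_nondegenerate g x)
    (θ x : TangentSpace (𝓡 n) x →ₗ[ℝ] ℝ) v

/-- `δ*θ = ½ L_ξ g` with `ξ = θ^#`. -/
def deltaStar (θ : OneForm n M) (x : M) (v w : TangentSpace (𝓡 n) x) : ℝ :=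
  (1 / 2) * lieMetric g (sharp g θ) x v w

/-- The differential of a real function. -/
def differential (u : M → ℝ) (x : M) (w : TangentSpace (𝓡 n) x) : ℝ :=
  mfderiv (𝓡 n) 𝓘(ℝ, ℝ) u x w

/-- The Sampson Laplacian on one-forms, `Δ_S = 2 δ δ* - d δ`. -/
def sampsonLaplacian (θ : OneForm n M) (x : M) (w : TangentSpace (𝓡 n) x) : ℝ :=
  2 * divTensor g (deltaStar g θ) x w
    - differential (divForm g (fun x v ↦ θ x v)) x w

/-- `TT`-tensors: smooth symmetric two-tensor fields, divergence free and trace free. -/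
structure IsTT (φ : TwoTensor n M) : Prop where
  symm : ∀ (x : M) (v w : TangentSpace (𝓡 n) x), φ x v w = φ x w v
  div : ∀ (x : M) (w : TangentSpace (𝓡 n) x), divTensor g (fun x v w ↦ φ x v w) x w = 0
  trace : ∀ x : M, metricTrace g (fun x v w ↦ φ x v w) x = 0

/-- The components, in the chart at `p`, of the tension field at `p` of a map `Φ : M → M` that
is smooth near `p` and maps `p` into the domain of the chart at `p`:
`τᵏ = gⁱʲ (∂ᵢ∂ⱼ Φᵏ - Γˡᵢⱼ ∂ₗ Φᵏ + (Γᵏₐᵦ ∘ Φ) ∂ᵢ Φᵃ ∂ⱼ Φᵇ)`. -/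
def coordTension (p : M) (Φ : M → M) (k : Fin n) : ℝ :=
  let y := extChartAt (𝓡 n) p p
  let u : Rn n → Rn n := fun z ↦ extChartAt (𝓡 n) p (Φ ((extChartAt (𝓡 n) p).symm z))
  ∑ i, ∑ j, coordInv g p y i j *
    (pd i (pd j (fun z ↦ u z k)) y
      - ∑ l, christoffel g p l i j y * pd l (fun z ↦ u z k) y
      + ∑ a, ∑ b, christoffel g p k a b (u y) * pd i (fun z ↦ u z a) y * pd j (fun z ↦ u z b) y)

/-- `ξ` is an infinitesimal harmonic transformation: the local transformations `Φₜ` of `M`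
generated by `ξ` (so `Φ₀ = id` and `∂ₜ Φₜ = ξ` at `t = 0`) are harmonic to first order in `t`,
that is, the `t`-derivative at `t = 0` of their tension field vanishes at every point. As
`Φ₀ = id` has zero tension, this derivative is a tangent vector that does not depend on
coordinates; it is `trace_g (L_ξ ∇)`, and so is the same for all families generated by `ξ`. -/
def IsInfinitesimalHarmonic (ξ : ∀ x : M, TangentSpace (𝓡 n) x) : Prop :=
  ∀ (p : M) (Φ : ℝ → M → M),
    ContMDiffAt (𝓘(ℝ, ℝ).prod (𝓡 n)) (𝓡 n) ∞ (fun q : ℝ × M ↦ Φ q.1 q.2) (0, p) →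
    (∀ᶠ x in 𝓝 p, Φ 0 x = x ∧
      HasMFDerivAt 𝓘(ℝ, ℝ) (𝓡 n) (fun t ↦ Φ t x) 0
        ((1 : ℝ →L[ℝ] ℝ).smulRight (ξ (Φ 0 x)))) →
    ∀ k, HasDerivAt (fun t ↦ coordTension g p (Φ t) k) 0 0

variable [MeasurableSpace M]

/-- The measure `√det(gᵢⱼ) dy¹⋯dyⁿ` of the chart at `p`, carried to `M`; it is the Riemannian
volume measure restricted to the domain of that chart. -/
def chartVolume (p : M) : Measure M :=
  (((volume : Measure (Rn n)).restrict (extChartAt (𝓡 n) p).target).withDensity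
    (fun y ↦ ENNReal.ofReal √(coordMetric g p y).det)).map (extChartAt (𝓡 n) p).symm

/-- The Riemannian volume measure `dv_g`: the least measure that dominates the volume measures
of all charts (these agree on overlaps). -/
def riemVol : Measure M := ⨆ p : M, chartVolume g p

end Coordinates

section Maps

variable {n m : ℕ} {M N : Type*}
  [TopologicalSpace M] [ChartedSpace (Rn n) M] [IsManifold (𝓡 n) ∞ M] [MeasurableSpace M]
  [TopologicalSpace N] [ChartedSpace (Rn m) N] [IsManifold (𝓡 m) ∞ N]

/-- The pullback metric `f^* ḡ`. -/
def pullbackMetric (gbar : RiemMetric m N) (f : M → N) (x : M) (v w : TangentSpace (𝓡 n) x) : ℝ :=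
  gbar.inner (f x) (mfderiv (𝓡 n) (𝓡 m) f x v) (mfderiv (𝓡 n) (𝓡 m) f x w)

/-- The energy density `e(f) = trace_g (f^* ḡ)`. -/
def energyDensity (g : RiemMetric n M) (gbar : RiemMetric m N) (f : M → N) (x : M) : ℝ :=
  metricTrace g (pullbackMetric gbar f) x

/-- The energy of `f` over `U`: `½ ∫_U e(f) dv_g`. -/
def energyOn (g : RiemMetric n M) (gbar : RiemMetric m N) (U : Set M) (f : M → N) : ℝ :=
  (1 / 2) * ∫ x in U, energyDensity g gbar f x ∂(riemVol g)

/-- The energy `E(f) = ½ ∫_M e(f) dv_g`. -/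
def energy (g : RiemMetric n M) (gbar : RiemMetric m N) (f : M → N) : ℝ :=
  energyOn g gbar univ f

/-- A smooth map is harmonic if it is a critical point of the energy over every relatively
compact open set `U`, under all smooth variations with compact support in `U`. -/
def IsHarmonicMap (g : RiemMetric n M) (gbar : RiemMetric m N) (f : M → N) : Prop :=
  ContMDiff (𝓡 n) (𝓡 m) ∞ f ∧
  ∀ (U K : Set M) (F : ℝ → M → N) (ε : ℝ), IsOpen U → IsCompact (closure U) →
    IsCompact K → K ⊆ U → 0 < ε →
    ContMDiffOn (𝓘(ℝ, ℝ).prod (𝓡 n)) (𝓡 m) ∞ (fun q : ℝ × M ↦ F q.1 q.2)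
      (Ioo (-ε) ε ×ˢ univ) →
    F 0 = f → (∀ t ∈ Ioo (-ε) ε, ∀ x ∉ K, F t x = f x) →
    HasDerivAt (fun t ↦ energyOn g gbar U (F t)) 0 0

/-- Completeness of a Riemannian manifold: every sequence that is Cauchy for the Riemannian
distance converges. -/
def IsCompleteMetric (gbar : RiemMetric m N) : Prop :=
  letI : Bundle.RiemannianBundle (fun x : N ↦ TangentSpace (𝓡 m) x) :=
    ⟨gbar.toRiemannianMetric⟩
  ∀ u : ℕ → N,
    (∀ ε : ENNReal, 0 < ε → ∃ k, ∀ a ≥ k, ∀ b ≥ k,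
      Manifold.riemannianEDist (𝓡 m) (u a) (u b) < ε) →
    ∃ x, Tendsto u atTop (𝓝 x)

end Maps

end RiemGeom

end

open RiemGeom

open scoped Manifold ContDiff Topology Bundle
open MeasureTheory Set Filter

noncomputable section

namespace RiemGeom

set_option linter.unusedSectionVars false

/-! ### Partial derivatives, and derivatives of inverse matrices and determinants -/

section CoordinateCalculus

variable {n : ℕ} {y : Rn n} {F F' : Rn n → ℝ}

/-! Let S(h) = div h - ½ d(trace h), with div = -δ: the divergence of h - ½ (trace h) g, linear in
the symmetric two-tensor h. Its component form is `stressDiv`. The theorem comes from evaluating S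
on the two sides of the York decomposition.

Harmonicity gives S(f^*ḡ) = 0 (`stressDiv_pullbackMetric_eq_zero`). Composing f with the deformation
y ↦ y + t η(y) e_c of a chart is an admissible variation; in coordinates its energy is an integral
over a fixed ball, and the fundamental lemma of the calculus of variations, after integration by
parts, yields the vanishing of S.

On the other side, S(λ g) = (1 - n/2) dλ because ∇g = 0 (`stressDiv_smul_metric`), and S vanishes on
TT-tensors (`IsTT.stressDiv_eq_zero`). For ξ = θ^# and s = L_ξ g, contracting the identity g(L_ξ ∇)
= ½ (∇s + ∇s - ∇s) shows that S(s) is the one-form dual to trace_g(L_ξ ∇) (`stressDiv_lieMatrix`).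
Since trace δ*θ = -δθ, the same one-form S(s) equals -Δ_S θ (`sampsonLaplacian_eq`).

Hence 0 = ½ S(L_ξ g) + (1 - n/2) dλ, that is S(L_ξ g) = (n - 2) dλ (`stressDiv_lieMatrix_of_york`).
This is the formula for Δ_S θ, and it says that ξ is an infinitesimal harmonic transformation
exactly when (n - 2) dλ = 0; connectedness turns dλ = 0 into constancy. For the energy, the trace of
the decomposition is e(f) = -δθ + nλ, the integral of δθ vanishes by the divergence theorem, and
e(f) ≥ 0 gives the sign of λ.

Traces, divergences and Lie derivatives at x are defined in the chart at x. They can be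
differentiated or integrated only after being rewritten in one fixed chart, so chart independence of
the trace, of L_ξ g and of the volume carries the rest of the work. -/

theorem pd_congr {i : Fin n} (h : F =ᶠ[𝓝 y] F') : pd i F y = pd i F' y := by
  rw [pd, pd, h.fderiv_eq]

theorem pd_const (i : Fin n) (c : ℝ) : pd i (fun _ ↦ c) y = 0 := by simp [pd]

theorem pd_add (i : Fin n) (h : DifferentiableAt ℝ F y) (h' : DifferentiableAt ℝ F' y) :
    pd i (fun z ↦ F z + F' z) y = pd i F y + pd i F' y := by
  simp [pd, fderiv_fun_add h h']

theorem pd_sub (i : Fin n) (h : DifferentiableAt ℝ F y) (h' : DifferentiableAt ℝ F' y) :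
    pd i (fun z ↦ F z - F' z) y = pd i F y - pd i F' y := by
  simp [pd, fderiv_fun_sub h h']

theorem pd_mul (i : Fin n) (h : DifferentiableAt ℝ F y) (h' : DifferentiableAt ℝ F' y) :
    pd i (fun z ↦ F z * F' z) y = pd i F y * F' y + F y * pd i F' y := by
  simp [pd, fderiv_fun_mul h h']; ring

theorem pd_const_mul (i : Fin n) (c : ℝ) (h : DifferentiableAt ℝ F y) :
    pd i (fun z ↦ c * F z) y = c * pd i F y := by
  simp [pd, fderiv_const_mul h]

theorem pd_sum {ι : Type*} [Fintype ι] (i : Fin n) {H : ι → Rn n → ℝ}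
    (h : ∀ a, DifferentiableAt ℝ (H a) y) :
    pd i (fun z ↦ ∑ a, H a z) y = ∑ a, pd i (H a) y := by
  simp [pd, fderiv_fun_sum (fun a (_ : a ∈ Finset.univ) ↦ h a)]

theorem fderiv_eq_sum_pd (v : Rn n) : fderiv ℝ F y v = ∑ i, v i * pd i F y := by
  have hv : v = ∑ i, v i • (EuclideanSpace.single i (1 : ℝ) : Rn n) := by
    ext j
    simp [Finset.sum_apply, Pi.single_apply]
  conv_lhs => rw [hv]
  simp [pd]

theorem _root_.ContDiffAt.pd {k : WithTop ℕ∞} {l : WithTop ℕ∞} (h : ContDiffAt ℝ l F y)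
    (hk : k + 1 ≤ l) (i : Fin n) : ContDiffAt ℝ k (pd i F) y :=
  (h.fderiv_right hk).clm_apply contDiffAt_const

theorem pd_comm (h : ContDiffAt ℝ 2 F y) (i j : Fin n) :
    pd i (pd j F) y = pd j (pd i F) y := by
  have hd : DifferentiableAt ℝ (fderiv ℝ F) y :=
    (h.fderiv_right (m := 1) (by norm_num)).differentiableAt (by norm_num)
  have key : ∀ a b : Fin n, pd a (pd b F) y =
      fderiv ℝ (fderiv ℝ F) y (EuclideanSpace.single a 1) (EuclideanSpace.single b 1) := by
    intro a b
    have : pd b F = fun z ↦ fderiv ℝ F z (EuclideanSpace.single b 1) := rfl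
    rw [this, pd, fderiv_clm_apply hd (by fun_prop)]
    simp
  rw [key, key]
  exact (h.isSymmSndFDerivAt (by simp)).eq _ _

variable {A : Rn n → Matrix (Fin n) (Fin n) ℝ}

theorem contDiffAt_det {ι : Type*} [Fintype ι] [DecidableEq ι] {E : Type*}
    [NormedAddCommGroup E] [NormedSpace ℝ E] {x : E}
    {A : E → Matrix ι ι ℝ} {k : WithTop ℕ∞}
    (h : ∀ i j, ContDiffAt ℝ k (fun z ↦ A z i j) x) : ContDiffAt ℝ k (fun z ↦ (A z).det) x := by
  simp only [Matrix.det_apply]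
  refine ContDiffAt.sum fun σ _ ↦ ContDiffAt.const_smul _ (contDiffAt_prod fun i _ ↦ h _ _)

/-- Cramer's formula: up to the factor 1/det, each entry of the inverse is a determinant with one
row replaced by a constant one. -/
theorem contDiffAt_inv_entry {k : WithTop ℕ∞} (h : ∀ i j, ContDiffAt ℝ k (fun z ↦ A z i j) y)
    (hd : (A y).det ≠ 0) (i j : Fin n) : ContDiffAt ℝ k (fun z ↦ (A z)⁻¹ i j) y := by
  simp only [Matrix.inv_def, Ring.inverse_eq_inv', Matrix.smul_apply, smul_eq_mul,
    Matrix.adjugate_apply]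
  refine ((contDiffAt_det h).inv hd).mul (contDiffAt_det fun a b ↦ ?_)
  by_cases hab : a = j
  · subst hab
    simp only [Matrix.updateRow_self]
    exact contDiffAt_const
  · simp only [Matrix.updateRow_ne hab]
    exact h a b

/-- Obtained by differentiating A A⁻¹ = 1, which holds in a whole neighbourhood of y because the
determinant stays nonzero there. -/
theorem pd_inv_entry (h : ∀ i j, ContDiffAt ℝ 1 (fun z ↦ A z i j) y) (hd : (A y).det ≠ 0)
    (l i j : Fin n) :
    pd l (fun z ↦ (A z)⁻¹ i j) y
      = -∑ a, ∑ b, (A y)⁻¹ i a * pd l (fun z ↦ A z a b) y * (A y)⁻¹ b j := by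
  set dA : Matrix (Fin n) (Fin n) ℝ := Matrix.of fun a b ↦ pd l (fun z ↦ A z a b) y
  set dB : Matrix (Fin n) (Fin n) ℝ := Matrix.of fun a b ↦ pd l (fun z ↦ (A z)⁻¹ a b) y
  have hA : ∀ a b, DifferentiableAt ℝ (fun z ↦ A z a b) y :=
    fun a b ↦ (h a b).differentiableAt (by norm_num)
  have hB : ∀ a b, DifferentiableAt ℝ (fun z ↦ (A z)⁻¹ a b) y :=
    fun a b ↦ (contDiffAt_inv_entry h hd a b).differentiableAt (by norm_num)
  have hev : ∀ᶠ z in 𝓝 y, (A z).det ≠ 0 :=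
    (contDiffAt_det h).continuousAt.eventually_ne hd
  have hsum : dA * (A y)⁻¹ + A y * dB = 0 := by
    ext a b
    have h0 : pd l (fun z ↦ ∑ c, A z a c * (A z)⁻¹ c b) y = 0 := by
      rw [← pd_const (y := y) l ((1 : Matrix (Fin n) (Fin n) ℝ) a b)]
      apply pd_congr
      filter_upwards [hev] with z hz
      rw [← Matrix.mul_apply, Matrix.mul_nonsing_inv _ (isUnit_iff_ne_zero.2 hz)]
    rw [pd_sum l fun c ↦ (hA a c).fun_mul (hB c b)] at h0
    simp only [pd_mul l (hA a _) (hB _ b), Finset.sum_add_distrib] at h0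
    simpa [Matrix.mul_apply, dA, dB] using h0
  have : dB = -((A y)⁻¹ * dA * (A y)⁻¹) := by
    have h1 : (A y)⁻¹ * (A y * dB) = dB := by
      rw [← Matrix.mul_assoc, Matrix.nonsing_inv_mul _ (isUnit_iff_ne_zero.2 hd), Matrix.one_mul]
    rw [← h1, eq_neg_of_add_eq_zero_right hsum]
    simp [Matrix.mul_assoc]
  have h2 := congrFun (congrFun this i) j
  simp only [dB, dA, Matrix.of_apply, Matrix.neg_apply, Matrix.mul_apply, Finset.sum_mul] at h2
  rw [h2, Finset.sum_comm]

/-- Jacobi's formula. The derivative of the Leibniz expansion regroups into determinants with one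
column differentiated, and Cramer's rule evaluates each of them. -/
theorem pd_det (h : ∀ i j, DifferentiableAt ℝ (fun z ↦ A z i j) y) (hd : (A y).det ≠ 0)
    (l : Fin n) :
    pd l (fun z ↦ (A z).det) y
      = (A y).det * ∑ i, ∑ j, (A y)⁻¹ i j * pd l (fun z ↦ A z j i) y := by
  have hprod : ∀ σ : Equiv.Perm (Fin n), HasFDerivAt (fun z ↦ ∏ i, A z (σ i) i)
      (∑ i, (∏ j ∈ Finset.univ.erase i, A y (σ j) j) • fderiv ℝ (fun z ↦ A z (σ i) i) y) y :=
    fun σ ↦ HasFDerivAt.finsetProd fun i _ ↦ (h _ _).hasFDerivAt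
  have hdet := HasFDerivAt.fun_sum (u := Finset.univ) fun (σ : Equiv.Perm (Fin n)) _ ↦
    (hprod σ).fun_const_smul (Equiv.Perm.sign σ : ℤ)
  have hcol : ∀ i, ((A y).updateCol i fun a ↦ pd l (fun z ↦ A z a i) y).det
      = ∑ σ : Equiv.Perm (Fin n), (Equiv.Perm.sign σ : ℤ) •
        ((∏ j ∈ Finset.univ.erase i, A y (σ j) j) * pd l (fun z ↦ A z (σ i) i) y) := by
    intro i
    rw [Matrix.det_apply]
    refine Finset.sum_congr rfl fun σ _ ↦ ?_
    rw [← Finset.prod_erase_mul _ _ (Finset.mem_univ i), Matrix.updateCol_self, Units.smul_def]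
    congr 2
    refine Finset.prod_congr rfl fun j hj ↦ ?_
    rw [Matrix.updateCol_ne (Finset.ne_of_mem_erase hj)]
  have : pd l (fun z ↦ (A z).det) y
      = ∑ i, ((A y).updateCol i fun a ↦ pd l (fun z ↦ A z a i) y).det := by
    have he : (fun z ↦ (A z).det)
        = fun z ↦ ∑ σ : Equiv.Perm (Fin n), (Equiv.Perm.sign σ : ℤ) • ∏ i, A z (σ i) i := by
      funext z
      rw [Matrix.det_apply]
      rfl
    simp only [hcol]
    rw [he, pd, hdet.fderiv, Finset.sum_comm]
    simp [pd, Finset.smul_sum]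
  rw [this, Finset.mul_sum]
  refine Finset.sum_congr rfl fun i _ ↦ ?_
  rw [← Matrix.cramer_apply, Matrix.cramer_eq_adjugate_mulVec, Matrix.mulVec, dotProduct,
    Finset.mul_sum]
  refine Finset.sum_congr rfl fun j _ ↦ ?_
  rw [Matrix.inv_def, Ring.inverse_eq_inv', Matrix.smul_apply, smul_eq_mul]
  field_simp

end CoordinateCalculus

/-! ### Index algebra: contractions of Christoffel symbols and the Lie derivative of the connection
-/

section IndexAlgebra

variable {ι : Type*} [Fintype ι]

/-- Renaming of dummy indices. This and the next three lemmas bring two multiple sums to the same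
order, after which they can be compared term by term. -/
theorem sum_reverse₄ (F : ι → ι → ι → ι → ℝ) :
    ∑ i, ∑ j, ∑ k, ∑ m, F i j k m = ∑ i, ∑ j, ∑ k, ∑ m, F m k j i := by
  let e : ι × ι × ι × ι ≃ ι × ι × ι × ι :=
    ⟨fun x ↦ (x.2.2.2, x.2.2.1, x.2.1, x.1), fun x ↦ (x.2.2.2, x.2.2.1, x.2.1, x.1),
      fun _ ↦ rfl, fun _ ↦ rfl⟩
  have := e.sum_comp fun x ↦ F x.1 x.2.1 x.2.2.1 x.2.2.2
  simpa only [Fintype.sum_prod_type, e, Equiv.coe_fn_mk] using this.symm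

theorem sum_rotate₄ (F : ι → ι → ι → ι → ℝ) :
    ∑ i, ∑ j, ∑ k, ∑ m, F i j k m = ∑ i, ∑ j, ∑ k, ∑ m, F k i j m := by
  let e : ι × ι × ι × ι ≃ ι × ι × ι × ι :=
    ⟨fun x ↦ (x.2.2.1, x.1, x.2.1, x.2.2.2), fun x ↦ (x.2.1, x.2.2.1, x.1, x.2.2.2),
      fun _ ↦ rfl, fun _ ↦ rfl⟩
  have := e.sum_comp fun x ↦ F x.1 x.2.1 x.2.2.1 x.2.2.2
  simpa only [Fintype.sum_prod_type, e, Equiv.coe_fn_mk] using this.symm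

theorem sum_rotate₃ (F : ι → ι → ι → ℝ) :
    ∑ i, ∑ j, ∑ k, F i j k = ∑ i, ∑ j, ∑ k, F k i j := by
  let e : ι × ι × ι ≃ ι × ι × ι :=
    ⟨fun x ↦ (x.2.2, x.1, x.2.1), fun x ↦ (x.2.1, x.2.2, x.1), fun _ ↦ rfl, fun _ ↦ rfl⟩
  have := e.sum_comp fun x ↦ F x.1 x.2.1 x.2.2
  simpa only [Fintype.sum_prod_type, e, Equiv.coe_fn_mk] using this.symm

theorem sum_reverse₃ (F : ι → ι → ι → ℝ) :
    ∑ i, ∑ j, ∑ k, F i j k = ∑ i, ∑ j, ∑ k, F k j i := by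
  let e : ι × ι × ι ≃ ι × ι × ι :=
    ⟨fun x ↦ (x.2.2, x.2.1, x.1), fun x ↦ (x.2.2, x.2.1, x.1), fun _ ↦ rfl, fun _ ↦ rfl⟩
  have := e.sum_comp fun x ↦ F x.1 x.2.1 x.2.2
  simpa only [Fintype.sum_prod_type, e, Equiv.coe_fn_mk] using this.symm

theorem sum_mul_sum_sum (a : ι → ℝ) (B : Matrix ι ι ℝ) (F : ι → ι → ι → ℝ) :
    ∑ k, a k * ∑ i, ∑ j, B i j * F k i j = ∑ i, ∑ j, B i j * ∑ k, a k * F k i j := by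
  simp only [Finset.mul_sum]
  rw [sum_rotate₃]
  exact Finset.sum_congr rfl fun i _ ↦ Finset.sum_congr rfl fun j _ ↦
    Finset.sum_congr rfl fun k _ ↦ by ring

/-- Christoffel symbols of the second kind, from the inverse metric `B` and the derivatives
`d l i j = ∂ₗ gᵢⱼ` of the metric. -/
def christoffelOf (B : Matrix ι ι ℝ) (d : ι → ι → ι → ℝ) (k i j : ι) : ℝ :=
  (1 / 2) * ∑ l, B k l * (d i j l + d j i l - d l i j)

variable {B : Matrix ι ι ℝ} {d : ι → ι → ι → ℝ}

/-- Contraction of a Christoffel symbol with a symmetric tensor. -/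
theorem sum_christoffelOf_contract (hB : B.IsSymm) (hd : ∀ l i j, d l i j = d l j i)
    {S : Matrix ι ι ℝ} (hS : S.IsSymm) (l : ι) :
    ∑ i, ∑ j, B i j * ∑ k, christoffelOf B d k i l * S j k
      = (1 / 2) * ∑ i, ∑ j, ∑ k, ∑ m, B i j * B k m * d l i m * S j k := by
  -- Reversing the four indices exchanges the first and third terms of the Christoffel symbol, since
  -- B, S and the metric derivatives are symmetric. These terms cancel, and only ∂ₗ g survives.
  have h1 : ∑ i, ∑ j, ∑ k, ∑ m, B i j * B k m * d i l m * S j k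
      = ∑ i, ∑ j, ∑ k, ∑ m, B i j * B k m * d m i l * S j k := by
    rw [sum_reverse₄]
    refine Finset.sum_congr rfl fun i _ ↦ Finset.sum_congr rfl fun j _ ↦
      Finset.sum_congr rfl fun k _ ↦ Finset.sum_congr rfl fun m _ ↦ ?_
    rw [hB.apply k m, hB.apply i j, hd m i l, hS.apply j k]; ring
  have h2 : ∑ i, ∑ j, B i j * ∑ k, christoffelOf B d k i l * S j k
      = (1 / 2) * (∑ i, ∑ j, ∑ k, ∑ m, B i j * B k m * d i l m * S j k
        + ∑ i, ∑ j, ∑ k, ∑ m, B i j * B k m * d l i m * S j k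
        - ∑ i, ∑ j, ∑ k, ∑ m, B i j * B k m * d m i l * S j k) := by
    simp only [← Finset.sum_add_distrib, ← Finset.sum_sub_distrib, Finset.mul_sum, Finset.sum_mul,
      christoffelOf]
    refine Finset.sum_congr rfl fun i _ ↦ Finset.sum_congr rfl fun j _ ↦
      Finset.sum_congr rfl fun k _ ↦ Finset.sum_congr rfl fun m _ ↦ ?_
    ring
  rw [h2, h1]; ring

variable [DecidableEq ι]

/-- Lowering the index gives the symbols of the first kind, which no longer involve the inverse
metric. Differentiating this relation later gives access to ∂Γ. -/
theorem sum_mul_christoffelOf {A : Matrix ι ι ℝ} (hAB : A * B = 1) (l i j : ι) :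
    ∑ k, A l k * christoffelOf B d k i j = (1 / 2) * (d i j l + d j i l - d l i j) := by
  have h : ∀ m, ∑ k, A l k * B k m = if l = m then 1 else 0 := fun m ↦ by
    rw [← Matrix.mul_apply, hAB, Matrix.one_apply]
  simp only [christoffelOf, Finset.mul_sum]
  rw [Finset.sum_comm]
  have : ∀ m, ∑ k, A l k * (1 / 2 * (B k m * (d i j m + d j i m - d m i j)))
      = (if l = m then 1 else 0) * ((1 / 2) * (d i j m + d j i m - d m i j)) := fun m ↦ by
    rw [← h m, Finset.sum_mul]
    exact Finset.sum_congr rfl fun k _ ↦ by ring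
  rw [Finset.sum_congr rfl fun m _ ↦ this m]
  simp

/-- The index identity behind `g (L_ξ ∇) = ½ (∇ s + ∇ s - ∇ s)` for `s = L_ξ g`: here `X`, `dX`,
`ddX` are the components of `ξ` and its derivatives, `d` and `dd` the derivatives of the metric,
and `dΓ` that of the Christoffel symbols. -/
theorem lie_connection_index_identity {A : Matrix ι ι ℝ} (hA : A.IsSymm) (hAB : A * B = 1)
    (hd : ∀ l i j, d l i j = d l j i)
    {dd : ι → ι → ι → ι → ℝ} (hdd : ∀ a b i j, dd a b i j = dd b a i j)
    {dΓ : ι → ι → ι → ι → ℝ}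
    (hdΓ : ∀ c l i j, ∑ k, (d c l k * christoffelOf B d k i j + A l k * dΓ c k i j)
      = (1 / 2) * (dd c i j l + dd c j i l - dd c l i j))
    (X : ι → ℝ) (dX : ι → ι → ℝ) {ddX : ι → ι → ι → ℝ} (hddX : ∀ i j k, ddX i j k = ddX j i k)
    (s : Matrix ι ι ℝ) (hs : ∀ i j, s i j = ∑ k, (X k * d k i j + A k j * dX i k + A i k * dX j k))
    {ds : ι → ι → ι → ℝ}
    (hds : ∀ l i j, ds l i j = ∑ k, (dX l k * d k i j + X k * dd l k i j
      + (d l k j * dX i k + A k j * ddX l i k) + (d l i k * dX j k + A i k * ddX l j k)))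
    (l i j : ι) :
    ∑ k, A l k * (ddX i j k - ∑ m, christoffelOf B d m i j * dX m k + ∑ c, X c * dΓ c k i j
        + ∑ a, christoffelOf B d k a j * dX i a + ∑ b, christoffelOf B d k i b * dX j b)
      = (1 / 2) * (ds i j l + ds j i l - ds l i j) - ∑ k, christoffelOf B d k i j * s k l := by
  have low := fun l i j ↦ sum_mul_christoffelOf (d := d) hAB l i j
  -- `hdΓ` trades the derivatives of Γ for second derivatives of the metric and a term Γ · X · ∂g.
  -- That term occurs again in `e4`, so it cancels between the two sides.
  have e1 : ∑ k, A l k * ∑ c, X c * dΓ c k i j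
      = ∑ c, X c * ((1 / 2) * (dd c i j l + dd c j i l - dd c l i j))
        - ∑ k, ∑ c, christoffelOf B d k i j * (X c * d c k l) := by
    simp only [← hdΓ, Finset.mul_sum]
    rw [Finset.sum_comm, Finset.sum_comm (f := fun k c ↦ christoffelOf B d k i j * (X c * d c k l)),
      ← Finset.sum_sub_distrib]
    refine Finset.sum_congr rfl fun c _ ↦ ?_
    rw [← Finset.sum_sub_distrib]
    refine Finset.sum_congr rfl fun k _ ↦ ?_
    rw [hd c k l]; ring
  have e2 : ∑ k, A l k * ∑ a, christoffelOf B d k a j * dX i a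
      = ∑ a, ((1 / 2) * (d a j l + d j a l - d l a j)) * dX i a := by
    simp only [← low, Finset.mul_sum, Finset.sum_mul]
    rw [Finset.sum_comm]
    exact Finset.sum_congr rfl fun c _ ↦ Finset.sum_congr rfl fun k _ ↦ by ring
  have e3 : ∑ k, A l k * ∑ b, christoffelOf B d k i b * dX j b
      = ∑ b, ((1 / 2) * (d i b l + d b i l - d l i b)) * dX j b := by
    simp only [← low, Finset.mul_sum, Finset.sum_mul]
    rw [Finset.sum_comm]
    exact Finset.sum_congr rfl fun c _ ↦ Finset.sum_congr rfl fun k _ ↦ by ring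
  have e4 : ∑ k, christoffelOf B d k i j * s k l
      = ∑ k, ∑ c, christoffelOf B d k i j * (X c * d c k l)
        + ∑ k, A l k * ∑ m, christoffelOf B d m i j * dX m k
        + ∑ c, ((1 / 2) * (d i j c + d j i c - d c i j)) * dX l c := by
    have : ∑ c, ((1 / 2) * (d i j c + d j i c - d c i j)) * dX l c
        = ∑ k, ∑ c, christoffelOf B d k i j * (A k c * dX l c) := by
      simp only [← low, Finset.sum_mul]
      rw [Finset.sum_comm]
      refine Finset.sum_congr rfl fun c _ ↦ Finset.sum_congr rfl fun k _ ↦ ?_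
      rw [hA.apply c k]; ring
    have h' : ∑ k, A l k * ∑ m, christoffelOf B d m i j * dX m k
        = ∑ k, ∑ c, christoffelOf B d k i j * (A c l * dX k c) := by
      simp only [Finset.mul_sum]
      rw [Finset.sum_comm]
      refine Finset.sum_congr rfl fun c _ ↦ Finset.sum_congr rfl fun k _ ↦ ?_
      rw [hA.apply k l]; ring
    rw [this, h']
    simp only [hs, Finset.mul_sum, ← Finset.sum_add_distrib]
    exact Finset.sum_congr rfl fun c _ ↦ Finset.sum_congr rfl fun k _ ↦ by ring
  have e5 : ∑ k, A l k * (ddX i j k - ∑ m, christoffelOf B d m i j * dX m k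
        + ∑ c, X c * dΓ c k i j + ∑ a, christoffelOf B d k a j * dX i a
        + ∑ b, christoffelOf B d k i b * dX j b)
      = ∑ k, A l k * ddX i j k - ∑ k, A l k * ∑ m, christoffelOf B d m i j * dX m k
        + ∑ k, A l k * ∑ c, X c * dΓ c k i j + ∑ k, A l k * ∑ a, christoffelOf B d k a j * dX i a
        + ∑ k, A l k * ∑ b, christoffelOf B d k i b * dX j b := by
    simp only [← Finset.sum_add_distrib, ← Finset.sum_sub_distrib]
    exact Finset.sum_congr rfl fun k _ ↦ by ring
  rw [e5, e1, e2, e3, e4]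
  -- In this combination of the derivatives of s, the second derivatives of X that carry the index l
  -- cancel by symmetry; A · ∂ᵢ∂ⱼX remains.
  have e6 : (1 / 2) * (ds i j l + ds j i l - ds l i j)
      = ∑ k, A l k * ddX i j k
        + ∑ c, X c * ((1 / 2) * (dd c i j l + dd c j i l - dd c l i j))
        + ∑ a, ((1 / 2) * (d a j l + d j a l - d l a j)) * dX i a
        + ∑ b, ((1 / 2) * (d i b l + d b i l - d l i b)) * dX j b
        + ∑ c, ((1 / 2) * (d i j c + d j i c - d c i j)) * dX l c := by
    simp only [hds, ← Finset.sum_add_distrib, ← Finset.sum_sub_distrib, Finset.mul_sum]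
    refine Finset.sum_congr rfl fun k _ ↦ ?_
    rw [hdd i k, hdd j k, hdd l k, hddX j i, hddX l i, hddX l j, hA.apply l k, hA.apply k j]
    ring
  rw [e6]; ring

end IndexAlgebra

/-! ### The stress divergence of a two-tensor in coordinates -/

section StressDivergence

variable {n : ℕ}

/-- The Christoffel symbols of a matrix-valued function on `ℝⁿ`, seen as a metric. -/
def metricChristoffel (A : Rn n → Matrix (Fin n) (Fin n) ℝ) (k i j : Fin n) (y : Rn n) : ℝ :=
  christoffelOf (A y)⁻¹ (fun l a b ↦ pd l (fun z ↦ A z a b) y) k i j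

/-- The components `gⁱʲ (∇ᵢ hⱼₗ - ½ ∇ₗ hᵢⱼ)` of the divergence of the stress tensor
`h - ½ (trace h) g`. -/
def stressDiv (A H : Rn n → Matrix (Fin n) (Fin n) ℝ) (l : Fin n) (y : Rn n) : ℝ :=
  ∑ i, ∑ j, (A y)⁻¹ i j * (pd i (fun z ↦ H z j l) y - (1 / 2) * pd l (fun z ↦ H z i j) y
    - ∑ k, metricChristoffel A k i j y * H y k l)

/-- The components of the Lie derivative of the metric `A` along `X`. -/
def lieMatrix (A : Rn n → Matrix (Fin n) (Fin n) ℝ) (X : Rn n → Fin n → ℝ) (y : Rn n) :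
    Matrix (Fin n) (Fin n) ℝ :=
  Matrix.of fun i j ↦ ∑ k, (X y k * pd k (fun z ↦ A z i j) y
    + A y k j * pd i (fun z ↦ X z k) y + A y i k * pd j (fun z ↦ X z k) y)

/-- The components `(L_X ∇)ᵏᵢⱼ` of the Lie derivative of the connection. -/
def lieConnection (A : Rn n → Matrix (Fin n) (Fin n) ℝ) (X : Rn n → Fin n → ℝ) (k i j : Fin n)
    (y : Rn n) : ℝ :=
  pd i (pd j fun z ↦ X z k) y
    - ∑ m, metricChristoffel A m i j y * pd m (fun z ↦ X z k) y
    + ∑ c, X y c * pd c (metricChristoffel A k i j) y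
    + ∑ a, metricChristoffel A k a j y * pd i (fun z ↦ X z a) y
    + ∑ b, metricChristoffel A k i b y * pd j (fun z ↦ X z b) y

/-- The components `gⁱʲ (L_X ∇)ᵏᵢⱼ` of the trace of the Lie derivative of the connection. -/
def lieTension (A : Rn n → Matrix (Fin n) (Fin n) ℝ) (X : Rn n → Fin n → ℝ) (k : Fin n)
    (y : Rn n) : ℝ :=
  ∑ i, ∑ j, (A y)⁻¹ i j * lieConnection A X k i j y

/-- `A` is, near `y`, the matrix of components of a smooth metric. -/
structure IsMetricAt (A : Rn n → Matrix (Fin n) (Fin n) ℝ) (y : Rn n) : Prop where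
  smooth : ∀ i j, ContDiffAt ℝ ∞ (fun z ↦ A z i j) y
  symm : ∀ᶠ z in 𝓝 y, (A z).IsSymm
  pos : 0 < (A y).det

variable {A H : Rn n → Matrix (Fin n) (Fin n) ℝ} {y : Rn n}

namespace IsMetricAt

theorem smooth_inv (hA : IsMetricAt A y) (i j : Fin n) :
    ContDiffAt ℝ ∞ (fun z ↦ (A z)⁻¹ i j) y :=
  contDiffAt_inv_entry hA.smooth hA.pos.ne' i j

theorem differentiableAt (hA : IsMetricAt A y) (i j : Fin n) :
    DifferentiableAt ℝ (fun z ↦ A z i j) y :=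
  (hA.smooth i j).differentiableAt (by simp)

theorem differentiableAt_inv (hA : IsMetricAt A y) (i j : Fin n) :
    DifferentiableAt ℝ (fun z ↦ (A z)⁻¹ i j) y :=
  (hA.smooth_inv i j).differentiableAt (by simp)

theorem symm_inv (hA : IsMetricAt A y) : ((A y)⁻¹).IsSymm := by
  rw [Matrix.IsSymm, Matrix.transpose_nonsing_inv, hA.symm.self_of_nhds.eq]

theorem mul_inv (hA : IsMetricAt A y) : A y * (A y)⁻¹ = 1 :=
  Matrix.mul_nonsing_inv _ (isUnit_iff_ne_zero.2 hA.pos.ne')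

theorem inv_mul (hA : IsMetricAt A y) : (A y)⁻¹ * A y = 1 :=
  Matrix.nonsing_inv_mul _ (isUnit_iff_ne_zero.2 hA.pos.ne')

theorem pd_symm (hA : IsMetricAt A y) (l i j : Fin n) :
    pd l (fun z ↦ A z i j) y = pd l (fun z ↦ A z j i) y :=
  pd_congr (hA.symm.mono fun _ hz ↦ hz.apply j i)

theorem smooth_christoffel (hA : IsMetricAt A y) (k i j : Fin n) :
    ContDiffAt ℝ ∞ (metricChristoffel A k i j) y := by
  have hp : ∀ l i j, ContDiffAt ℝ ∞ (pd l fun z ↦ A z i j) y :=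
    fun l i j ↦ (hA.smooth i j).pd (by simp) l
  exact contDiffAt_const.mul (ContDiffAt.sum fun l _ ↦ (hA.smooth_inv k l).mul
    (((hp i j l).add (hp j i l)).sub (hp l i j)))

/-- Metric compatibility: trace commutes with ∇. The derivative of the inverse metric is a fourfold
sum which `sum_christoffelOf_contract` recognises as the two equal Christoffel terms of ∇ₗ h. -/
theorem pd_trace (hA : IsMetricAt A y) (hH : ∀ i j, DifferentiableAt ℝ (fun z ↦ H z i j) y)
    (hs : (H y).IsSymm) (l : Fin n) :
    pd l (fun z ↦ ∑ i, ∑ j, (A z)⁻¹ i j * H z i j) y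
      = ∑ i, ∑ j, (A y)⁻¹ i j * pd l (fun z ↦ H z i j) y
        - 2 * ∑ i, ∑ j, (A y)⁻¹ i j * ∑ k, metricChristoffel A k i l y * H y j k := by
  have hB := hA.differentiableAt_inv
  rw [pd_sum l fun i ↦ DifferentiableAt.fun_sum fun j _ ↦ (hB i j).fun_mul (hH i j)]
  simp only [pd_sum l fun j ↦ (hB _ j).fun_mul (hH _ j), pd_mul l (hB _ _) (hH _ _),
    Finset.sum_add_distrib]
  have hc := sum_christoffelOf_contract hA.symm_inv (d := fun l a b ↦ pd l (fun z ↦ A z a b) y)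
    hA.pd_symm hs l
  simp only [metricChristoffel, hc]
  have : ∑ i, ∑ j, pd l (fun z ↦ (A z)⁻¹ i j) y * H y i j
      = -∑ i, ∑ j, ∑ k, ∑ m, (A y)⁻¹ i j * (A y)⁻¹ k m * pd l (fun z ↦ A z i m) y * H y j k := by
    rw [sum_rotate₄ (fun i j k m ↦ (A y)⁻¹ i j * (A y)⁻¹ k m * pd l (fun z ↦ A z i m) y * H y j k)]
    simp only [pd_inv_entry (fun i j ↦ (hA.smooth i j).of_le (by simp)) hA.pos.ne',
      ← Finset.sum_neg_distrib, Finset.sum_mul]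
    refine Finset.sum_congr rfl fun i _ ↦ Finset.sum_congr rfl fun j _ ↦
      Finset.sum_congr rfl fun k _ ↦ Finset.sum_congr rfl fun m _ ↦ ?_
    rw [hA.symm_inv.apply i k, hA.symm_inv.apply j m]; ring
  rw [this]; ring

/-- Of the two Christoffel terms in ∇ᵢ hⱼₗ, the one contracted against the free index l is absorbed
into the derivative of the trace. This is why `stressDiv` contains a single Christoffel term. -/
theorem divergence_eq (hA : IsMetricAt A y) (hH : ∀ i j, DifferentiableAt ℝ (fun z ↦ H z i j) y)
    (hs : (H y).IsSymm) (l : Fin n) :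
    ∑ i, ∑ j, (A y)⁻¹ i j * (pd i (fun z ↦ H z j l) y - ∑ k, metricChristoffel A k i j y * H y k l
        - ∑ k, metricChristoffel A k i l y * H y j k)
      = stressDiv A H l y + (1 / 2) * pd l (fun z ↦ ∑ i, ∑ j, (A z)⁻¹ i j * H z i j) y := by
  rw [hA.pd_trace hH hs, stressDiv]
  have h1 : ∑ i, ∑ j, (A y)⁻¹ i j * (pd i (fun z ↦ H z j l) y
        - ∑ k, metricChristoffel A k i j y * H y k l - ∑ k, metricChristoffel A k i l y * H y j k)
      = stressDiv A H l y + (1 / 2) * ∑ i, ∑ j, (A y)⁻¹ i j * pd l (fun z ↦ H z i j) y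
        - ∑ i, ∑ j, (A y)⁻¹ i j * ∑ k, metricChristoffel A k i l y * H y j k := by
    rw [stressDiv, Finset.mul_sum]
    simp only [Finset.mul_sum (a := (1 / 2 : ℝ)), ← Finset.sum_add_distrib,
      ← Finset.sum_sub_distrib]
    exact Finset.sum_congr rfl fun i _ ↦ Finset.sum_congr rfl fun j _ ↦ by ring
  rw [h1, stressDiv]; ring

theorem sum_inv_mul_self (hA : IsMetricAt A y) : ∑ i, ∑ j, (A y)⁻¹ i j * A y i j = n := by
  have h := congrArg Matrix.trace hA.inv_mul
  simp only [Matrix.trace, Matrix.diag, Matrix.mul_apply, Matrix.one_apply_eq, Finset.sum_const,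
    Finset.card_univ, Fintype.card_fin, nsmul_eq_mul, mul_one] at h
  rw [← h]
  refine Finset.sum_congr rfl fun i _ ↦ Finset.sum_congr rfl fun j _ ↦ ?_
  rw [hA.symm.self_of_nhds.apply]

theorem sum_mul_christoffel (hA : IsMetricAt A y) (l i j : Fin n) :
    ∑ k, A y l k * metricChristoffel A k i j y
      = (1 / 2) * (pd i (fun z ↦ A z j l) y + pd j (fun z ↦ A z i l) y
        - pd l (fun z ↦ A z i j) y) :=
  sum_mul_christoffelOf (d := fun l a b ↦ pd l (fun z ↦ A z a b) y) hA.mul_inv l i j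

/-- As ∇g = 0, the divergence of u g is du and its trace is n u. In components, the lowered
Christoffel symbols cancel the derivatives of the metric. -/
theorem stressDiv_smul_metric (hA : IsMetricAt A y) {u : Rn n → ℝ} (hu : DifferentiableAt ℝ u y)
    (l : Fin n) :
    stressDiv A (fun z ↦ u z • A z) l y = (1 - (n : ℝ) / 2) * pd l u y := by
  have hl : ∀ i j, ∑ k, metricChristoffel A k i j y * (u y * A y k l)
      = u y * ((1 / 2) * (pd i (fun z ↦ A z j l) y + pd j (fun z ↦ A z i l) y
        - pd l (fun z ↦ A z i j) y)) := fun i j ↦ by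
    rw [← hA.sum_mul_christoffel, Finset.mul_sum]
    refine Finset.sum_congr rfl fun k _ ↦ ?_
    rw [hA.symm.self_of_nhds.apply l k]; ring
  have hswap : ∑ i, ∑ j, (A y)⁻¹ i j * pd j (fun z ↦ A z i l) y
      = ∑ i, ∑ j, (A y)⁻¹ i j * pd i (fun z ↦ A z j l) y := by
    rw [Finset.sum_comm]
    refine Finset.sum_congr rfl fun i _ ↦ Finset.sum_congr rfl fun j _ ↦ ?_
    rw [hA.symm_inv.apply]
  have hdelta : ∑ i, ∑ j, (A y)⁻¹ i j * (pd i u y * A y j l) = pd l u y := by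
    have : ∀ i, ∑ j, (A y)⁻¹ i j * (pd i u y * A y j l)
        = pd i u y * (1 : Matrix (Fin n) (Fin n) ℝ) i l := fun i ↦ by
      rw [← hA.inv_mul, Matrix.mul_apply, Finset.mul_sum]
      exact Finset.sum_congr rfl fun j _ ↦ by ring
    simp [this, Matrix.one_apply]
  have h1 : stressDiv A (fun z ↦ u z • A z) l y
      = ∑ i, ∑ j, (A y)⁻¹ i j * (pd i u y * A y j l)
        - (1 / 2) * pd l u y * ∑ i, ∑ j, (A y)⁻¹ i j * A y i j
        + (1 / 2) * u y * ∑ i, ∑ j, (A y)⁻¹ i j * pd i (fun z ↦ A z j l) y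
        - (1 / 2) * u y * ∑ i, ∑ j, (A y)⁻¹ i j * pd j (fun z ↦ A z i l) y := by
    simp only [stressDiv, Matrix.smul_apply, smul_eq_mul, hl,
      pd_mul _ hu (hA.differentiableAt _ _)]
    rw [Finset.mul_sum, Finset.mul_sum, Finset.mul_sum, ← Finset.sum_sub_distrib,
      ← Finset.sum_add_distrib, ← Finset.sum_sub_distrib]
    refine Finset.sum_congr rfl fun i _ ↦ ?_
    rw [Finset.mul_sum, Finset.mul_sum, Finset.mul_sum, ← Finset.sum_sub_distrib,
      ← Finset.sum_add_distrib, ← Finset.sum_sub_distrib]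
    exact Finset.sum_congr rfl fun j _ ↦ by ring
  rw [h1, hdelta, hA.sum_inv_mul_self, hswap]; ring

theorem contDiffAt_sqrt_det (hA : IsMetricAt A y) : ContDiffAt ℝ ∞ (fun z ↦ √(A z).det) y :=
  (contDiffAt_det hA.smooth).sqrt hA.pos.ne'

theorem pd_sqrt_det (hA : IsMetricAt A y) (l : Fin n) :
    pd l (fun z ↦ √(A z).det) y
      = (1 / 2) * √(A y).det * ∑ i, ∑ j, (A y)⁻¹ i j * pd l (fun z ↦ A z i j) y := by
  have hd : DifferentiableAt ℝ (fun z ↦ (A z).det) y :=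
    (contDiffAt_det hA.smooth).differentiableAt (by simp)
  have h1 : pd l (fun z ↦ √(A z).det) y = 1 / (2 * √(A y).det) * pd l (fun z ↦ (A z).det) y := by
    rw [pd, (hd.hasFDerivAt.sqrt hA.pos.ne').fderiv]; simp [pd]
  have h2 : √(A y).det ≠ 0 := (Real.sqrt_pos.2 hA.pos).ne'
  rw [h1, pd_det hA.differentiableAt hA.pos.ne']
  have h4 : 1 / (2 * √(A y).det) * (A y).det = 1 / 2 * √(A y).det := by
    field_simp
    exact (Real.sq_sqrt hA.pos.le).symm
  rw [← mul_assoc, h4]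
  congr 1
  exact Finset.sum_congr rfl fun i _ ↦ Finset.sum_congr rfl fun j _ ↦ by rw [hA.pd_symm]

/-- `∂ᵢ (√g gⁱᵏ) = - √g gⁱʲ Γᵏᵢⱼ`. -/
theorem sum_pd_sqrt_det_mul_inv (hA : IsMetricAt A y) (k : Fin n) :
    ∑ i, pd i (fun z ↦ √(A z).det * (A z)⁻¹ i k) y
      = -√(A y).det * ∑ i, ∑ j, (A y)⁻¹ i j * metricChristoffel A k i j y := by
  have hq := hA.contDiffAt_sqrt_det.differentiableAt (by simp)
  have hB := hA.symm_inv
  have e1 : ∑ i, pd i (fun z ↦ √(A z).det * (A z)⁻¹ i k) y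
      = √(A y).det * ((1 / 2) * ∑ i, ∑ a, ∑ b,
          (A y)⁻¹ a b * pd i (fun z ↦ A z a b) y * (A y)⁻¹ i k
        - ∑ i, ∑ a, ∑ b, (A y)⁻¹ i a * pd i (fun z ↦ A z a b) y * (A y)⁻¹ b k) := by
    rw [Finset.mul_sum, ← Finset.sum_sub_distrib, Finset.mul_sum]
    refine Finset.sum_congr rfl fun i _ ↦ ?_
    rw [pd_mul i hq (hA.differentiableAt_inv i k), hA.pd_sqrt_det,
      pd_inv_entry (fun i j ↦ (hA.smooth i j).of_le (by simp)) hA.pos.ne']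
    simp only [← Finset.sum_mul]
    ring
  have e2 : ∑ i, ∑ j, (A y)⁻¹ i j * metricChristoffel A k i j y
      = (1 / 2) * (∑ i, ∑ j, ∑ m, (A y)⁻¹ i j * (A y)⁻¹ k m * pd i (fun z ↦ A z j m) y
        + ∑ i, ∑ j, ∑ m, (A y)⁻¹ i j * (A y)⁻¹ k m * pd j (fun z ↦ A z i m) y
        - ∑ i, ∑ j, ∑ m, (A y)⁻¹ i j * (A y)⁻¹ k m * pd m (fun z ↦ A z i j) y) := by
    simp only [metricChristoffel, christoffelOf, ← Finset.sum_add_distrib,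
      ← Finset.sum_sub_distrib, Finset.mul_sum]
    exact Finset.sum_congr rfl fun i _ ↦ Finset.sum_congr rfl fun j _ ↦
      Finset.sum_congr rfl fun m _ ↦ by ring
  have e3 : ∑ i, ∑ j, ∑ m, (A y)⁻¹ i j * (A y)⁻¹ k m * pd j (fun z ↦ A z i m) y
      = ∑ i, ∑ j, ∑ m, (A y)⁻¹ i j * (A y)⁻¹ k m * pd i (fun z ↦ A z j m) y := by
    rw [Finset.sum_comm]
    refine Finset.sum_congr rfl fun i _ ↦ Finset.sum_congr rfl fun j _ ↦ ?_
    rw [hB.apply]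
  have e4 : ∑ i, ∑ j, ∑ m, (A y)⁻¹ i j * (A y)⁻¹ k m * pd m (fun z ↦ A z i j) y
      = ∑ i, ∑ a, ∑ b, (A y)⁻¹ a b * pd i (fun z ↦ A z a b) y * (A y)⁻¹ i k := by
    rw [sum_rotate₃ (fun i a b ↦ (A y)⁻¹ a b * pd i (fun z ↦ A z a b) y * (A y)⁻¹ i k)]
    refine Finset.sum_congr rfl fun i _ ↦ Finset.sum_congr rfl fun j _ ↦
      Finset.sum_congr rfl fun m _ ↦ ?_
    rw [hB.apply k m]; ring
  have e5 : ∑ i, ∑ a, ∑ b, (A y)⁻¹ i a * pd i (fun z ↦ A z a b) y * (A y)⁻¹ b k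
      = ∑ i, ∑ j, ∑ m, (A y)⁻¹ i j * (A y)⁻¹ k m * pd i (fun z ↦ A z j m) y := by
    refine Finset.sum_congr rfl fun i _ ↦ Finset.sum_congr rfl fun j _ ↦
      Finset.sum_congr rfl fun m _ ↦ ?_
    rw [hB.apply k m]; ring
  rw [e1, e2, e3, e4, e5]; ring

/-- The coordinate form of the first variation of the energy under changes of the domain. -/
theorem stressDiv_eq_zero (hA : IsMetricAt A y)
    (hH : ∀ i j, DifferentiableAt ℝ (fun z ↦ H z i j) y) (hs : ∀ᶠ z in 𝓝 y, (H z).IsSymm)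
    {c : Fin n}
    (h : ∑ i, ∑ j, √(A y).det * (A y)⁻¹ i j * pd c (fun z ↦ H z i j) y
      = 2 * ∑ i, ∑ j, pd i (fun z ↦ √(A z).det * (A z)⁻¹ i j * H z c j) y) :
    stressDiv A H c y = 0 := by
  have hq := hA.contDiffAt_sqrt_det.differentiableAt (by simp)
  have hW : ∀ i j, DifferentiableAt ℝ (fun z ↦ √(A z).det * (A z)⁻¹ i j) y :=
    fun i j ↦ hq.fun_mul (hA.differentiableAt_inv i j)
  have hsd : ∀ l i j, pd l (fun z ↦ H z i j) y = pd l (fun z ↦ H z j i) y :=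
    fun l i j ↦ pd_congr (hs.mono fun _ hz ↦ hz.apply j i)
  -- The product rule isolates ∂ᵢ(√g gⁱʲ), and `sum_pd_sqrt_det_mul_inv` turns it into the
  -- Christoffel term of `stressDiv`. The positive factor √g is divided out at the end.
  have e1 : ∑ i, ∑ j, pd i (fun z ↦ √(A z).det * (A z)⁻¹ i j * H z c j) y
      = ∑ j, (∑ i, pd i (fun z ↦ √(A z).det * (A z)⁻¹ i j) y) * H y c j
        + ∑ i, ∑ j, √(A y).det * (A y)⁻¹ i j * pd i (fun z ↦ H z c j) y := by
    simp only [pd_mul _ (hW _ _) (hH _ _), Finset.sum_add_distrib, Finset.sum_mul]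
    congr 1
    rw [Finset.sum_comm]
  have e2 : ∑ j, (∑ i, pd i (fun z ↦ √(A z).det * (A z)⁻¹ i j) y) * H y c j
      = -√(A y).det * ∑ i, ∑ j, (A y)⁻¹ i j * ∑ k, metricChristoffel A k i j y * H y k c := by
    simp only [hA.sum_pd_sqrt_det_mul_inv, Finset.mul_sum, Finset.sum_mul]
    rw [sum_rotate₃ (fun k i j ↦ -√(A y).det * ((A y)⁻¹ i j * metricChristoffel A k i j y)
      * H y c k)]
    refine Finset.sum_congr rfl fun i _ ↦ Finset.sum_congr rfl fun j _ ↦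
      Finset.sum_congr rfl fun k _ ↦ ?_
    rw [hs.self_of_nhds.apply k c]; ring
  have e3 : √(A y).det * stressDiv A H c y
      = ∑ i, ∑ j, √(A y).det * (A y)⁻¹ i j * pd i (fun z ↦ H z c j) y
        - (1 / 2) * ∑ i, ∑ j, √(A y).det * (A y)⁻¹ i j * pd c (fun z ↦ H z i j) y
        - √(A y).det * ∑ i, ∑ j, (A y)⁻¹ i j * ∑ k, metricChristoffel A k i j y * H y k c := by
    simp only [stressDiv, Finset.mul_sum (a := √(A y).det), Finset.mul_sum (a := (1 / 2 : ℝ)),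
      ← Finset.sum_sub_distrib]
    refine Finset.sum_congr rfl fun i _ ↦ Finset.sum_congr rfl fun j _ ↦ ?_
    rw [hsd i c j]; ring
  have : √(A y).det * stressDiv A H c y = 0 := by rw [e3, h, e1, e2]; ring
  exact (mul_eq_zero.1 this).resolve_left (Real.sqrt_pos.2 hA.pos).ne'

/-- The trace over i, j of g(L_X ∇) = ½ (∇ᵢ s + ∇ⱼ s - ∇ₗ s), with s = L_X g: against the symmetric
inverse metric the first two terms coincide and their sum is div s. This links infinitesimal
harmonicity with the stress divergence. -/
theorem stressDiv_lieMatrix (hA : IsMetricAt A y) {X : Rn n → Fin n → ℝ}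
    (hX : ∀ k, ContDiffAt ℝ ∞ (fun z ↦ X z k) y) (l : Fin n) :
    stressDiv A (lieMatrix A X) l y = ∑ k, A y l k * lieTension A X k y := by
  have hXd : ∀ k, DifferentiableAt ℝ (fun z ↦ X z k) y := fun k ↦ (hX k).differentiableAt (by simp)
  have hXd' : ∀ i k, DifferentiableAt ℝ (pd i fun z ↦ X z k) y :=
    fun i k ↦ ((hX k).pd (k := ∞) (by simp) i).differentiableAt (by simp)
  have hAd := hA.differentiableAt
  have hAd' : ∀ l i j, DifferentiableAt ℝ (pd l fun z ↦ A z i j) y :=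
    fun l i j ↦ ((hA.smooth i j).pd (k := ∞) (by simp) l).differentiableAt (by simp)
  have hΓ : ∀ k i j, DifferentiableAt ℝ (metricChristoffel A k i j) y :=
    fun k i j ↦ (hA.smooth_christoffel k i j).differentiableAt (by simp)
  have hdet : ∀ᶠ z in 𝓝 y, (A z).det ≠ 0 :=
    (contDiffAt_det hA.smooth).continuousAt.eventually_ne hA.pos.ne'
  have key := lie_connection_index_identity hA.symm.self_of_nhds hA.mul_inv
    (d := fun l a b ↦ pd l (fun z ↦ A z a b) y) hA.pd_symm
    (dd := fun a b i j ↦ pd a (pd b fun z ↦ A z i j) y)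
    (fun a b i j ↦ pd_comm ((hA.smooth i j).of_le (ENat.LEInfty.out)) a b)
    (dΓ := fun c k i j ↦ pd c (metricChristoffel A k i j) y)
    (fun c l i j ↦ by
      -- The lowered Christoffel relation holds wherever the determinant is nonzero, hence near y,
      -- and so may be differentiated.
      have h1 : pd c (fun z ↦ ∑ k, A z l k * metricChristoffel A k i j z) y
          = pd c (fun z ↦ (1 / 2) * (pd i (fun z ↦ A z j l) z + pd j (fun z ↦ A z i l) z
            - pd l (fun z ↦ A z i j) z)) y := by
        apply pd_congr
        filter_upwards [hdet] with z hz
        exact sum_mul_christoffelOf (d := fun l a b ↦ pd l (fun z ↦ A z a b) z)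
          (Matrix.mul_nonsing_inv _ (isUnit_iff_ne_zero.2 hz)) l i j
      rw [pd_sum c fun k ↦ (hAd l k).fun_mul (hΓ k i j),
        pd_const_mul c _ (((hAd' i j l).fun_add (hAd' j i l)).fun_sub (hAd' l i j)),
        pd_sub c ((hAd' i j l).fun_add (hAd' j i l)) (hAd' l i j),
        pd_add c (hAd' i j l) (hAd' j i l)] at h1
      rw [← h1]
      exact Finset.sum_congr rfl fun k _ ↦ (pd_mul c (hAd l k) (hΓ k i j)).symm)
    (X y) (fun i k ↦ pd i (fun z ↦ X z k) y)
    (ddX := fun i j k ↦ pd i (pd j fun z ↦ X z k) y)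
    (fun i j k ↦ pd_comm ((hX k).of_le (ENat.LEInfty.out)) i j)
    (lieMatrix A X y) (fun i j ↦ rfl)
    (ds := fun l i j ↦ pd l (fun z ↦ lieMatrix A X z i j) y)
    (fun l i j ↦ by
      have h1 : ∀ k, DifferentiableAt ℝ (fun z ↦ X z k * pd k (fun z ↦ A z i j) z) y :=
        fun k ↦ (hXd k).fun_mul (hAd' k i j)
      have h2 : ∀ k, DifferentiableAt ℝ (fun z ↦ A z k j * pd i (fun z ↦ X z k) z) y :=
        fun k ↦ (hAd k j).fun_mul (hXd' i k)
      have h3 : ∀ k, DifferentiableAt ℝ (fun z ↦ A z i k * pd j (fun z ↦ X z k) z) y :=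
        fun k ↦ (hAd i k).fun_mul (hXd' j k)
      have : (fun z ↦ lieMatrix A X z i j) = fun z ↦ ∑ k, (X z k * pd k (fun z ↦ A z i j) z
        + A z k j * pd i (fun z ↦ X z k) z + A z i k * pd j (fun z ↦ X z k) z) := rfl
      rw [this, pd_sum l fun k ↦ ((h1 k).fun_add (h2 k)).fun_add (h3 k)]
      refine Finset.sum_congr rfl fun k _ ↦ ?_
      rw [pd_add l ((h1 k).fun_add (h2 k)) (h3 k), pd_add l (h1 k) (h2 k),
        pd_mul l (hXd k) (hAd' k i j), pd_mul l (hAd k j) (hXd' i k),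
        pd_mul l (hAd i k) (hXd' j k)]) l
  have hR : ∑ k, A y l k * lieTension A X k y = ∑ i, ∑ j, (A y)⁻¹ i j *
      ((1 / 2) * (pd i (fun z ↦ lieMatrix A X z j l) y + pd j (fun z ↦ lieMatrix A X z i l) y
        - pd l (fun z ↦ lieMatrix A X z i j) y)
        - ∑ k, metricChristoffel A k i j y * lieMatrix A X y k l) := by
    simp only [lieTension]
    refine (sum_mul_sum_sum (A y l) (A y)⁻¹ fun k i j ↦ lieConnection A X k i j y).trans ?_
    exact Finset.sum_congr rfl fun i _ ↦ Finset.sum_congr rfl fun j _ ↦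
      congrArg (fun t ↦ (A y)⁻¹ i j * t) (key i j)
  rw [hR]
  have hswap : ∑ i, ∑ j, (A y)⁻¹ i j * pd j (fun z ↦ lieMatrix A X z i l) y
      = ∑ i, ∑ j, (A y)⁻¹ i j * pd i (fun z ↦ lieMatrix A X z j l) y := by
    rw [Finset.sum_comm]
    refine Finset.sum_congr rfl fun i _ ↦ Finset.sum_congr rfl fun j _ ↦ ?_
    rw [hA.symm_inv.apply]
  have h5 : ∑ i, ∑ j, (A y)⁻¹ i j *
      ((1 / 2) * (pd i (fun z ↦ lieMatrix A X z j l) y + pd j (fun z ↦ lieMatrix A X z i l) y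
        - pd l (fun z ↦ lieMatrix A X z i j) y)
        - ∑ k, metricChristoffel A k i j y * lieMatrix A X y k l)
      = stressDiv A (lieMatrix A X) l y
        + (1 / 2) * ∑ i, ∑ j, (A y)⁻¹ i j * pd j (fun z ↦ lieMatrix A X z i l) y
        - (1 / 2) * ∑ i, ∑ j, (A y)⁻¹ i j * pd i (fun z ↦ lieMatrix A X z j l) y := by
    simp only [stressDiv, Finset.mul_sum (a := (1 / 2 : ℝ)), ← Finset.sum_add_distrib,
      ← Finset.sum_sub_distrib]
    exact Finset.sum_congr rfl fun i _ ↦ Finset.sum_congr rfl fun j _ ↦ by ring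
  rw [h5, hswap]; ring

end IsMetricAt

theorem stressDiv_congr {H' : Rn n → Matrix (Fin n) (Fin n) ℝ} (h : H =ᶠ[𝓝 y] H') (l : Fin n) :
    stressDiv A H l y = stressDiv A H' l y := by
  have hp : ∀ c i j, pd c (fun z ↦ H z i j) y = pd c (fun z ↦ H' z i j) y :=
    fun c i j ↦ pd_congr (h.mono fun z hz ↦ by simp only [hz])
  simp only [stressDiv, hp, h.self_of_nhds]

theorem stressDiv_add {H' : Rn n → Matrix (Fin n) (Fin n) ℝ}
    (h : ∀ i j, DifferentiableAt ℝ (fun z ↦ H z i j) y)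
    (h' : ∀ i j, DifferentiableAt ℝ (fun z ↦ H' z i j) y) (l : Fin n) :
    stressDiv A (fun z ↦ H z + H' z) l y = stressDiv A H l y + stressDiv A H' l y := by
  simp only [stressDiv, Matrix.add_apply, pd_add _ (h _ _) (h' _ _)]
  rw [← Finset.sum_add_distrib]
  refine Finset.sum_congr rfl fun i _ ↦ ?_
  rw [← Finset.sum_add_distrib]
  refine Finset.sum_congr rfl fun j _ ↦ ?_
  simp only [mul_add (metricChristoffel _ _ _ _ _), Finset.sum_add_distrib]
  ring

theorem stressDiv_const_smul (c : ℝ) (h : ∀ i j, DifferentiableAt ℝ (fun z ↦ H z i j) y)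
    (l : Fin n) : stressDiv A (fun z ↦ c • H z) l y = c * stressDiv A H l y := by
  simp only [stressDiv, Matrix.smul_apply, smul_eq_mul, pd_const_mul _ c (h _ _)]
  rw [Finset.mul_sum]
  refine Finset.sum_congr rfl fun i _ ↦ ?_
  rw [Finset.mul_sum]
  refine Finset.sum_congr rfl fun j _ ↦ ?_
  simp only [mul_left_comm (metricChristoffel _ _ _ _ _) c, ← Finset.mul_sum]
  ring

end StressDivergence

/-! ### Charts, transition maps and the transformation law of two-tensors -/

section Charts

variable {n m : ℕ} {M N : Type*}
  [TopologicalSpace M] [ChartedSpace (Rn n) M] [IsManifold (𝓡 n) ∞ M]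
  [TopologicalSpace N] [ChartedSpace (Rn m) N] [IsManifold (𝓡 m) ∞ N]

theorem contMDiffAt_chart_symm {p : M} {y : Rn n} (hy : y ∈ (extChartAt (𝓡 n) p).target) :
    ContMDiffAt (𝓡 n) (𝓡 n) ∞ (extChartAt (𝓡 n) p).symm y :=
  (contMDiffOn_extChartAt_symm p).contMDiffAt ((isOpen_extChartAt_target p).mem_nhds hy)

theorem contMDiffAt_chart {p x : M} (hx : x ∈ (extChartAt (𝓡 n) p).source) :
    ContMDiffAt (𝓡 n) (𝓡 n) ∞ (extChartAt (𝓡 n) p) x :=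
  contMDiffAt_extChartAt' (by simpa using hx)

/-- The tangent map of F is applied to a constant vector field on `Rn n`. With F the inverse of a
chart this covers the coordinate vector fields. -/
theorem contMDiffAt_mfderiv_apply_const {F : Rn n → N} {y : Rn n}
    (hF : ContMDiffAt (𝓡 n) (𝓡 m) ∞ F y) (u : Rn n) :
    ContMDiffAt (𝓡 n) ((𝓡 m).prod (𝓡 m)) ∞
      (fun z ↦ (Bundle.TotalSpace.mk' (Rn m) (F z) (mfderiv (𝓡 n) (𝓡 m) F z u) :
        TangentBundle (𝓡 m) N)) y := by
  have h1 := hF.mfderiv_const (m := ∞) (by simp)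
  have h2 : ContMDiffAt (𝓡 n) ((𝓡 n).prod (𝓡 n)) ∞
      (fun z ↦ (Bundle.TotalSpace.mk' (Rn n) z u : TangentBundle (𝓡 n) (Rn n))) y :=
    contMDiffAt_vectorSpace_iff_contDiffAt.2 contDiffAt_const
  exact ContMDiffAt.clm_apply_of_inCoordinates h1 h2 hF

/-- Pulling back a smooth two-tensor field by a smooth map from `ℝⁿ` gives smooth components. -/
theorem contDiffAt_tensor_pullback
    {B : ∀ x : N, TangentSpace (𝓡 m) x →L[ℝ] TangentSpace (𝓡 m) x →L[ℝ] ℝ}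
    (hB : ContMDiff (𝓡 m) ((𝓡 m).prod 𝓘(ℝ, Rn m →L[ℝ] Rn m →L[ℝ] ℝ)) ∞
      (fun x ↦ Bundle.TotalSpace.mk' (Rn m →L[ℝ] Rn m →L[ℝ] ℝ) x (B x)))
    {F : Rn n → N} {y : Rn n} (hF : ContMDiffAt (𝓡 n) (𝓡 m) ∞ F y) (v w : Rn n) :
    ContDiffAt ℝ ∞
      (fun z ↦ B (F z) (mfderiv (𝓡 n) (𝓡 m) F z v) (mfderiv (𝓡 n) (𝓡 m) F z w)) y := by
  have h3 := ContMDiffAt.clm_bundle_apply₂ (F₁ := Rn m) (F₂ := Rn m) (F₃ := ℝ) (b := F)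
    (E₃ := fun _ : N ↦ ℝ) (hB.contMDiffAt.comp y hF) (contMDiffAt_mfderiv_apply_const hF v)
    (contMDiffAt_mfderiv_apply_const hF w)
  rw [Bundle.contMDiffAt_totalSpace] at h3
  exact h3.2.contDiffAt

/-- Pulling back a smooth one-form by a smooth map from `ℝⁿ` gives smooth components. -/
theorem contDiffAt_form_pullback
    {B : ∀ x : N, TangentSpace (𝓡 m) x →L[ℝ] ℝ}
    (hB : ContMDiff (𝓡 m) ((𝓡 m).prod 𝓘(ℝ, Rn m →L[ℝ] ℝ)) ∞
      (fun x ↦ Bundle.TotalSpace.mk' (Rn m →L[ℝ] ℝ) x (B x)))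
    {F : Rn n → N} {y : Rn n} (hF : ContMDiffAt (𝓡 n) (𝓡 m) ∞ F y) (v : Rn n) :
    ContDiffAt ℝ ∞ (fun z ↦ B (F z) (mfderiv (𝓡 n) (𝓡 m) F z v)) y := by
  have h3 := ContMDiffAt.clm_bundle_apply (F₁ := Rn m) (F₂ := ℝ) (b := F)
    (E₂ := fun _ : N ↦ ℝ) (hB.contMDiffAt.comp y hF) (contMDiffAt_mfderiv_apply_const hF v)
  rw [Bundle.contMDiffAt_totalSpace] at h3
  exact h3.2.contDiffAt

/-- The derivative of the inverse of the chart at `p`, as an endomorphism of `ℝⁿ`. -/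
def symmDeriv (p : M) (y : Rn n) : Rn n →L[ℝ] Rn n :=
  mfderiv (𝓡 n) (𝓡 n) (extChartAt (𝓡 n) p).symm y

/-- The derivative of the chart at `p`, as an endomorphism of `ℝⁿ`. -/
def chartDeriv (p x : M) : Rn n →L[ℝ] Rn n :=
  mfderiv (𝓡 n) (𝓡 n) (extChartAt (𝓡 n) p) x

theorem chartDeriv_symmDeriv {p : M} {y : Rn n} (hy : y ∈ (extChartAt (𝓡 n) p).target)
    (v : Rn n) : chartDeriv p ((extChartAt (𝓡 n) p).symm y) (symmDeriv p y v) = v := by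
  have := mfderiv_extChartAt_comp_mfderivWithin_extChartAt_symm (I := 𝓡 n) (x := p) hy
  rw [ModelWithCorners.range_eq_univ, mfderivWithin_univ] at this
  exact congrArg (fun L : Rn n →L[ℝ] Rn n ↦ L v) this

theorem symmDeriv_chartDeriv {p : M} {y : Rn n} (hy : y ∈ (extChartAt (𝓡 n) p).target)
    (v : Rn n) : symmDeriv p y (chartDeriv p ((extChartAt (𝓡 n) p).symm y) v) = v := by
  have := mfderivWithin_extChartAt_symm_comp_mfderiv_extChartAt (I := 𝓡 n) (x := p) hy
  rw [ModelWithCorners.range_eq_univ, mfderivWithin_univ] at this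
  exact congrArg (fun L : Rn n →L[ℝ] Rn n ↦ L v) this

theorem symmDeriv_chartDeriv_of_mem {p x : M} (hx : x ∈ (extChartAt (𝓡 n) p).source)
    (v : Rn n) : symmDeriv p (extChartAt (𝓡 n) p x) (chartDeriv p x v) = v := by
  have := symmDeriv_chartDeriv ((extChartAt (𝓡 n) p).map_source hx) v
  rwa [(extChartAt (𝓡 n) p).left_inv hx] at this

/-- The change of coordinates from the chart at `p` to the chart at `q`. -/
def transition (p q : M) (y : Rn n) : Rn n :=
  extChartAt (𝓡 n) q ((extChartAt (𝓡 n) p).symm y)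

/-- The coordinates, in the chart at `p`, of the overlap with the domain of the chart at `q`. -/
def overlap (p q : M) : Set (Rn n) :=
  (extChartAt (𝓡 n) p).target ∩ (extChartAt (𝓡 n) p).symm ⁻¹' (extChartAt (𝓡 n) q).source

theorem isOpen_overlap (p q : M) : IsOpen (overlap (n := n) p q) :=
  (continuousOn_extChartAt_symm p).isOpen_inter_preimage (isOpen_extChartAt_target p)
    (isOpen_extChartAt_source q)

theorem contDiffAt_transition {p q : M} {y : Rn n} (hy : y ∈ overlap (n := n) p q) :
    ContDiffAt ℝ ∞ (transition (n := n) p q) y :=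
  ((contMDiffAt_chart hy.2).comp y (contMDiffAt_chart_symm hy.1)).contDiffAt

theorem fderiv_transition {p q : M} {y : Rn n} (hy : y ∈ overlap (n := n) p q) (v : Rn n) :
    fderiv ℝ (transition (n := n) p q) y v
      = chartDeriv q ((extChartAt (𝓡 n) p).symm y) (symmDeriv p y v) := by
  have h1 : MDifferentiableAt (𝓡 n) (𝓡 n) (extChartAt (𝓡 n) q) ((extChartAt (𝓡 n) p).symm y) :=
    (contMDiffAt_chart hy.2).mdifferentiableAt (by simp)
  have h2 : MDifferentiableAt (𝓡 n) (𝓡 n) (extChartAt (𝓡 n) p).symm y :=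
    (contMDiffAt_chart_symm hy.1).mdifferentiableAt (by simp)
  have h3 := mfderiv_comp y h1 h2
  have h4 : fderiv ℝ (transition (n := n) p q) y
    = mfderiv (𝓡 n) (𝓡 n) (extChartAt (𝓡 n) q ∘ (extChartAt (𝓡 n) p).symm) y :=
    mfderiv_eq_fderiv.symm
  rw [h4]
  exact congrArg (fun L : Rn n →L[ℝ] Rn n ↦ L v) h3

theorem symmDeriv_fderiv_transition {p q : M} {y : Rn n} (hy : y ∈ overlap (n := n) p q)
    (v : Rn n) :
    symmDeriv q (transition p q y) (fderiv ℝ (transition (n := n) p q) y v) = symmDeriv p y v := by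
  rw [fderiv_transition hy, transition, symmDeriv_chartDeriv_of_mem hy.2]

theorem transition_mem_overlap {p q : M} {y : Rn n} (hy : y ∈ overlap (n := n) p q) :
    transition p q y ∈ overlap (n := n) q p := by
  refine ⟨(extChartAt (𝓡 n) q).map_source hy.2, ?_⟩
  rw [mem_preimage, transition, (extChartAt (𝓡 n) q).left_inv hy.2]
  exact (extChartAt (𝓡 n) p).map_target hy.1

theorem transition_transition {p q : M} {y : Rn n} (hy : y ∈ overlap (n := n) p q) :
    transition q p (transition p q y) = y := by
  rw [transition, transition, (extChartAt (𝓡 n) q).left_inv hy.2,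
    (extChartAt (𝓡 n) p).right_inv hy.1]

/-- The Jacobian matrix of the change of coordinates. -/
def jacobian (p q : M) (y : Rn n) : Matrix (Fin n) (Fin n) ℝ :=
  Matrix.of fun a i ↦ pd i (fun z ↦ transition p q z a) y

theorem jacobian_apply {p q : M} {y : Rn n} (hy : y ∈ overlap (n := n) p q) (a i : Fin n) :
    jacobian p q y a i = fderiv ℝ (transition (n := n) p q) y (EuclideanSpace.single i 1) a := by
  have h : HasFDerivAt (fun z ↦ transition (n := n) p q z a)
      ((EuclideanSpace.proj a : Rn n →L[ℝ] ℝ) ∘L fderiv ℝ (transition (n := n) p q) y) y :=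
    (EuclideanSpace.proj a : Rn n →L[ℝ] ℝ).hasFDerivAt.comp y
      ((contDiffAt_transition hy).differentiableAt (by simp)).hasFDerivAt
  simp only [jacobian, Matrix.of_apply, pd]
  rw [h.fderiv]
  rfl

theorem sum_smul_single (v : Rn n) :
    ∑ i, v i • (EuclideanSpace.single i (1 : ℝ) : Rn n) = v := by
  ext j
  simp [Finset.sum_apply, Pi.single_apply]

theorem det_jacobian {p q : M} {y : Rn n} (hy : y ∈ overlap (n := n) p q) :
    (jacobian p q y).det = (fderiv ℝ (transition (n := n) p q) y).det := by
  rw [ContinuousLinearMap.det,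
    ← LinearMap.det_toMatrix (EuclideanSpace.basisFun (Fin n) ℝ).toBasis]
  congr 1
  ext a i
  rw [jacobian_apply hy, LinearMap.toMatrix_apply]
  simp

theorem det_jacobian_ne_zero {p q : M} {y : Rn n} (hy : y ∈ overlap (n := n) p q) :
    (jacobian p q y).det ≠ 0 := by
  rw [det_jacobian hy]
  have h : (fderiv ℝ (transition (n := n) q p) (transition p q y)) ∘L
      (fderiv ℝ (transition (n := n) p q) y) = ContinuousLinearMap.id ℝ _ := by
    ext1 v
    have h1 := fderiv_transition (transition_mem_overlap hy)
      (fderiv ℝ (transition (n := n) p q) y v)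
    rw [symmDeriv_fderiv_transition hy] at h1
    rw [ContinuousLinearMap.comp_apply, h1, transition, (extChartAt (𝓡 n) q).left_inv hy.2,
      chartDeriv_symmDeriv hy.1]
    rfl
  intro h0
  have h2 := congrArg (fun L : Rn n →L[ℝ] Rn n ↦ LinearMap.det (L : Rn n →ₗ[ℝ] Rn n)) h
  rw [ContinuousLinearMap.det] at h0
  simp [h0] at h2

/-- `h` is bilinear at `x`. -/
def IsBilinAt (h : ∀ x : M, TangentSpace (𝓡 n) x → TangentSpace (𝓡 n) x → ℝ) (x : M) : Prop :=
  ∃ B : Rn n →ₗ[ℝ] Rn n →ₗ[ℝ] ℝ, ∀ v w : Rn n, h x v w = B v w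

theorem bilin_eq_sum (B : Rn m →ₗ[ℝ] Rn m →ₗ[ℝ] ℝ) (L : Rn n →L[ℝ] Rn m) (v w : Rn n) :
    B (L v) (L w) = ∑ a, ∑ b, B (L (EuclideanSpace.single a 1)) (L (EuclideanSpace.single b 1))
      * v a * w b := by
  conv_lhs => rw [← sum_smul_single v, ← sum_smul_single w]
  simp only [map_sum, map_smul, LinearMap.sum_apply, LinearMap.smul_apply, smul_eq_mul,
    Finset.mul_sum]
  rw [Finset.sum_comm]
  exact Finset.sum_congr rfl fun i _ ↦ Finset.sum_congr rfl fun j _ ↦ by ring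

theorem coordTensor_eq_sum {h : ∀ x : M, TangentSpace (𝓡 n) x → TangentSpace (𝓡 n) x → ℝ}
    {p q : M} {y : Rn n} (hy : y ∈ overlap (n := n) p q)
    (hh : IsBilinAt h ((extChartAt (𝓡 n) p).symm y)) (i j : Fin n) :
    coordTensor h p y i j = ∑ a, ∑ b, coordTensor h q (transition p q y) a b
      * jacobian p q y a i * jacobian p q y b j := by
  obtain ⟨B, hB⟩ := hh
  have hx : (extChartAt (𝓡 n) q).symm (transition p q y) = (extChartAt (𝓡 n) p).symm y :=
    (extChartAt (𝓡 n) q).left_inv hy.2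
  have hq : ∀ a b, coordTensor h q (transition p q y) a b
      = B (symmDeriv q (transition p q y) (EuclideanSpace.single a 1))
        (symmDeriv q (transition p q y) (EuclideanSpace.single b 1)) := by
    intro a b
    rw [← hB]
    -- The base points are equal only propositionally. Reading every tangent space as `Rn n` makes
    -- the type independent of the point, so the equality can be substituted.
    exact congrArg (fun x ↦ (h : M → Rn n → Rn n → ℝ) x _ _) hx
  have hp : coordTensor h p y i j
      = B (symmDeriv p y (EuclideanSpace.single i 1)) (symmDeriv p y (EuclideanSpace.single j 1)) :=
    hB _ _
  rw [hp, ← symmDeriv_fderiv_transition hy, ← symmDeriv_fderiv_transition hy, bilin_eq_sum]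
  simp only [hq, jacobian_apply hy]

theorem coordTensor_eq_mul {h : ∀ x : M, TangentSpace (𝓡 n) x → TangentSpace (𝓡 n) x → ℝ}
    {p q : M} {y : Rn n} (hy : y ∈ overlap (n := n) p q)
    (hh : IsBilinAt h ((extChartAt (𝓡 n) p).symm y)) :
    coordTensor h p y
      = (jacobian p q y).transpose * coordTensor h q (transition p q y) * jacobian p q y := by
  ext i j
  rw [coordTensor_eq_sum hy hh, Matrix.mul_apply, Finset.sum_comm]
  simp only [Matrix.mul_apply, Matrix.transpose_apply, Finset.sum_mul]
  exact Finset.sum_congr rfl fun i _ ↦ Finset.sum_congr rfl fun j _ ↦ by ring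

theorem continuousOn_source_of_symm {E : Type*} [TopologicalSpace E] {p : M} {F : M → E}
    (hF : ContinuousOn (fun y ↦ F ((extChartAt (𝓡 n) p).symm y)) (extChartAt (𝓡 n) p).target) :
    ContinuousOn F (extChartAt (𝓡 n) p).source :=
  (hF.comp (continuousOn_extChartAt p) fun _ hx ↦ (extChartAt (𝓡 n) p).map_source hx).congr
    fun _ hx ↦ congrArg F ((extChartAt (𝓡 n) p).left_inv hx).symm

theorem continuous_of_symm {E : Type*} [TopologicalSpace E] {F : M → E}
    (hF : ∀ p : M, ContinuousOn (fun y : Rn n ↦ F ((extChartAt (𝓡 n) p).symm y))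
      (extChartAt (𝓡 n) p).target) : Continuous F :=
  continuous_iff_continuousAt.2 fun p ↦ (continuousOn_source_of_symm (hF p)).continuousAt
    ((isOpen_extChartAt_source p).mem_nhds (mem_extChartAt_source p))

end Charts

/-! ### Components of the metric and chart independence of the trace -/

section Metric

variable {n m : ℕ} {M N : Type*}
  [TopologicalSpace M] [ChartedSpace (Rn n) M] [IsManifold (𝓡 n) ∞ M]
  [TopologicalSpace N] [ChartedSpace (Rn m) N] [IsManifold (𝓡 m) ∞ N]
  (g : RiemMetric n M) {p q x : M} {y : Rn n}

theorem isBilinAt_clm (B : ∀ x : M, TangentSpace (𝓡 n) x →L[ℝ] TangentSpace (𝓡 n) x →L[ℝ] ℝ)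
    (x : M) : IsBilinAt (fun x v w ↦ B x v w) x :=
  ⟨LinearMap.mk₂ ℝ (fun v w : Rn n ↦ B x v w)
    (fun _ _ _ ↦ congrArg (fun L : Rn n →L[ℝ] ℝ ↦ L _) ((B x).map_add _ _))
    (fun _ _ _ ↦ congrArg (fun L : Rn n →L[ℝ] ℝ ↦ L _) ((B x).map_smul _ _))
    (fun _ _ _ ↦ (B x _).map_add _ _) (fun _ _ _ ↦ (B x _).map_smul _ _), fun _ _ ↦ rfl⟩

theorem isBilinAt_pullbackMetric (gbar : RiemMetric m N) (f : M → N) (x : M) :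
    IsBilinAt (pullbackMetric (n := n) gbar f) x := by
  obtain ⟨B, hB⟩ := isBilinAt_clm (fun x ↦ gbar.inner x) (f x)
  let L : Rn n →L[ℝ] Rn m := mfderiv (𝓡 n) (𝓡 m) f x
  exact ⟨B.compl₁₂ (L : Rn n →ₗ[ℝ] Rn m) (L : Rn n →ₗ[ℝ] Rn m), fun v w ↦ hB (L v) (L w)⟩

theorem isSymm_coordMetric (p : M) (y : Rn n) : (coordMetric g p y).IsSymm := by
  ext i j
  exact g.symm _ _ _

/-- The derivative of the inverse chart is injective on the chart target, so the quadratic form of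
the matrix is that of g on nonzero vectors. -/
theorem posDef_coordMetric (hy : y ∈ (extChartAt (𝓡 n) p).target) :
    (coordMetric g p y).PosDef := by
  rw [Matrix.posDef_iff_dotProduct_mulVec]
  refine ⟨(Matrix.conjTranspose_eq_transpose_of_trivial _).trans
    (isSymm_coordMetric g p y), fun v hv ↦ ?_⟩
  obtain ⟨B, hB⟩ := isBilinAt_clm (fun x ↦ g.inner x) ((extChartAt (𝓡 n) p).symm y)
  set u : Rn n := WithLp.toLp 2 v
  have hu : symmDeriv p y u ≠ 0 := by
    intro h0
    have h1 := chartDeriv_symmDeriv hy u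
    rw [h0, map_zero] at h1
    exact hv (by simpa [u] using h1.symm)
  have hpos : 0 < B (symmDeriv p y u) (symmDeriv p y u) := by
    rw [← hB]
    exact g.pos _ _ hu
  rw [bilin_eq_sum] at hpos
  refine hpos.trans_eq ?_
  simp only [dotProduct, Matrix.mulVec, Finset.mul_sum]
  refine Finset.sum_congr rfl fun i _ ↦ Finset.sum_congr rfl fun j _ ↦ ?_
  have : coordMetric g p y i j = B (symmDeriv p y (EuclideanSpace.single i 1))
    (symmDeriv p y (EuclideanSpace.single j 1)) := hB _ _
  rw [this, star_trivial]
  ring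

theorem isMetricAt_coordMetric (hy : y ∈ (extChartAt (𝓡 n) p).target) :
    IsMetricAt (coordMetric g p) y where
  smooth _ _ := contDiffAt_tensor_pullback g.contMDiff (contMDiffAt_chart_symm hy) _ _
  symm := Eventually.of_forall fun z ↦ isSymm_coordMetric g p z
  pos := (posDef_coordMetric g hy).det_pos

theorem contDiffAt_coordTensor (φ : TwoTensor n M) (hy : y ∈ (extChartAt (𝓡 n) p).target)
    (i j : Fin n) : ContDiffAt ℝ ∞ (fun z ↦ coordTensor (fun x v w ↦ φ x v w) p z i j) y :=
  contDiffAt_tensor_pullback φ.contMDiff (contMDiffAt_chart_symm hy) _ _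

theorem contDiffAt_coordForm (θ : OneForm n M) (hy : y ∈ (extChartAt (𝓡 n) p).target)
    (i : Fin n) : ContDiffAt ℝ ∞ (fun z ↦ coordForm (fun x v ↦ θ x v) p z i) y :=
  contDiffAt_form_pullback θ.contMDiff (contMDiffAt_chart_symm hy) _

theorem coordTensor_pullbackMetric (gbar : RiemMetric m N) {f : M → N}
    (hf : MDifferentiableAt (𝓡 n) (𝓡 m) f ((extChartAt (𝓡 n) p).symm y))
    (hy : y ∈ (extChartAt (𝓡 n) p).target) (i j : Fin n) :
    coordTensor (pullbackMetric gbar f) p y i j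
      = gbar.inner (f ((extChartAt (𝓡 n) p).symm y))
        (mfderiv (𝓡 n) (𝓡 m) (f ∘ (extChartAt (𝓡 n) p).symm) y (EuclideanSpace.single i 1 : Rn n))
        (mfderiv (𝓡 n) (𝓡 m) (f ∘ (extChartAt (𝓡 n) p).symm) y
          (EuclideanSpace.single j 1 : Rn n)) := by
  rw [mfderiv_comp y hf ((contMDiffAt_chart_symm hy).mdifferentiableAt (by simp))]
  rfl

theorem contDiffAt_coordTensor_pullbackMetric (gbar : RiemMetric m N) {f : M → N}
    (hf : ContMDiff (𝓡 n) (𝓡 m) ∞ f) (hy : y ∈ (extChartAt (𝓡 n) p).target) (i j : Fin n) :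
    ContDiffAt ℝ ∞ (fun z ↦ coordTensor (pullbackMetric gbar f) p z i j) y := by
  have h := contDiffAt_tensor_pullback gbar.contMDiff
    (hf.contMDiffAt.comp y (contMDiffAt_chart_symm hy)) (EuclideanSpace.single i 1)
    (EuclideanSpace.single j 1)
  refine h.congr_of_eventuallyEq ?_
  filter_upwards [(isOpen_extChartAt_target p).mem_nhds hy] with z hz
  exact coordTensor_pullbackMetric gbar (hf.mdifferentiableAt (by simp)) hz i j

/-- The pointwise operators at x use the chart at x. This puts every point of a fixed chart in the
overlap with the chart centred at that point, where the two expressions can be compared. -/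
theorem overlap_self_center (hy : y ∈ (extChartAt (𝓡 n) p).target) :
    y ∈ overlap p ((extChartAt (𝓡 n) p).symm y) :=
  ⟨hy, mem_extChartAt_source _⟩

/-- The sum is the trace of G⁻¹ Hᵀ, and the congruence by T acts on this product by conjugation. -/
theorem sum_inv_mul_congruence {G H G' H' T : Matrix (Fin n) (Fin n) ℝ} (hT : T.det ≠ 0)
    (hG : G = T.transpose * G' * T) (hH : H = T.transpose * H' * T) :
    ∑ i, ∑ j, G⁻¹ i j * H i j = ∑ i, ∑ j, G'⁻¹ i j * H' i j := by
  have key : ∀ G H : Matrix (Fin n) (Fin n) ℝ,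
      ∑ i, ∑ j, G i j * H i j = (G * H.transpose).trace := fun G H ↦ by
    simp [Matrix.trace, Matrix.mul_apply]
  have hu : IsUnit T.det := isUnit_iff_ne_zero.2 hT
  have hu' : IsUnit T.transpose.det := by rwa [Matrix.det_transpose]
  rw [key, key, hG, hH, Matrix.mul_inv_rev, Matrix.mul_inv_rev]
  simp only [Matrix.transpose_mul, Matrix.transpose_transpose]
  have : T⁻¹ * (G'⁻¹ * T.transpose⁻¹) * (T.transpose * (H'.transpose * T))
      = T⁻¹ * (G'⁻¹ * H'.transpose * T) := by
    simp only [Matrix.mul_assoc]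
    rw [← Matrix.mul_assoc T.transpose⁻¹, Matrix.nonsing_inv_mul _ hu', Matrix.one_mul]
  rw [this, Matrix.trace_mul_comm, Matrix.mul_assoc, Matrix.mul_nonsing_inv _ hu, Matrix.mul_one]

/-- The trace may be computed in any chart. -/
theorem metricTrace_eq {h : ∀ x : M, TangentSpace (𝓡 n) x → TangentSpace (𝓡 n) x → ℝ}
    (hy : y ∈ (extChartAt (𝓡 n) p).target) (hh : IsBilinAt h ((extChartAt (𝓡 n) p).symm y)) :
    metricTrace g h ((extChartAt (𝓡 n) p).symm y)
      = ∑ i, ∑ j, (coordMetric g p y)⁻¹ i j * coordTensor h p y i j :=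
  have ho := overlap_self_center hy
  (sum_inv_mul_congruence (det_jacobian_ne_zero ho)
    (coordTensor_eq_mul ho (isBilinAt_clm (fun x ↦ g.inner x) _)) (coordTensor_eq_mul ho hh)).symm

/-- The Jacobian factor is the one in the change of variables formula; this makes the chart volumes
agree on overlaps. -/
theorem sqrt_det_coordMetric (hy : y ∈ overlap p q) :
    √(coordMetric g p y).det = |(fderiv ℝ (transition (n := n) p q) y).det|
      * √(coordMetric g q (transition p q y)).det := by
  have := coordTensor_eq_mul hy (isBilinAt_clm (fun x ↦ g.inner x) _)
  rw [coordMetric, this, Matrix.det_mul, Matrix.det_mul, Matrix.det_transpose, ← det_jacobian hy,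
    mul_comm, ← mul_assoc, Real.sqrt_mul (mul_self_nonneg _), Real.sqrt_mul_self_eq_abs]
  rfl

end Metric

/-! ### Naturality and trace of the Lie derivative of a metric -/

section LieDerivative

variable {n : ℕ}

theorem fderiv_apply_coord {ψ : Rn n → Rn n} {y : Rn n} (hψ : DifferentiableAt ℝ ψ y) (v : Rn n)
    (a : Fin n) : fderiv ℝ (fun z ↦ ψ z a) y v = fderiv ℝ ψ y v a := by
  have h : HasFDerivAt (fun z ↦ ψ z a) ((EuclideanSpace.proj a : Rn n →L[ℝ] ℝ) ∘L fderiv ℝ ψ y) y :=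
    (EuclideanSpace.proj a : Rn n →L[ℝ] ℝ).hasFDerivAt.comp y hψ.hasFDerivAt
  rw [h.fderiv]
  rfl

theorem pd_comp {ψ : Rn n → Rn n} {F : Rn n → ℝ} {y : Rn n} (hψ : DifferentiableAt ℝ ψ y)
    (hF : DifferentiableAt ℝ F (ψ y)) (i : Fin n) :
    pd i (fun z ↦ F (ψ z)) y = ∑ c, pd c F (ψ y) * pd i (fun z ↦ ψ z c) y := by
  have h := (hF.hasFDerivAt.comp y hψ.hasFDerivAt).fderiv
  have h' : pd i (fun z ↦ F (ψ z)) y = fderiv ℝ F (ψ y) (fderiv ℝ ψ y (EuclideanSpace.single i 1)) :=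
    congrArg (fun L : Rn n →L[ℝ] ℝ ↦ L (EuclideanSpace.single i 1)) h
  rw [h', fderiv_eq_sum_pd]
  refine Finset.sum_congr rfl fun c _ ↦ ?_
  have hc : pd i (fun z ↦ ψ z c) y = fderiv ℝ ψ y (EuclideanSpace.single i 1) c :=
    fderiv_apply_coord hψ _ c
  rw [hc, mul_comm]

/-- The index identity behind the naturality of the Lie derivative of a two-tensor. -/
theorem lie_naturality_index_identity {ι : Type*} [Fintype ι] {A' : ι → ι → ℝ}
    {dA' : ι → ι → ι → ℝ} {X X' : ι → ℝ} {dX dX' : ι → ι → ℝ} {P : ι → ι → ℝ} {PP : ι → ι → ι → ℝ}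
    (hPP : ∀ k a i, PP k a i = PP i a k)
    {A : ι → ι → ℝ} (hA : ∀ i j, A i j = ∑ a, ∑ b, A' a b * P a i * P b j)
    {dA : ι → ι → ι → ℝ} (hdA : ∀ k i j, dA k i j = ∑ a, ∑ b,
      ((∑ c, dA' c a b * P c k) * P a i * P b j + A' a b * PP k a i * P b j
        + A' a b * P a i * PP k b j))
    (hX : ∀ a, X' a = ∑ i, P a i * X i)
    (hdX : ∀ k a, ∑ c, dX' c a * P c k = ∑ i, (PP k a i * X i + P a i * dX k i)) (i j : ι) :
    ∑ k, (X k * dA k i j + A k j * dX i k + A i k * dX j k)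
      = ∑ a, ∑ b, (∑ k, (X' k * dA' k a b + A' k b * dX' a k + A' a k * dX' b k))
        * P a i * P b j := by
  -- The second derivatives PP of the coordinate change appear here because ∂A is not tensorial.
  -- They occur with the opposite sign in `e2` and `e3`, where ∂X is not tensorial, and cancel by
  -- the symmetry of PP.
  have e1 : ∑ k, X k * dA k i j
      = ∑ a, ∑ b, (∑ c, X' c * dA' c a b) * P a i * P b j
        + ∑ a, ∑ b, A' a b * (∑ k, PP i a k * X k) * P b j
        + ∑ a, ∑ b, A' a b * P a i * ∑ k, PP j b k * X k := by
    have : ∀ a b, ∑ c, X' c * dA' c a b = ∑ k, X k * ∑ c, dA' c a b * P c k := fun a b ↦ by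
      simp only [hX, Finset.sum_mul, Finset.mul_sum]
      rw [Finset.sum_comm]
      exact Finset.sum_congr rfl fun _ _ ↦ Finset.sum_congr rfl fun _ _ ↦ by ring
    have hsum : ∑ k, X k * dA k i j = ∑ a, ∑ b, ∑ k, X k *
        ((∑ c, dA' c a b * P c k) * P a i * P b j + A' a b * PP k a i * P b j
        + A' a b * P a i * PP k b j) := by
      simp only [hdA]
      have hF : ∀ F : ι → ι → ι → ℝ,
          ∑ k, X k * ∑ a, ∑ b, F k a b = ∑ a, ∑ b, ∑ k, X k * F k a b := fun F ↦ by
        simp only [Finset.mul_sum]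
        rw [sum_rotate₃]
      exact hF _
    rw [hsum, ← Finset.sum_add_distrib, ← Finset.sum_add_distrib]
    refine Finset.sum_congr rfl fun a _ ↦ ?_
    rw [← Finset.sum_add_distrib, ← Finset.sum_add_distrib]
    refine Finset.sum_congr rfl fun b _ ↦ ?_
    rw [this, Finset.sum_mul, Finset.sum_mul, Finset.mul_sum, Finset.sum_mul, Finset.mul_sum,
      ← Finset.sum_add_distrib, ← Finset.sum_add_distrib]
    refine Finset.sum_congr rfl fun k _ ↦ ?_
    rw [hPP i a k, hPP j b k]
    ring
  have e2 : ∑ k, A k j * dX i k = ∑ a, ∑ b, A' a b * (∑ c, dX' c a * P c i) * P b j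
      - ∑ a, ∑ b, A' a b * (∑ k, PP i a k * X k) * P b j := by
    simp only [hdX, Finset.sum_add_distrib, mul_add, add_mul, add_sub_cancel_left, hA,
      Finset.sum_mul]
    rw [Finset.sum_comm]
    refine Finset.sum_congr rfl fun a _ ↦ ?_
    rw [Finset.sum_comm]
    refine Finset.sum_congr rfl fun b _ ↦ ?_
    rw [Finset.mul_sum, Finset.sum_mul]
    exact Finset.sum_congr rfl fun k _ ↦ by ring
  have e3 : ∑ k, A i k * dX j k = ∑ a, ∑ b, A' a b * P a i * ∑ c, dX' c b * P c j
      - ∑ a, ∑ b, A' a b * P a i * ∑ k, PP j b k * X k := by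
    simp only [hdX, Finset.sum_add_distrib, mul_add, add_sub_cancel_left, hA,
      Finset.sum_mul]
    rw [Finset.sum_comm]
    refine Finset.sum_congr rfl fun a _ ↦ ?_
    rw [Finset.sum_comm]
    refine Finset.sum_congr rfl fun b _ ↦ ?_
    rw [Finset.mul_sum]
    exact Finset.sum_congr rfl fun k _ ↦ by ring
  have e4 : ∑ a, ∑ b, A' a b * (∑ c, dX' c a * P c i) * P b j
      = ∑ a, ∑ b, (∑ k, A' k b * dX' a k) * P a i * P b j := by
    simp only [Finset.mul_sum, Finset.sum_mul]
    rw [sum_reverse₃]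
    exact Finset.sum_congr rfl fun _ _ ↦ Finset.sum_congr rfl fun _ _ ↦
      Finset.sum_congr rfl fun _ _ ↦ by ring
  have e5 : ∑ a, ∑ b, A' a b * P a i * ∑ c, dX' c b * P c j
      = ∑ a, ∑ b, (∑ k, A' a k * dX' b k) * P a i * P b j := by
    simp only [Finset.mul_sum, Finset.sum_mul]
    refine Finset.sum_congr rfl fun _ _ ↦ ?_
    rw [Finset.sum_comm]
    exact Finset.sum_congr rfl fun _ _ ↦ Finset.sum_congr rfl fun _ _ ↦ by ring
  rw [Finset.sum_add_distrib, Finset.sum_add_distrib, e1, e2, e3, e4, e5]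
  have e6 : ∑ a, ∑ b, (∑ k, (X' k * dA' k a b + A' k b * dX' a k + A' a k * dX' b k))
        * P a i * P b j
      = ∑ a, ∑ b, (∑ c, X' c * dA' c a b) * P a i * P b j
        + ∑ a, ∑ b, (∑ k, A' k b * dX' a k) * P a i * P b j
        + ∑ a, ∑ b, (∑ k, A' a k * dX' b k) * P a i * P b j := by
    simp only [Finset.sum_add_distrib, add_mul]
  rw [e6]; ring

/-- Naturality of the Lie derivative of a metric under a change of coordinates. -/
theorem lieMatrix_pullback {ψ : Rn n → Rn n} {y : Rn n} (hψ : ContDiffAt ℝ ∞ ψ y)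
    {A A' : Rn n → Matrix (Fin n) (Fin n) ℝ} {X X' : Rn n → Fin n → ℝ}
    (hA' : ∀ a b, DifferentiableAt ℝ (fun z ↦ A' z a b) (ψ y))
    (hX : ∀ k, DifferentiableAt ℝ (fun z ↦ X z k) y)
    (hX' : ∀ k, DifferentiableAt ℝ (fun z ↦ X' z k) (ψ y))
    (hA : ∀ᶠ z in 𝓝 y, ∀ i j, A z i j
      = ∑ a, ∑ b, A' (ψ z) a b * pd i (fun z ↦ ψ z a) z * pd j (fun z ↦ ψ z b) z)
    (hXX' : ∀ᶠ z in 𝓝 y, ∀ a, X' (ψ z) a = ∑ i, pd i (fun z ↦ ψ z a) z * X z i) (i j : Fin n) :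
    lieMatrix A X y i j = ∑ a, ∑ b, lieMatrix A' X' (ψ y) a b
      * pd i (fun z ↦ ψ z a) y * pd j (fun z ↦ ψ z b) y := by
  have hψc : ∀ a, ContDiffAt ℝ ∞ (fun z ↦ ψ z a) y := fun a ↦
    (EuclideanSpace.proj a : Rn n →L[ℝ] ℝ).contDiff.contDiffAt.comp y hψ
  have hψd : DifferentiableAt ℝ ψ y := hψ.differentiableAt (by simp)
  have hP : ∀ i a, DifferentiableAt ℝ (pd i fun z ↦ ψ z a) y := fun i a ↦
    ((hψc a).pd (k := ∞) (by simp) i).differentiableAt (by simp)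
  have hA'ψ : ∀ a b, DifferentiableAt ℝ (fun z ↦ A' (ψ z) a b) y := fun a b ↦
    (hA' a b).comp y hψd
  refine lie_naturality_index_identity (A' := A' (ψ y)) (A := A y)
    (dA' := fun c a b ↦ pd c (fun z ↦ A' z a b) (ψ y)) (X := X y) (X' := X' (ψ y))
    (dX := fun i k ↦ pd i (fun z ↦ X z k) y) (dX' := fun i k ↦ pd i (fun z ↦ X' z k) (ψ y))
    (P := fun a i ↦ pd i (fun z ↦ ψ z a) y) (PP := fun k a i ↦ pd k (pd i fun z ↦ ψ z a) y)
    (fun k a i ↦ pd_comm ((hψc a).of_le ENat.LEInfty.out) k i)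
    (fun i j ↦ hA.self_of_nhds i j) (dA := fun k i j ↦ pd k (fun z ↦ A z i j) y)
    (fun k i j ↦ ?_) (fun a ↦ hXX'.self_of_nhds a) (fun k a ↦ ?_) i j
  · rw [pd_congr (hA.mono fun z hz ↦ hz i j),
      pd_sum k fun a ↦ DifferentiableAt.fun_sum fun b _ ↦
        ((hA'ψ a b).fun_mul (hP i a)).fun_mul (hP j b)]
    refine Finset.sum_congr rfl fun a _ ↦ ?_
    rw [pd_sum k fun b ↦ ((hA'ψ a b).fun_mul (hP i a)).fun_mul (hP j b)]
    refine Finset.sum_congr rfl fun b _ ↦ ?_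
    rw [pd_mul k ((hA'ψ a b).fun_mul (hP i a)) (hP j b), pd_mul k (hA'ψ a b) (hP i a),
      pd_comp (F := fun z ↦ A' z a b) hψd (hA' a b)]
    ring
  · rw [← pd_comp (F := fun z ↦ X' z a) hψd (hX' a), pd_congr (hXX'.mono fun z hz ↦ hz a),
      pd_sum k fun i ↦ (hP i a).fun_mul (hX i)]
    exact Finset.sum_congr rfl fun i _ ↦ pd_mul k (hP i a) (hX i)

/-- Half the trace of L_X g is the divergence of X. The terms with ∂X contract to the flat
divergence, and the term with ∂g is the logarithmic derivative of √g; the resulting form can be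
integrated by parts. -/
theorem trace_lieMatrix {A : Rn n → Matrix (Fin n) (Fin n) ℝ} {y : Rn n} (hA : IsMetricAt A y)
    {X : Rn n → Fin n → ℝ} (hX : ∀ k, DifferentiableAt ℝ (fun z ↦ X z k) y) :
    √(A y).det * ∑ i, ∑ j, (A y)⁻¹ i j * lieMatrix A X y i j
      = 2 * ∑ k, pd k (fun z ↦ √(A z).det * X z k) y := by
  have hq := hA.contDiffAt_sqrt_det.differentiableAt (by simp)
  have h1 : ∑ i, ∑ j, (A y)⁻¹ i j * ∑ k, A y k j * pd i (fun z ↦ X z k) y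
      = ∑ k, pd k (fun z ↦ X z k) y := by
    refine Finset.sum_congr rfl fun i _ ↦ ?_
    simp only [Finset.mul_sum]
    rw [Finset.sum_comm]
    have : ∀ k, ∑ j, (A y)⁻¹ i j * (A y k j * pd i (fun z ↦ X z k) y)
        = (1 : Matrix (Fin n) (Fin n) ℝ) i k * pd i (fun z ↦ X z k) y := fun k ↦ by
      rw [← hA.inv_mul, Matrix.mul_apply, Finset.sum_mul]
      refine Finset.sum_congr rfl fun j _ ↦ ?_
      rw [hA.symm.self_of_nhds.apply]; ring
    simp [this, Matrix.one_apply]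
  have h2 : ∑ i, ∑ j, (A y)⁻¹ i j * ∑ k, A y i k * pd j (fun z ↦ X z k) y
      = ∑ i, ∑ j, (A y)⁻¹ i j * ∑ k, A y k j * pd i (fun z ↦ X z k) y := by
    rw [Finset.sum_comm]
    refine Finset.sum_congr rfl fun i _ ↦ Finset.sum_congr rfl fun j _ ↦ ?_
    rw [hA.symm_inv.apply]
    refine congrArg _ (Finset.sum_congr rfl fun k _ ↦ ?_)
    rw [hA.symm.self_of_nhds.apply]
  have h3 : ∑ i, ∑ j, (A y)⁻¹ i j * lieMatrix A X y i j
      = ∑ k, X y k * ∑ i, ∑ j, (A y)⁻¹ i j * pd k (fun z ↦ A z i j) y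
        + ∑ i, ∑ j, (A y)⁻¹ i j * ∑ k, A y k j * pd i (fun z ↦ X z k) y
        + ∑ i, ∑ j, (A y)⁻¹ i j * ∑ k, A y i k * pd j (fun z ↦ X z k) y := by
    rw [sum_mul_sum_sum (X y) (A y)⁻¹ fun k i j ↦ pd k (fun z ↦ A z i j) y]
    simp only [← Finset.sum_add_distrib, ← mul_add]
    rfl
  have h4 : ∀ k, pd k (fun z ↦ √(A z).det * X z k) y
      = √(A y).det * ((1 / 2) * (X y k * ∑ i, ∑ j, (A y)⁻¹ i j * pd k (fun z ↦ A z i j) y)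
        + pd k (fun z ↦ X z k) y) := fun k ↦ by
    rw [pd_mul k hq (hX k), hA.pd_sqrt_det]; ring
  rw [h3, h2, h1]
  simp only [h4, ← Finset.mul_sum, Finset.sum_add_distrib]
  ring

end LieDerivative

/-! ### The dual vector field, the Lie derivative along it and the codifferential -/

section LieMetric

variable {n : ℕ} {M : Type*} [TopologicalSpace M] [ChartedSpace (Rn n) M] [IsManifold (𝓡 n) ∞ M]
  (g : RiemMetric n M) {p q : M} {y : Rn n}

theorem coordField_transition (ξ : ∀ x : M, TangentSpace (𝓡 n) x) (hy : y ∈ overlap p q)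
    (a : Fin n) :
    coordField ξ q (transition p q y) a = ∑ i, jacobian p q y a i * coordField ξ p y i := by
  have hx : (extChartAt (𝓡 n) q).symm (transition p q y) = (extChartAt (𝓡 n) p).symm y :=
    (extChartAt (𝓡 n) q).left_inv hy.2
  have h1 : coordField ξ q (transition p q y) a
      = chartDeriv q ((extChartAt (𝓡 n) p).symm y) (ξ ((extChartAt (𝓡 n) p).symm y)) a :=
    congrArg (fun x ↦ chartDeriv q x ((ξ : M → Rn n) x) a) hx
  have h2 : ∀ u : Rn n, chartDeriv q ((extChartAt (𝓡 n) p).symm y) u a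
      = ∑ i, jacobian p q y a i * chartDeriv p ((extChartAt (𝓡 n) p).symm y) u i := fun u ↦ by
    have h := fderiv_transition hy (chartDeriv p ((extChartAt (𝓡 n) p).symm y) u)
    rw [symmDeriv_chartDeriv hy.1] at h
    rw [← h, ← fderiv_apply_coord ((contDiffAt_transition hy).differentiableAt (by simp)),
      fderiv_eq_sum_pd]
    exact Finset.sum_congr rfl fun i _ ↦ mul_comm _ _
  exact h1.trans (h2 _)

/-- The components of `θ` in terms of those of `θ^#`. -/
theorem coordForm_eq_sum (θ : OneForm n M) (hy : y ∈ (extChartAt (𝓡 n) p).target) (j : Fin n) :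
    coordForm (fun x v ↦ θ x v) p y j
      = ∑ k, coordField (sharp g θ) p y k * coordMetric g p y k j := by
  set x := (extChartAt (𝓡 n) p).symm y
  obtain ⟨B, hB⟩ := isBilinAt_clm (fun x ↦ g.inner x) x
  have h2 : ∀ u : Rn n, B u (symmDeriv p y (EuclideanSpace.single j 1))
      = ∑ k, chartDeriv p x u k * B (symmDeriv p y (EuclideanSpace.single k 1))
        (symmDeriv p y (EuclideanSpace.single j 1)) := fun u ↦ by
    conv_lhs => rw [← symmDeriv_chartDeriv hy u, ← sum_smul_single (chartDeriv p _ u)]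
    simp only [map_sum, map_smul, LinearMap.sum_apply, LinearMap.smul_apply, smul_eq_mul]
    rfl
  refine ((inner_sharp g θ x _).symm.trans (hB _ _)).trans ((h2 _).trans ?_)
  refine Finset.sum_congr rfl fun k _ ↦ ?_
  rw [← hB]
  rfl

theorem coordField_sharp_eq (θ : OneForm n M) (hy : y ∈ (extChartAt (𝓡 n) p).target) (k : Fin n) :
    coordField (sharp g θ) p y k
      = ∑ j, (coordMetric g p y)⁻¹ j k * coordForm (fun x v ↦ θ x v) p y j := by
  have hA := isMetricAt_coordMetric g hy
  have h : ∀ l, ∑ j, coordMetric g p y l j * (coordMetric g p y)⁻¹ j k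
      = if l = k then 1 else 0 := fun l ↦ by
    rw [← Matrix.mul_apply, hA.mul_inv, Matrix.one_apply]
  simp only [coordForm_eq_sum g θ hy, Finset.mul_sum]
  rw [Finset.sum_comm]
  have : ∀ l, ∑ j, (coordMetric g p y)⁻¹ j k *
      (coordField (sharp g θ) p y l * coordMetric g p y l j)
      = coordField (sharp g θ) p y l * if l = k then 1 else 0 := fun l ↦ by
    rw [← h, Finset.mul_sum]
    exact Finset.sum_congr rfl fun j _ ↦ by ring
  rw [Finset.sum_congr rfl fun l _ ↦ this l]
  simp

/-- `sharp` is defined pointwise by duality, so smoothness has to come from raising the index with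
the smooth inverse matrix. -/
theorem contDiffAt_coordField_sharp (θ : OneForm n M) (hy : y ∈ (extChartAt (𝓡 n) p).target)
    (k : Fin n) : ContDiffAt ℝ ∞ (fun z ↦ coordField (sharp g θ) p z k) y := by
  have h : ContDiffAt ℝ ∞ (fun z ↦ ∑ j, (coordMetric g p z)⁻¹ j k
      * coordForm (fun x v ↦ θ x v) p z j) y :=
    ContDiffAt.sum fun j _ ↦ ((isMetricAt_coordMetric g hy).smooth_inv j k).mul
      (contDiffAt_coordForm θ hy j)
  refine h.congr_of_eventuallyEq ?_
  filter_upwards [(isOpen_extChartAt_target p).mem_nhds hy] with z hz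
  exact coordField_sharp_eq g θ hz k

theorem isBilinAt_lieMetric (ξ : ∀ x : M, TangentSpace (𝓡 n) x) (x : M) :
    IsBilinAt (lieMetric g ξ) x := by
  refine ⟨LinearMap.mk₂ ℝ (fun v w : Rn n ↦ ∑ i, ∑ j, lieMatrix (coordMetric g x) (coordField ξ x)
      (extChartAt (𝓡 n) x x) i j * chartDeriv x x v i * chartDeriv x x w j) ?_ ?_ ?_ ?_,
    fun v w ↦ rfl⟩ <;> intros <;>
    simp only [map_add, map_smul, PiLp.add_apply, PiLp.smul_apply, smul_eq_mul,
      ← Finset.sum_add_distrib, Finset.mul_sum] <;>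
    exact Finset.sum_congr rfl fun _ _ ↦ Finset.sum_congr rfl fun _ _ ↦ by ring

/-- The coordinate formula for the Lie derivative of the metric holds in every chart. -/
theorem coordTensor_lieMetric_sharp (θ : OneForm n M) (hy : y ∈ (extChartAt (𝓡 n) p).target) :
    coordTensor (lieMetric g (sharp g θ)) p y
      = lieMatrix (coordMetric g p) (coordField (sharp g θ) p) y := by
  ext i j
  set x := (extChartAt (𝓡 n) p).symm y with hx
  have ho : y ∈ overlap p x := overlap_self_center hy
  have hc : transition p x y = extChartAt (𝓡 n) x x := rfl
  have ht : transition p x y ∈ (extChartAt (𝓡 n) x).target := mem_extChartAt_target x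
  have hev : ∀ᶠ z in 𝓝 y, z ∈ overlap p x := (isOpen_overlap p x).mem_nhds ho
  -- `lieMetric` at x is computed in the chart at x; naturality under the transition from the chart
  -- at p to that chart brings it to p.
  have key := lieMatrix_pullback (contDiffAt_transition ho) (A := coordMetric g p)
    (A' := coordMetric g x)
    (X' := coordField (sharp g θ) x)
    (isMetricAt_coordMetric g ht).differentiableAt
    (fun k ↦ (contDiffAt_coordField_sharp g θ hy k).differentiableAt (by simp))
    (fun k ↦ (contDiffAt_coordField_sharp g θ ht k).differentiableAt (by simp))
    (hev.mono fun z hz i j ↦ coordTensor_eq_sum hz (isBilinAt_clm (fun x ↦ g.inner x) _) i j)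
    (hev.mono fun z hz a ↦ coordField_transition _ hz a) i j
  have hj : ∀ a i, pd i (fun z ↦ transition p x z a) y
      = chartDeriv x x (symmDeriv p y (EuclideanSpace.single i 1)) a := fun a i ↦ by
    rw [← fderiv_transition ho]
    exact jacobian_apply ho a i
  simp only [hj, hc] at key
  exact key.symm

/-- `δθ = - ½ trace (L_ξ g)` for `ξ = θ^#`. -/
theorem divForm_eq (θ : OneForm n M) (x : M) :
    divForm g (fun x v ↦ θ x v) x = -(1 / 2) * metricTrace g (lieMetric g (sharp g θ)) x := by
  set y := extChartAt (𝓡 n) x x with hy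
  have ht : y ∈ (extChartAt (𝓡 n) x).target := mem_extChartAt_target x
  set A := coordMetric g x
  set X := coordField (sharp g θ) x
  have hA : IsMetricAt A y := isMetricAt_coordMetric g ht
  have hX : ∀ k, DifferentiableAt ℝ (fun z ↦ X z k) y := fun k ↦
    (contDiffAt_coordField_sharp g θ ht k).differentiableAt (by simp)
  have hcov : ∀ i j, covForm g (fun x v ↦ θ x v) x i j y
      = ∑ k, (pd i (fun z ↦ X z k) y * A y k j + X y k * ((1 / 2) * (pd i (fun z ↦ A z k j) y
        - pd j (fun z ↦ A z i k) y + pd k (fun z ↦ A z i j) y))) := by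
    intro i j
    have h1 : pd i (fun z ↦ coordForm (fun x v ↦ θ x v) x z j) y
        = ∑ k, (pd i (fun z ↦ X z k) y * A y k j + X y k * pd i (fun z ↦ A z k j) y) := by
      have : (fun z ↦ coordForm (fun x v ↦ θ x v) x z j) =ᶠ[𝓝 y] fun z ↦ ∑ k, X z k * A z k j := by
        filter_upwards [(isOpen_extChartAt_target x).mem_nhds ht] with z hz
        exact coordForm_eq_sum g θ hz j
      rw [pd_congr this, pd_sum i fun k ↦ (hX k).fun_mul (hA.differentiableAt k j)]
      exact Finset.sum_congr rfl fun k _ ↦ pd_mul i (hX k) (hA.differentiableAt k j)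
    have h2 : ∑ l, christoffel g x l i j y * coordForm (fun x v ↦ θ x v) x y l
        = ∑ k, X y k * ((1 / 2) * (pd i (fun z ↦ A z j k) y + pd j (fun z ↦ A z i k) y
          - pd k (fun z ↦ A z i j) y)) := by
      simp only [← hA.sum_mul_christoffel, coordForm_eq_sum g θ ht, Finset.mul_sum]
      rw [Finset.sum_comm]
      refine Finset.sum_congr rfl fun k _ ↦ Finset.sum_congr rfl fun l _ ↦ ?_
      have : christoffel g x l i j y = metricChristoffel A l i j y := rfl
      rw [this]; ring
    rw [covForm, h1, h2, ← Finset.sum_sub_distrib]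
    refine Finset.sum_congr rfl fun k _ ↦ ?_
    rw [hA.pd_symm i j k]; ring
  -- L_ξ g is the symmetrisation of ∇θ, and contraction with the inverse metric only sees the
  -- symmetric part.
  have hsum : ∀ i j, covForm g (fun x v ↦ θ x v) x i j y + covForm g (fun x v ↦ θ x v) x j i y
      = lieMatrix A X y i j := by
    intro i j
    rw [hcov, hcov, ← Finset.sum_add_distrib]
    refine Finset.sum_congr rfl fun k _ ↦ ?_
    rw [hA.pd_symm i k j, hA.pd_symm j k i, hA.pd_symm k j i, hA.pd_symm i j k,
      hA.pd_symm j i k, hA.symm.self_of_nhds.apply k i]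
    ring
  have htr : metricTrace g (lieMetric g (sharp g θ)) x
      = ∑ i, ∑ j, (A y)⁻¹ i j * lieMatrix A X y i j := by
    rw [← coordTensor_lieMetric_sharp g θ ht]
    rfl
  have hswap : ∑ i, ∑ j, (A y)⁻¹ i j * covForm g (fun x v ↦ θ x v) x j i y
      = ∑ i, ∑ j, (A y)⁻¹ i j * covForm g (fun x v ↦ θ x v) x i j y := by
    rw [Finset.sum_comm]
    refine Finset.sum_congr rfl fun i _ ↦ Finset.sum_congr rfl fun j _ ↦ ?_
    rw [hA.symm_inv.apply]
  rw [htr]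
  simp only [← hsum, mul_add, Finset.sum_add_distrib, hswap]
  have : divForm g (fun x v ↦ θ x v) x
    = -∑ i, ∑ j, (A y)⁻¹ i j * covForm g (fun x v ↦ θ x v) x i j y := rfl
  rw [this]; ring

end LieMetric

/-! ### The Riemannian volume measure -/

section Volume

variable {n : ℕ} {M : Type*} [TopologicalSpace M] [ChartedSpace (Rn n) M] [IsManifold (𝓡 n) ∞ M]
  [MeasurableSpace M] [BorelSpace M] (g : RiemMetric n M) {p q : M}

theorem measurableSet_chart_target (p : M) : MeasurableSet (extChartAt (𝓡 n) p).target :=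
  (isOpen_extChartAt_target p).measurableSet

theorem measurableSet_preimage_inter_target (p : M) {s : Set M} (hs : MeasurableSet s) :
    MeasurableSet ((extChartAt (𝓡 n) p).symm ⁻¹' s ∩ (extChartAt (𝓡 n) p).target) := by
  have h : Measurable ((extChartAt (𝓡 n) p).target.domRestrict (extChartAt (𝓡 n) p).symm) :=
    (continuousOn_iff_continuous_domRestrict.1 (continuousOn_extChartAt_symm p)).measurable
  have := (measurableSet_chart_target p).subtype_image (h hs)
  convert this using 1
  ext z
  exact ⟨fun hz ↦ ⟨⟨z, hz.2⟩, hz.1, rfl⟩, by rintro ⟨z, hz, rfl⟩; exact ⟨hz, z.2⟩⟩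

theorem continuousOn_sqrt_det (p : M) :
    ContinuousOn (fun y ↦ √(coordMetric g p y).det) (extChartAt (𝓡 n) p).target :=
  fun _ hy ↦ (isMetricAt_coordMetric g hy).contDiffAt_sqrt_det.continuousAt.continuousWithinAt

theorem aemeasurable_chart_symm (p : M) (s : Set (Rn n)) (d : Rn n → ENNReal) :
    AEMeasurable (extChartAt (𝓡 n) p).symm
      (((volume : Measure (Rn n)).restrict (s ∩ (extChartAt (𝓡 n) p).target)).withDensity d) :=
  (((continuousOn_extChartAt_symm p).aemeasurable (measurableSet_chart_target p)).mono_measure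
    (Measure.restrict_mono_set _ inter_subset_right)).mono_ac (withDensity_absolutelyContinuous _ _)

theorem chartVolume_apply {s : Set M} (hs : MeasurableSet s) :
    chartVolume g p s = ∫⁻ y in (extChartAt (𝓡 n) p).symm ⁻¹' s ∩ (extChartAt (𝓡 n) p).target,
      ENNReal.ofReal √(coordMetric g p y).det := by
  have h := aemeasurable_chart_symm p univ fun y ↦ ENNReal.ofReal √(coordMetric g p y).det
  rw [univ_inter] at h
  rw [chartVolume, Measure.map_apply_of_aemeasurable h hs, withDensity_apply',
    Measure.restrict_restrict' (measurableSet_chart_target p)]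

theorem chartVolume_inter_source {s : Set M} (hs : MeasurableSet s) :
    chartVolume g p (s ∩ (extChartAt (𝓡 n) p).source) = chartVolume g p s := by
  rw [chartVolume_apply g hs,
    chartVolume_apply g (hs.inter (isOpen_extChartAt_source p).measurableSet)]
  congr 2
  ext z
  exact ⟨fun h ↦ ⟨h.1.1, h.2⟩, fun h ↦ ⟨⟨h.1, (extChartAt (𝓡 n) p).map_target h.2⟩, h.2⟩⟩

/-- The volume measures of two charts agree on the overlap. -/
theorem chartVolume_eq_chartVolume {s : Set M} (hs : MeasurableSet s)
    (hp : s ⊆ (extChartAt (𝓡 n) p).source) (hq : s ⊆ (extChartAt (𝓡 n) q).source) :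
    chartVolume g q s = chartVolume g p s := by
  rw [chartVolume_apply g hs, chartVolume_apply g hs]
  set S := (extChartAt (𝓡 n) p).symm ⁻¹' s ∩ (extChartAt (𝓡 n) p).target
  have hS : S ⊆ overlap p q := fun y hy ↦ ⟨hy.2, hq hy.1⟩
  have himage : (extChartAt (𝓡 n) q).symm ⁻¹' s ∩ (extChartAt (𝓡 n) q).target
      = transition p q '' S := by
    ext z
    constructor
    · intro hz
      have hz' : z ∈ overlap q p := ⟨hz.2, hp hz.1⟩
      refine ⟨transition q p z, ⟨?_, (transition_mem_overlap hz').1⟩, transition_transition hz'⟩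
      rw [mem_preimage, transition, (extChartAt (𝓡 n) p).left_inv hz'.2]
      exact hz.1
    · rintro ⟨y, hy, rfl⟩
      refine ⟨?_, (transition_mem_overlap (hS hy)).1⟩
      rw [mem_preimage, transition, (extChartAt (𝓡 n) q).left_inv (hS hy).2]
      exact hy.1
  have hSm : MeasurableSet S := measurableSet_preimage_inter_target p hs
  have hinj : InjOn (transition (n := n) p q) S := fun a ha b hb hab ↦ by
    rw [← transition_transition (hS ha), hab, transition_transition (hS hb)]
  -- Change of variables along the transition map: its Jacobian is exactly the ratio of the two
  -- densities.
  rw [himage, lintegral_image_eq_lintegral_abs_det_fderiv_mul volume hSm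
    (fun y hy ↦ ((contDiffAt_transition (hS hy)).differentiableAt
      (by simp)).hasFDerivAt.hasFDerivWithinAt) hinj]
  refine setLIntegral_congr_fun hSm fun y hy ↦ ?_
  rw [← ENNReal.ofReal_mul (abs_nonneg _), ← sqrt_det_coordMetric g (hS hy)]

/-- A chart measure charges only the domain of its chart and agrees with the measure of the chart at
p on the overlap. So the chart measure at p inside its domain, plus `riemVol` outside it, dominates
every chart measure and hence their supremum. -/
theorem riemVol_apply {s : Set M} (hs : MeasurableSet s) (hp : s ⊆ (extChartAt (𝓡 n) p).source) :
    riemVol g s = chartVolume g p s := by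
  set S := (extChartAt (𝓡 n) p).source
  have hS : MeasurableSet S := (isOpen_extChartAt_source p).measurableSet
  refine le_antisymm ?_ (le_iSup (fun q ↦ chartVolume g q) p s)
  have hle : riemVol g ≤ (chartVolume g p).restrict S + (riemVol g).restrict Sᶜ := by
    refine iSup_le fun q ↦ Measure.le_iff.2 fun B hB ↦ ?_
    rw [Measure.add_apply, Measure.restrict_apply hB, Measure.restrict_apply hB,
      ← measure_inter_add_sdiff B hS, ← chartVolume_inter_source g (hB.inter hS),
      chartVolume_eq_chartVolume g
        ((hB.inter hS).inter (isOpen_extChartAt_source q).measurableSet)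
        (inter_subset_left.trans inter_subset_right) inter_subset_right]
    exact add_le_add (measure_mono inter_subset_left) (le_iSup (fun q ↦ chartVolume g q) q _)
  refine (hle s).trans ?_
  rw [Measure.add_apply, Measure.restrict_apply hs, Measure.restrict_apply hs,
    inter_eq_left.2 hp, ← sdiff_eq, sdiff_eq_empty.2 hp, measure_empty, add_zero]

theorem riemVol_restrict {s : Set M} (hs : MeasurableSet s)
    (hp : s ⊆ (extChartAt (𝓡 n) p).source) :
    (riemVol g).restrict s = (chartVolume g p).restrict s := by
  ext B hB
  rw [Measure.restrict_apply hB, Measure.restrict_apply hB,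
    riemVol_apply g (hB.inter hs) (inter_subset_right.trans hp)]

/-- Integrals over a subset of a chart domain, in coordinates. -/
theorem setIntegral_riemVol {s : Set M} (hs : MeasurableSet s)
    (hp : s ⊆ (extChartAt (𝓡 n) p).source) {F : M → ℝ}
    (hF : ContinuousOn (fun y ↦ F ((extChartAt (𝓡 n) p).symm y)) (extChartAt (𝓡 n) p).target) :
    ∫ x in s, F x ∂(riemVol g)
      = ∫ y in (extChartAt (𝓡 n) p).symm ⁻¹' s ∩ (extChartAt (𝓡 n) p).target,
        √(coordMetric g p y).det * F ((extChartAt (𝓡 n) p).symm y) := by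
  have hFs := continuousOn_source_of_symm hF
  have h := aemeasurable_chart_symm p univ fun y ↦ ENNReal.ofReal √(coordMetric g p y).det
  rw [univ_inter] at h
  have hmeas : AEStronglyMeasurable F ((riemVol g).restrict s) :=
    (hFs.aestronglyMeasurable (isOpen_extChartAt_source p).measurableSet).mono_measure
      (Measure.restrict_mono_set _ hp)
  rw [riemVol_restrict g hs hp] at hmeas ⊢
  rw [chartVolume, Measure.restrict_map_of_aemeasurable h hs, restrict_withDensity',
    Measure.restrict_restrict' (measurableSet_chart_target p)] at hmeas ⊢
  rw [integral_map (aemeasurable_chart_symm p _ _) hmeas,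
    integral_withDensity_eq_integral_toReal_smul₀]
  · refine integral_congr_ae (Eventually.of_forall fun y ↦ ?_)
    simp only [ENNReal.toReal_ofReal (Real.sqrt_nonneg _), smul_eq_mul]
  · exact (((continuousOn_sqrt_det g p).aemeasurable (measurableSet_chart_target p)).mono_measure
      (Measure.restrict_mono_set _ inter_subset_right)).ennreal_ofReal
  · exact Eventually.of_forall fun y ↦ ENNReal.ofReal_lt_top

/-- The density is bounded on a closed coordinate ball contained in the chart target. -/
theorem isLocallyFiniteMeasure_riemVol : IsLocallyFiniteMeasure (riemVol g) := by
  refine ⟨fun x ↦ ?_⟩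
  set e := extChartAt (𝓡 n) x
  obtain ⟨r, hr, hball⟩ := Metric.nhds_basis_closedBall.mem_iff.1
    ((isOpen_extChartAt_target (I := 𝓡 n) x).mem_nhds (mem_extChartAt_target x))
  have hU : IsOpen (e.source ∩ e ⁻¹' Metric.ball (e x) r) :=
    (continuousOn_extChartAt x).isOpen_inter_preimage (isOpen_extChartAt_source x)
      Metric.isOpen_ball
  refine ⟨_, hU.mem_nhds ⟨mem_extChartAt_source x, Metric.mem_ball_self hr⟩, ?_⟩
  rw [riemVol_apply g hU.measurableSet inter_subset_left, chartVolume_apply g hU.measurableSet]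
  obtain ⟨C, hC⟩ := (isCompact_closedBall (e x) r).bddAbove_image
    ((continuousOn_sqrt_det g x).mono hball)
  have hsub : e.symm ⁻¹' (e.source ∩ e ⁻¹' Metric.ball (e x) r) ∩ e.target
      ⊆ Metric.ball (e x) r := fun y hy ↦ by
    have := hy.1.2
    rwa [mem_preimage, e.right_inv hy.2] at this
  calc _ ≤ ∫⁻ y in Metric.ball (e x) r, ENNReal.ofReal √(coordMetric g x y).det :=
        lintegral_mono_set hsub
    _ ≤ ∫⁻ y in Metric.ball (e x) r, ENNReal.ofReal C := by
        refine setLIntegral_mono' Metric.isOpen_ball.measurableSet fun y hy ↦ ?_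
        exact ENNReal.ofReal_le_ofReal (hC (mem_image_of_mem _ (Metric.ball_subset_closedBall hy)))
    _ < ⊤ := by
        rw [setLIntegral_const]
        exact ENNReal.mul_lt_top ENNReal.ofReal_lt_top measure_ball_lt_top

/-- One chart is enough: its target is open and nonempty, and the density is positive there. -/
theorem riemVol_univ_pos [Nonempty M] : 0 < riemVol g univ := by
  obtain ⟨p⟩ := ‹Nonempty M›
  refine lt_of_lt_of_le ?_ (le_iSup (fun q ↦ chartVolume g q) p univ)
  rw [chartVolume_apply g MeasurableSet.univ, preimage_univ, univ_inter, pos_iff_ne_zero, Ne,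
    setLIntegral_eq_zero_iff' (measurableSet_chart_target p)
      ((continuousOn_sqrt_det g p).aemeasurable (measurableSet_chart_target p)).ennreal_ofReal]
  intro h
  have h0 : volume (extChartAt (𝓡 n) p).target = 0 := by
    rw [ae_iff] at h
    refine measure_mono_null ?_ h
    intro y hy hy0
    have := ENNReal.ofReal_eq_zero.1 (hy0 hy)
    exact absurd (Real.sqrt_pos.2 (isMetricAt_coordMetric g hy).pos) (not_lt.2 this)
  exact ((isOpen_extChartAt_target p).measure_pos volume ⟨_, mem_extChartAt_target p⟩).ne' h0

end Volume

/-! ### Differentiation under the integral and integration by parts -/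

section ParametricIntegral

variable {n : ℕ}

/-- The time derivative is continuous on the compact product of the closed interval and the closed
ball; its maximum is a constant, hence integrable, dominating function on the ball. -/
theorem hasDerivAt_setIntegral_ball {J : ℝ → Rn n → ℝ} {J' : Rn n → ℝ} {y₀ : Rn n} {r ε : ℝ}
    (hε : 0 < ε)
    (hJ : ∀ t ∈ Icc (-ε) ε, ∀ y ∈ Metric.closedBall y₀ r, ContDiffAt ℝ 1 (Function.uncurry J) (t, y))
    (hJ' : ∀ y ∈ Metric.ball y₀ r, HasDerivAt (fun t ↦ J t y) (J' y) 0) :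
    HasDerivAt (fun t ↦ ∫ y in Metric.ball y₀ r, J t y) (∫ y in Metric.ball y₀ r, J' y) 0 := by
  set K : Set (ℝ × Rn n) := Icc (-ε) ε ×ˢ Metric.closedBall y₀ r
  have hK : IsCompact K := isCompact_Icc.prod (isCompact_closedBall y₀ r)
  have hJK : ∀ q ∈ K, ContDiffAt ℝ 1 (Function.uncurry J) q := fun q hq ↦ hJ q.1 hq.1 q.2 hq.2
  set D : ℝ → Rn n → ℝ := fun t y ↦ fderiv ℝ (Function.uncurry J) (t, y) (1, 0)
  have hDc : ContinuousOn (Function.uncurry D) K := fun q hq ↦ by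
    have h1 : ContinuousAt (fderiv ℝ (Function.uncurry J)) q :=
      ((hJK q hq).fderiv_right (m := 0) (by norm_num)).continuousAt
    exact (h1.clm_apply continuousAt_const).continuousWithinAt
  obtain ⟨C, hC⟩ := hK.exists_bound_of_continuousOn hDc
  have hderiv : ∀ t ∈ Icc (-ε) ε, ∀ y ∈ Metric.closedBall y₀ r,
      HasDerivAt (fun s ↦ J s y) (D t y) t := fun t ht y hy ↦ by
    have h1 := ((hJ t ht y hy).differentiableAt (by norm_num)).hasFDerivAt
    have h2 : HasDerivAt (fun s : ℝ ↦ (s, y)) (1, 0) t :=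
      (hasDerivAt_id t).prodMk (hasDerivAt_const t y)
    exact h1.comp_hasDerivAt t h2
  have hcont : ∀ t ∈ Icc (-ε) ε, ContinuousOn (J t) (Metric.closedBall y₀ r) := fun t ht y hy ↦
    ((hJ t ht y hy).continuousAt.comp (f := fun z ↦ (t, z))
      (by fun_prop)).continuousWithinAt
  have hmeas : ∀ t ∈ Icc (-ε) ε, AEStronglyMeasurable (J t) (volume.restrict (Metric.ball y₀ r)) :=
    fun t ht ↦ ((hcont t ht).mono Metric.ball_subset_closedBall).aestronglyMeasurable
      Metric.isOpen_ball.measurableSet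
  have h0 : (0 : ℝ) ∈ Icc (-ε) ε := ⟨by linarith, hε.le⟩
  have hnhds : Ioo (-ε) ε ∈ 𝓝 (0 : ℝ) := Ioo_mem_nhds (by linarith) hε
  have key := hasDerivAt_integral_of_dominated_loc_of_deriv_le (F := J) (F' := D) (x₀ := (0 : ℝ))
    (μ := volume.restrict (Metric.ball y₀ r)) (bound := fun _ ↦ C) hnhds
    (by filter_upwards [hnhds] with t ht using hmeas t (Ioo_subset_Icc_self ht))
    (((hcont 0 h0).integrableOn_compact (isCompact_closedBall y₀ r)).mono_set
      Metric.ball_subset_closedBall)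
    ?_ ?_ ?_ ?_
  · refine key.2.congr_deriv ?_
    refine setIntegral_congr_fun Metric.isOpen_ball.measurableSet fun y hy ↦ ?_
    exact (hderiv 0 h0 y (Metric.ball_subset_closedBall hy)).unique (hJ' y hy)
  · refine ContinuousOn.aestronglyMeasurable (fun y hy ↦ ?_) Metric.isOpen_ball.measurableSet
    have := hDc.comp (f := fun y ↦ ((0 : ℝ), y)) (s := Metric.ball y₀ r) (by fun_prop)
      fun y hy ↦ ⟨h0, Metric.ball_subset_closedBall hy⟩
    exact this y hy
  · refine (ae_restrict_iff' Metric.isOpen_ball.measurableSet).2 (Eventually.of_forall ?_)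
    exact fun y hy t ht ↦ hC (t, y) ⟨Ioo_subset_Icc_self ht, Metric.ball_subset_closedBall hy⟩
  · exact integrableOn_const (measure_ball_lt_top.ne)
  · refine (ae_restrict_iff' Metric.isOpen_ball.measurableSet).2 (Eventually.of_forall ?_)
    exact fun y hy t ht ↦ hderiv t (Ioo_subset_Icc_self ht) y (Metric.ball_subset_closedBall hy)

theorem continuous_mul_of_tsupport_subset {V η : Rn n → ℝ} {T : Set (Rn n)} (hT : IsOpen T)
    (hV : ContinuousOn V T) (hη : Continuous η) (hs : tsupport η ⊆ T) :
    Continuous fun y ↦ V y * η y := by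
  refine continuous_of_tsupport fun y hy ↦ ?_
  have : y ∈ tsupport η := closure_mono (Function.support_mul_subset_right V η) hy
  exact (hV.continuousAt (hT.mem_nhds (hs this))).mul hη.continuousAt

theorem integrable_mul_of_tsupport_subset {V η : Rn n → ℝ} {T : Set (Rn n)} (hT : IsOpen T)
    (hV : ContinuousOn V T) (hη : Continuous η) (hc : HasCompactSupport η) (hs : tsupport η ⊆ T) :
    Integrable fun y ↦ V y * η y :=
  (continuous_mul_of_tsupport_subset hT hV hη hs).integrable_of_hasCompactSupport hc.mul_left

theorem tsupport_pd_subset (i : Fin n) (η : Rn n → ℝ) : tsupport (pd i η) ⊆ tsupport η := by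
  refine closure_minimal (fun y hy ↦ ?_) (isClosed_tsupport η)
  by_contra h
  exact hy (by rw [pd, fderiv_of_notMem_tsupport ℝ h]; rfl)

/-- Integration by parts against a function with compact support in an open set. -/
theorem integral_mul_pd_eq_neg {V η : Rn n → ℝ} {T : Set (Rn n)} (hT : IsOpen T)
    (hV : ∀ y ∈ T, ContDiffAt ℝ ∞ V y) (hη : ContDiff ℝ ∞ η) (hc : HasCompactSupport η)
    (hs : tsupport η ⊆ T) (i : Fin n) :
    ∫ y, V y * pd i η y = -∫ y, pd i V y * η y := by
  have hVc : ContinuousOn V T := fun y hy ↦ (hV y hy).continuousAt.continuousWithinAt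
  have hV'c : ContinuousOn (pd i V) T := fun y hy ↦
    ((hV y hy).pd (k := ∞) (by simp) i).continuousAt.continuousWithinAt
  have hη' : Continuous (pd i η) := (hη.continuous_fderiv (by simp)).clm_apply continuous_const
  have hc' : HasCompactSupport (pd i η) := hc.mono' (subset_closure.trans (tsupport_pd_subset i η))
  refine integral_mul_fderiv_eq_neg_fderiv_mul_of_integrable
    (integrable_mul_of_tsupport_subset hT hV'c hη.continuous hc hs)
    (integrable_mul_of_tsupport_subset hT hVc hη' hc' ((tsupport_pd_subset i η).trans hs))
    (integrable_mul_of_tsupport_subset hT hVc hη.continuous hc hs)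
    (fun y hy ↦ (hV y (hs hy)).differentiableAt (by simp))
    (fun y _ ↦ (hη.differentiable (by simp)).differentiableAt)

end ParametricIntegral

/-! ### Deformations of the domain and their Euler–Lagrange equations -/

section DomainVariation

variable {n : ℕ}

/-- The deformation `y ↦ y + t η(y) e_c` of `ℝⁿ`. -/
def domainShift (η : Rn n → ℝ) (c : Fin n) (t : ℝ) (y : Rn n) : Rn n :=
  y + (t * η y) • EuclideanSpace.single c 1

/-- The coordinate expression of the density `trace (ψₜ^* h)` for the
deformation `ψₜ(y) = y + t η(y) e_c` and the weight `W = √g g⁻¹`. -/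
def variationDensity (W H : Rn n → Matrix (Fin n) (Fin n) ℝ) (η : Rn n → ℝ) (c : Fin n)
    (t : ℝ) (y : Rn n) : ℝ :=
  ∑ i, ∑ j, W y i j * ∑ a, ∑ b, H (domainShift η c t y) a b
    * ((if a = i then 1 else 0) + t * pd i η y * (if a = c then 1 else 0))
    * ((if b = j then 1 else 0) + t * pd j η y * (if b = c then 1 else 0))

theorem contDiff_domainShift {η : Rn n → ℝ} (hη : ContDiff ℝ ∞ η) (c : Fin n) :
    ContDiff ℝ ∞ (fun q : ℝ × Rn n ↦ domainShift η c q.1 q.2) :=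
  contDiff_snd.add ((contDiff_fst.mul (hη.comp contDiff_snd)).smul contDiff_const)

theorem contDiff_pd {η : Rn n → ℝ} (hη : ContDiff ℝ ∞ η) (i : Fin n) : ContDiff ℝ ∞ (pd i η) :=
  contDiff_iff_contDiffAt.2 fun _ ↦ hη.contDiffAt.pd (by simp) i

variable {W H : Rn n → Matrix (Fin n) (Fin n) ℝ} {T : Set (Rn n)} {η : Rn n → ℝ} {c : Fin n}

theorem contDiffAt_variationDensity (hW : ∀ y ∈ T, ∀ i j, ContDiffAt ℝ ∞ (fun z ↦ W z i j) y)
    (hH : ∀ y ∈ T, ∀ i j, ContDiffAt ℝ ∞ (fun z ↦ H z i j) y) (hη : ContDiff ℝ ∞ η)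
    {t : ℝ} {y : Rn n} (hy : y ∈ T) (ht : domainShift η c t y ∈ T) :
    ContDiffAt ℝ ∞ (Function.uncurry (variationDensity W H η c)) (t, y) := by
  have hfac : ∀ a i : Fin n, ContDiffAt ℝ ∞ (fun q : ℝ × Rn n ↦
      (if a = i then (1 : ℝ) else 0) + q.1 * pd i η q.2 * (if a = c then 1 else 0)) (t, y) :=
    fun a i ↦ contDiffAt_const.add ((contDiffAt_fst.mul
      ((contDiff_pd hη i).comp contDiff_snd).contDiffAt).mul contDiffAt_const)
  have hHt : ∀ a b, ContDiffAt ℝ ∞ (fun q : ℝ × Rn n ↦ H (domainShift η c q.1 q.2) a b) (t, y) :=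
    fun a b ↦ ContDiffAt.comp (g := fun z ↦ H z a b) (t, y) (hH _ ht a b)
      (contDiff_domainShift hη c).contDiffAt
  have hWt : ∀ i j, ContDiffAt ℝ ∞ (fun q : ℝ × Rn n ↦ W q.2 i j) (t, y) :=
    fun i j ↦ (hW y hy i j).comp (t, y) contDiffAt_snd
  have h : ContDiffAt ℝ ∞ (fun q : ℝ × Rn n ↦ ∑ i, ∑ j, W q.2 i j
      * ∑ a, ∑ b, H (domainShift η c q.1 q.2) a b
        * ((if a = i then 1 else 0) + q.1 * pd i η q.2 * (if a = c then 1 else 0))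
        * ((if b = j then 1 else 0) + q.1 * pd j η q.2 * (if b = c then 1 else 0))) (t, y) :=
    ContDiffAt.sum fun i _ ↦ ContDiffAt.sum fun j _ ↦ (hWt i j).mul
      (ContDiffAt.sum fun a _ ↦ ContDiffAt.sum fun b _ ↦
        ((hHt a b).mul (hfac a i)).mul (hfac b j))
  exact h

/-- One term comes from moving the argument of H in direction e_c, the other two from the two
Jacobian factors. At t = 0 these factors are Kronecker deltas, which collapse the inner sums. -/
theorem hasDerivAt_variationDensity {y : Rn n}
    (hH : ∀ i j, DifferentiableAt ℝ (fun z ↦ H z i j) y) :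
    HasDerivAt (fun t ↦ variationDensity W H η c t y)
      (∑ i, ∑ j, W y i j * (η y * pd c (fun z ↦ H z i j) y + H y c j * pd i η y
        + H y i c * pd j η y)) 0 := by
  have hshift : HasDerivAt (fun t ↦ domainShift η c t y)
      ((1 * η y) • (EuclideanSpace.single c 1 : Rn n)) 0 :=
    (((hasDerivAt_id (0 : ℝ)).mul_const (η y)).smul_const _).const_add y
  have h0 : domainShift η c 0 y = y := by simp [domainShift]
  have hHt : ∀ a b, HasDerivAt (fun t ↦ H (domainShift η c t y) a b)
      (η y * pd c (fun z ↦ H z a b) y) 0 := fun a b ↦ by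
    have h1 : HasFDerivAt (fun z ↦ H z a b) (fderiv ℝ (fun z ↦ H z a b) y)
        (domainShift η c 0 y) := by rw [h0]; exact (hH a b).hasFDerivAt
    have h2 : HasDerivAt (fun t ↦ H (domainShift η c t y) a b) _ 0 :=
      HasFDerivAt.comp_hasDerivAt (l := fun z ↦ H z a b) (0 : ℝ) h1 hshift
    refine h2.congr_deriv ?_
    rw [map_smul, one_mul, smul_eq_mul, pd]
  have hfac : ∀ a i : Fin n, HasDerivAt (fun t : ℝ ↦
      (if a = i then (1 : ℝ) else 0) + t * pd i η y * (if a = c then 1 else 0))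
      (pd i η y * if a = c then 1 else 0) 0 := fun a i ↦ by
    simpa using ((((hasDerivAt_id (0 : ℝ)).mul_const (pd i η y)).mul_const
      (if a = c then (1 : ℝ) else 0)).const_add (if a = i then (1 : ℝ) else 0))
  have key := HasDerivAt.fun_sum (u := Finset.univ) fun (i : Fin n) _ ↦
    HasDerivAt.fun_sum (u := Finset.univ) fun (j : Fin n) _ ↦ HasDerivAt.const_mul (W y i j)
      (HasDerivAt.fun_sum (u := Finset.univ) fun (a : Fin n) _ ↦
        HasDerivAt.fun_sum (u := Finset.univ) fun (b : Fin n) _ ↦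
          ((hHt a b).fun_mul (hfac a i)).fun_mul (hfac b j))
  refine key.congr_deriv ?_
  refine Finset.sum_congr rfl fun i _ ↦ Finset.sum_congr rfl fun j _ ↦ ?_
  congr 1
  simp only [h0, zero_mul, add_zero, add_mul, Finset.sum_add_distrib]
  simp [mul_ite, ite_mul]

theorem domainShift_of_notMem {t : ℝ} {y : Rn n} (hy : y ∉ tsupport η) :
    domainShift η c t y = y := by
  simp [domainShift, image_eq_zero_of_notMem_tsupport hy]

/-- For small parameters the deformation maps an open set containing its support to itself. -/
theorem exists_domainShift_mem (hT : IsOpen T) (hη : Continuous η) (hc : HasCompactSupport η)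
    (hs : tsupport η ⊆ T) (c : Fin n) :
    ∃ ε > 0, ∀ t ∈ Icc (-ε) ε, ∀ y ∈ T, domainShift η c t y ∈ T := by
  obtain ⟨δ, hδ, hδT⟩ := IsCompact.exists_cthickening_subset_open hc hT hs
  obtain ⟨C, hC⟩ := hη.bounded_above_of_compact_support hc
  have hC0 : 0 ≤ C := (norm_nonneg _).trans (hC 0)
  -- Displacements are at most |t| C, less than the distance δ to be kept within T; C + 1 keeps the
  -- denominator positive when C = 0.
  refine ⟨δ / (C + 1), by positivity, fun t ht y hy ↦ ?_⟩
  by_cases hys : y ∈ tsupport η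
  · refine hδT (Metric.mem_cthickening_of_dist_le _ y δ _ hys ?_)
    have h1 : |t| ≤ δ / (C + 1) := abs_le.2 ht
    have h2 : |η y| ≤ C + 1 := (hC y).trans (by linarith)
    calc dist (domainShift η c t y) y = |t| * |η y| := by
          simp [domainShift, norm_smul]
      _ ≤ δ / (C + 1) * (C + 1) := mul_le_mul h1 h2 (abs_nonneg _) (by positivity)
      _ = δ := by field_simp
  · rwa [domainShift_of_notMem hys]

/-- The Euler–Lagrange equations for deformations of the domain. -/
theorem euler_lagrange_of_variation (hT : IsOpen T)
    (hW : ∀ y ∈ T, ∀ i j, ContDiffAt ℝ ∞ (fun z ↦ W z i j) y)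
    (hH : ∀ y ∈ T, ∀ i j, ContDiffAt ℝ ∞ (fun z ↦ H z i j) y)
    (hWs : ∀ y ∈ T, (W y).IsSymm) (hHs : ∀ y ∈ T, (H y).IsSymm)
    {y₀ : Rn n} {r : ℝ} (hr : 0 < r) (hball : Metric.closedBall y₀ r ⊆ T) {c : Fin n}
    (hvar : ∀ η : Rn n → ℝ, ContDiff ℝ ∞ η → HasCompactSupport η →
      tsupport η ⊆ Metric.ball y₀ r →
      HasDerivAt (fun t ↦ ∫ y in Metric.ball y₀ r, variationDensity W H η c t y) 0 0) :
    ∑ i, ∑ j, W y₀ i j * pd c (fun z ↦ H z i j) y₀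
      = 2 * ∑ i, ∑ j, pd i (fun z ↦ W z i j * H z c j) y₀ := by
  set V : Fin n → Fin n → Rn n → ℝ := fun i j z ↦ W z i j * H z c j
  set P : Rn n → ℝ := fun y ↦ ∑ i, ∑ j, W y i j * pd c (fun z ↦ H z i j) y
  have hV : ∀ i j, ∀ y ∈ T, ContDiffAt ℝ ∞ (V i j) y := fun i j y hy ↦
    (hW y hy i j).mul (hH y hy c j)
  have hP : ContinuousOn P T := fun y hy ↦ ContinuousAt.continuousWithinAt <| by
    have h : ContDiffAt ℝ ∞ P y := ContDiffAt.sum fun i _ ↦ ContDiffAt.sum fun j _ ↦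
      (hW y hy i j).mul ((hH y hy i j).pd (by simp) c)
    exact h.continuousAt
  have hdV : ∀ i j, ContinuousOn (pd i (V i j)) T := fun i j y hy ↦
    ((hV i j y hy).pd (k := ∞) (by simp) i).continuousAt.continuousWithinAt
  have hbT : Metric.ball y₀ r ⊆ T := Metric.ball_subset_closedBall.trans hball
  have hG : ContinuousOn (fun y ↦ P y - 2 * ∑ i, ∑ j, pd i (V i j) y) T :=
    hP.sub (continuousOn_const.mul (continuousOn_finsetSum _ fun i _ ↦
      continuousOn_finsetSum _ fun j _ ↦ hdV i j))
  -- The fundamental lemma of the calculus of variations gives vanishing almost everywhere on the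
  -- ball, and continuity gives it at the centre.
  have hae := Metric.isOpen_ball.ae_eq_zero_of_integral_contDiff_smul_eq_zero
    (μ := (volume : Measure (Rn n))) (U := Metric.ball y₀ r)
    ((hG.mono hbT).locallyIntegrableOn Metric.isOpen_ball.measurableSet) ?_
  · have h := Measure.eqOn_open_of_ae_eq (g := fun _ ↦ (0 : ℝ))
      ((ae_restrict_iff' Metric.isOpen_ball.measurableSet).2 hae) Metric.isOpen_ball
      (hG.mono hbT) continuousOn_const (Metric.mem_ball_self hr)
    exact sub_eq_zero.1 h
  intro η hη hc hs
  have hsT := hs.trans hbT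
  obtain ⟨ε, hε, hshift⟩ := exists_domainShift_mem hT hη.continuous hc hsT c
  have hder := hasDerivAt_setIntegral_ball (J := variationDensity W H η c) hε
    (fun t ht y hy ↦ (contDiffAt_variationDensity hW hH hη (hball hy)
      (hshift t ht y (hball hy))).of_le (by norm_cast))
    (fun y hy ↦ hasDerivAt_variationDensity
      fun i j ↦ (hH y (hbT hy) i j).differentiableAt (by simp))
  have hzero := hder.unique (hvar η hη hc hs)
  have hη0 : ∀ y, y ∉ tsupport η → η y = 0 := fun y hy ↦ image_eq_zero_of_notMem_tsupport hy
  have hpd0 : ∀ i y, y ∉ tsupport η → pd i η y = 0 := fun i y hy ↦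
    image_eq_zero_of_notMem_tsupport fun h ↦ hy (tsupport_pd_subset i η h)
  rw [setIntegral_eq_integral_of_forall_compl_eq_zero (fun y hy ↦ by
    have hy' : y ∉ tsupport η := fun h ↦ hy (hs h)
    simp [hη0 y hy', hpd0 _ y hy'])] at hzero
  -- The two Jacobian terms coincide by the symmetry of W and H, whence the factor 2. Off the
  -- support of η the symmetry may fail, but there both sides are zero.
  have hpt : ∀ y, ∑ i, ∑ j, W y i j * (η y * pd c (fun z ↦ H z i j) y + H y c j * pd i η y
      + H y i c * pd j η y) = P y * η y + 2 * ∑ i, ∑ j, V i j y * pd i η y := fun y ↦ by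
    by_cases hy : y ∈ tsupport η
    · have hyT := hsT hy
      have e : ∑ i, ∑ j, W y i j * (H y i c * pd j η y) = ∑ i, ∑ j, V i j y * pd i η y := by
        rw [Finset.sum_comm]
        refine Finset.sum_congr rfl fun i _ ↦ Finset.sum_congr rfl fun j _ ↦ ?_
        rw [(hWs y hyT).apply, (hHs y hyT).apply, mul_assoc]
      simp only [mul_add, Finset.sum_add_distrib, e, two_mul, ← add_assoc]
      congr 2
      · simp only [P, Finset.sum_mul]
        exact Finset.sum_congr rfl fun i _ ↦ Finset.sum_congr rfl fun j _ ↦ by ring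
      · exact Finset.sum_congr rfl fun i _ ↦ Finset.sum_congr rfl fun j _ ↦ by ring
    · simp [hη0 y hy, hpd0 _ y hy]
  simp only [hpt] at hzero
  have hηpd : ∀ i, Continuous (pd i η) := fun i ↦ (contDiff_pd hη i).continuous
  have hcpd : ∀ i, HasCompactSupport (pd i η) := fun i ↦
    hc.mono' (subset_closure.trans (tsupport_pd_subset i η))
  have hVc : ∀ i j, ContinuousOn (V i j) T := fun i j y hy ↦
    (hV i j y hy).continuousAt.continuousWithinAt
  have i1 : Integrable fun y ↦ P y * η y :=
    integrable_mul_of_tsupport_subset hT hP hη.continuous hc hsT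
  have i2 : ∀ i j, Integrable fun y ↦ V i j y * pd i η y := fun i j ↦
    integrable_mul_of_tsupport_subset hT (hVc i j) (hηpd i) (hcpd i)
      ((tsupport_pd_subset i η).trans hsT)
  have i3 : ∀ i j, Integrable fun y ↦ pd i (V i j) y * η y := fun i j ↦
    integrable_mul_of_tsupport_subset hT (hdV i j) hη.continuous hc hsT
  rw [integral_add i1 ((integrable_finsetSum _ fun i _ ↦
    integrable_finsetSum _ fun j _ ↦ i2 i j).const_mul 2), integral_const_mul,
    -- The remaining derivatives of η are now integrated by parts; what stays is the Euler–Lagrange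
    -- expression tested against η.
    integral_finsetSum _ fun i _ ↦ integrable_finsetSum _ fun j _ ↦ i2 i j] at hzero
  simp only [integral_finsetSum _ fun j _ ↦ i2 _ j,
    integral_mul_pd_eq_neg hT (hV _ _) hη hc hsT, Finset.sum_neg_distrib] at hzero
  have e : ∀ y, η y • (P y - 2 * ∑ i, ∑ j, pd i (V i j) y)
      = P y * η y - 2 * ∑ i, ∑ j, pd i (V i j) y * η y := fun y ↦ by
    simp only [smul_eq_mul, ← Finset.sum_mul]; ring
  simp only [e]
  rw [integral_sub i1 ((integrable_finsetSum _ fun i _ ↦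
    integrable_finsetSum _ fun j _ ↦ i3 i j).const_mul 2), integral_const_mul,
    integral_finsetSum _ fun i _ ↦ integrable_finsetSum _ fun j _ ↦ i3 i j]
  simp only [integral_finsetSum _ fun j _ ↦ i3 _ j]
  linarith

end DomainVariation

/-! ### Harmonic maps have divergence-free stress tensor -/

section FirstVariation

variable {n m : ℕ} {M N : Type*}
  [TopologicalSpace M] [ChartedSpace (Rn n) M] [IsManifold (𝓡 n) ∞ M]
  [TopologicalSpace N] [ChartedSpace (Rn m) N] [IsManifold (𝓡 m) ∞ N]

theorem pd_domainShift {η : Rn n → ℝ} {c : Fin n} {y : Rn n} (hη : DifferentiableAt ℝ η y) (t : ℝ)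
    (i a : Fin n) : pd i (fun z ↦ domainShift η c t z a) y
      = (if a = i then 1 else 0) + t * pd i η y * (if a = c then 1 else 0) := by
  have h1 : pd i (fun z : Rn n ↦ z a) y = if a = i then 1 else 0 := by
    have h := (EuclideanSpace.proj a : Rn n →L[ℝ] ℝ).hasFDerivAt (x := y)
    have h' : fderiv ℝ (fun z : Rn n ↦ z a) y = EuclideanSpace.proj a := h.fderiv
    rw [pd, h']
    simp
  have h2 : (fun z ↦ domainShift η c t z a)
      = fun z : Rn n ↦ z a + (t * if a = c then 1 else 0) * η z := by
    funext z
    simp [domainShift]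
  have h3 : DifferentiableAt ℝ (fun z : Rn n ↦ z a) y :=
    (EuclideanSpace.proj a : Rn n →L[ℝ] ℝ).differentiableAt
  rw [h2, pd_add i h3 (hη.const_mul _), pd_const_mul i _ hη, h1]
  ring

/-- The components of the pullback metric under a change of the domain. -/
theorem coordTensor_pullbackMetric_comp (gbar : RiemMetric m N) {f f' : M → N} {p : M}
    {ψ : Rn n → Rn n} {y : Rn n} (hf : ContMDiff (𝓡 n) (𝓡 m) ∞ f)
    (hf' : ContMDiff (𝓡 n) (𝓡 m) ∞ f') (hψ : DifferentiableAt ℝ ψ y)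
    (hy : y ∈ (extChartAt (𝓡 n) p).target) (hψy : ψ y ∈ (extChartAt (𝓡 n) p).target)
    (heq : ∀ᶠ z in 𝓝 y,
      f' ((extChartAt (𝓡 n) p).symm z) = f ((extChartAt (𝓡 n) p).symm (ψ z))) (i j : Fin n) :
    coordTensor (pullbackMetric gbar f') p y i j
      = ∑ a, ∑ b, coordTensor (pullbackMetric gbar f) p (ψ y) a b
        * pd i (fun z ↦ ψ z a) y * pd j (fun z ↦ ψ z b) y := by
  set e := extChartAt (𝓡 n) p
  let L : Rn n →L[ℝ] Rn m := mfderiv (𝓡 n) (𝓡 m) (f ∘ e.symm) (ψ y)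
  let L' : Rn n →L[ℝ] Rn m := mfderiv (𝓡 n) (𝓡 m) (f' ∘ e.symm) y
  have hd : MDifferentiableAt (𝓡 n) (𝓡 m) (f ∘ e.symm) (ψ y) :=
    (hf.contMDiffAt.comp _ (contMDiffAt_chart_symm hψy)).mdifferentiableAt (by simp)
  have hL : L' = L ∘L fderiv ℝ ψ y := by
    have h1 : HasMFDerivAt (𝓡 n) (𝓡 m) ((f ∘ e.symm) ∘ ψ) y (L ∘L fderiv ℝ ψ y) :=
      hd.hasMFDerivAt.comp y hψ.hasFDerivAt.hasMFDerivAt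
    exact (h1.congr_of_eventuallyEq heq).mfderiv
  obtain ⟨B, hB⟩ := isBilinAt_clm (fun x ↦ gbar.inner x) (f (e.symm (ψ y)))
  have h1 : coordTensor (pullbackMetric gbar f') p y i j
      = B (L' (EuclideanSpace.single i 1)) (L' (EuclideanSpace.single j 1)) := by
    rw [coordTensor_pullbackMetric gbar (hf'.mdifferentiableAt (by simp)) hy, ← hB]
    exact congrArg (fun x ↦ (gbar.inner : N → Rn m →L[ℝ] Rn m →L[ℝ] ℝ) x _ _) heq.self_of_nhds
  have h2 : ∀ a b, coordTensor (pullbackMetric gbar f) p (ψ y) a b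
      = B (L (EuclideanSpace.single a 1)) (L (EuclideanSpace.single b 1)) := fun a b ↦
    (coordTensor_pullbackMetric gbar (hf.mdifferentiableAt (by simp)) hψy a b).trans (hB _ _)
  rw [h1, hL]
  simp only [h2, ContinuousLinearMap.comp_apply]
  rw [bilin_eq_sum]
  refine Finset.sum_congr rfl fun a _ ↦ Finset.sum_congr rfl fun b _ ↦ ?_
  rw [pd, pd, fderiv_apply_coord hψ, fderiv_apply_coord hψ]

open Classical in
/-- The variation of `f` obtained by moving the domain by `y ↦ y + t η(y) e_c` in the chart at
`p`. -/
def domainVariation (f : M → N) (p : M) (η : Rn n → ℝ) (c : Fin n) (t : ℝ) (x : M) : N :=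
  if x ∈ (extChartAt (𝓡 n) p).source then
    f ((extChartAt (𝓡 n) p).symm (domainShift η c t (extChartAt (𝓡 n) p x))) else f x

variable {f : M → N} {p : M} {η : Rn n → ℝ} {c : Fin n}

theorem domainVariation_symm {t : ℝ} {y : Rn n} (hy : y ∈ (extChartAt (𝓡 n) p).target) :
    domainVariation f p η c t ((extChartAt (𝓡 n) p).symm y)
      = f ((extChartAt (𝓡 n) p).symm (domainShift η c t y)) := by
  rw [domainVariation, if_pos ((extChartAt (𝓡 n) p).map_target hy),
    (extChartAt (𝓡 n) p).right_inv hy]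

theorem domainVariation_zero : domainVariation f p η c 0 = f := by
  funext x
  rw [domainVariation]
  split_ifs with hx
  · have h0 : domainShift η c 0 (extChartAt (𝓡 n) p x) = extChartAt (𝓡 n) p x := by
      simp [domainShift]
    rw [h0, (extChartAt (𝓡 n) p).left_inv hx]
  · rfl

theorem domainVariation_of_notMem {t : ℝ} {x : M}
    (hx : x ∉ (extChartAt (𝓡 n) p).symm '' tsupport η) :
    domainVariation f p η c t x = f x := by
  rw [domainVariation]
  split_ifs with hs
  · have : extChartAt (𝓡 n) p x ∉ tsupport η := fun h ↦
      hx ⟨_, h, (extChartAt (𝓡 n) p).left_inv hs⟩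
    rw [domainShift_of_notMem this, (extChartAt (𝓡 n) p).left_inv hs]
  · rfl

/-- Inside the chart domain the map is a composite of smooth maps. A point outside it avoids the
image of the support of η, which is compact and therefore closed by the Hausdorff property, so near
that point nothing has moved. -/
theorem contMDiffAt_domainVariation [T2Space M] (hf : ContMDiff (𝓡 n) (𝓡 m) ∞ f)
    (hη : ContDiff ℝ ∞ η) (hc : HasCompactSupport η)
    (hs : tsupport η ⊆ (extChartAt (𝓡 n) p).target) {t : ℝ}
    (ht : ∀ y ∈ (extChartAt (𝓡 n) p).target, domainShift η c t y ∈ (extChartAt (𝓡 n) p).target)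
    (x : M) :
    ContMDiffAt (𝓘(ℝ, ℝ).prod (𝓡 n)) (𝓡 m) ∞
      (fun q : ℝ × M ↦ domainVariation f p η c q.1 q.2) (t, x) := by
  set e := extChartAt (𝓡 n) p
  by_cases hx : x ∈ e.source
  · have h1 : ContMDiffAt (𝓘(ℝ, ℝ).prod (𝓡 n)) 𝓘(ℝ, ℝ × Rn n) ∞
        (fun q : ℝ × M ↦ (q.1, e q.2)) (t, x) :=
      contMDiffAt_fst.prodMk_space ((contMDiffAt_chart hx).comp (t, x) contMDiffAt_snd)
    have h2 := (contDiff_domainShift hη c).contMDiff.contMDiffAt.comp (t, x) h1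
    have h3 := hf.contMDiffAt.comp (t, x)
      ((contMDiffAt_chart_symm (ht _ (e.map_source hx))).comp (t, x) h2)
    refine h3.congr_of_eventuallyEq ?_
    filter_upwards [continuousAt_snd.preimage_mem_nhds
      ((isOpen_extChartAt_source p).mem_nhds hx)] with q hq
    exact if_pos hq
  · have hK : IsClosed (e.symm '' tsupport η) :=
      (IsCompact.image_of_continuousOn hc ((continuousOn_extChartAt_symm p).mono hs)).isClosed
    have hxK : x ∉ e.symm '' tsupport η := by
      rintro ⟨y, hy, rfl⟩
      exact hx (e.map_target (hs hy))
    refine (hf.contMDiffAt.comp (t, x) contMDiffAt_snd).congr_of_eventuallyEq ?_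
    filter_upwards [continuousAt_snd.preimage_mem_nhds (hK.isOpen_compl.mem_nhds hxK)] with q hq
    exact domainVariation_of_notMem hq

variable [MeasurableSpace M] [BorelSpace M]

theorem energyDensity_symm (g : RiemMetric n M) (gbar : RiemMetric m N) (f : M → N) {y : Rn n}
    (hy : y ∈ (extChartAt (𝓡 n) p).target) :
    energyDensity g gbar f ((extChartAt (𝓡 n) p).symm y)
      = ∑ i, ∑ j, (coordMetric g p y)⁻¹ i j * coordTensor (pullbackMetric gbar f) p y i j :=
  metricTrace_eq g hy (isBilinAt_pullbackMetric gbar f _)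

theorem continuousOn_energyDensity_symm (g : RiemMetric n M) (gbar : RiemMetric m N)
    (hf : ContMDiff (𝓡 n) (𝓡 m) ∞ f) (p : M) :
    ContinuousOn (fun y ↦ energyDensity g gbar f ((extChartAt (𝓡 n) p).symm y))
      (extChartAt (𝓡 n) p).target := by
  refine ContinuousOn.congr (fun y hy ↦ ?_) fun y hy ↦ energyDensity_symm g gbar f hy
  have h : ContDiffAt ℝ ∞ (fun y ↦ ∑ i, ∑ j, (coordMetric g p y)⁻¹ i j
      * coordTensor (pullbackMetric gbar f) p y i j) y :=
    ContDiffAt.sum fun i _ ↦ ContDiffAt.sum fun j _ ↦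
      ((isMetricAt_coordMetric g hy).smooth_inv i j).mul
        (contDiffAt_coordTensor_pullbackMetric gbar hf hy i j)
  exact h.continuousAt.continuousWithinAt

/-- The energy of a domain variation over a coordinate ball. -/
theorem energyOn_domainVariation [T2Space M] (g : RiemMetric n M) (gbar : RiemMetric m N)
    (hf : ContMDiff (𝓡 n) (𝓡 m) ∞ f) (hη : ContDiff ℝ ∞ η) (hc : HasCompactSupport η)
    (hs : tsupport η ⊆ (extChartAt (𝓡 n) p).target) {t : ℝ}
    (ht : ∀ y ∈ (extChartAt (𝓡 n) p).target, domainShift η c t y ∈ (extChartAt (𝓡 n) p).target)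
    {b : Set (Rn n)} (hb : IsOpen b) (hbT : b ⊆ (extChartAt (𝓡 n) p).target) :
    energyOn g gbar ((extChartAt (𝓡 n) p).source ∩ extChartAt (𝓡 n) p ⁻¹' b)
        (domainVariation f p η c t)
      = (1 / 2) * ∫ y in b, variationDensity
        (fun y ↦ √(coordMetric g p y).det • (coordMetric g p y)⁻¹)
        (coordTensor (pullbackMetric gbar f) p) η c t y := by
  have hft : ContMDiff (𝓡 n) (𝓡 m) ∞ (domainVariation f p η c t) := fun x ↦
    (contMDiffAt_domainVariation hf hη hc hs ht x).comp x
      (contMDiffAt_const.prodMk contMDiffAt_id)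
  have hU : IsOpen ((extChartAt (𝓡 n) p).source ∩ extChartAt (𝓡 n) p ⁻¹' b) :=
    (continuousOn_extChartAt p).isOpen_inter_preimage (isOpen_extChartAt_source p) hb
  rw [energyOn, setIntegral_riemVol g hU.measurableSet inter_subset_left
    (continuousOn_energyDensity_symm g gbar hft p)]
  have hset : (extChartAt (𝓡 n) p).symm ⁻¹' ((extChartAt (𝓡 n) p).source ∩ extChartAt (𝓡 n) p ⁻¹' b)
      ∩ (extChartAt (𝓡 n) p).target = b := by
    ext y
    constructor
    · rintro ⟨⟨_, h⟩, hy⟩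
      rwa [mem_preimage, (extChartAt (𝓡 n) p).right_inv hy] at h
    · intro hy
      refine ⟨⟨(extChartAt (𝓡 n) p).map_target (hbT hy), ?_⟩, hbT hy⟩
      rwa [mem_preimage, (extChartAt (𝓡 n) p).right_inv (hbT hy)]
  rw [hset]
  congr 1
  refine setIntegral_congr_fun hb.measurableSet fun y hy ↦ ?_
  have hyT := hbT hy
  have hψ : DifferentiableAt ℝ (domainShift η c t) y :=
    ((contDiff_domainShift hη c).comp (contDiff_const.prodMk contDiff_id) :
      ContDiff ℝ ∞ (domainShift η c t)).differentiable (by simp) y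
  have hηd : DifferentiableAt ℝ η y := hη.differentiable (by simp) y
  have hev : ∀ᶠ z in 𝓝 y, domainVariation f p η c t ((extChartAt (𝓡 n) p).symm z)
      = f ((extChartAt (𝓡 n) p).symm (domainShift η c t z)) := by
    filter_upwards [(isOpen_extChartAt_target p).mem_nhds hyT] with z hz
    exact domainVariation_symm hz
  simp only [energyDensity_symm g gbar _ hyT, variationDensity,
    coordTensor_pullbackMetric_comp gbar hf hft hψ hyT (ht y hyT) hev, pd_domainShift hηd,
    Matrix.smul_apply, smul_eq_mul, Finset.mul_sum, mul_assoc]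

/-- The stress-energy tensor of a harmonic map is divergence free. -/
theorem stressDiv_pullbackMetric_eq_zero [T2Space M] [CompactSpace M] {g : RiemMetric n M}
    {gbar : RiemMetric m N} (hf : IsHarmonicMap g gbar f) (p : M) (c : Fin n) :
    stressDiv (coordMetric g p) (coordTensor (pullbackMetric gbar f) p) c
      (extChartAt (𝓡 n) p p) = 0 := by
  set T := (extChartAt (𝓡 n) p).target
  set y₀ := extChartAt (𝓡 n) p p
  have hT : IsOpen T := isOpen_extChartAt_target p
  have hy₀ : y₀ ∈ T := mem_extChartAt_target p
  obtain ⟨r, hr, hball⟩ := Metric.nhds_basis_closedBall.mem_iff.1 (hT.mem_nhds hy₀)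
  have hsymm : ∀ y : Rn n, (coordTensor (pullbackMetric gbar f) p y).IsSymm := fun y ↦ by
    ext i j
    exact gbar.symm _ _ _
  have hH : ∀ y ∈ T, ∀ i j,
      ContDiffAt ℝ ∞ (fun z ↦ coordTensor (pullbackMetric gbar f) p z i j) y :=
    fun y hy i j ↦ contDiffAt_coordTensor_pullbackMetric gbar hf.1 hy i j
  have hW : ∀ y ∈ T, ∀ i j, ContDiffAt ℝ ∞
      (fun z ↦ (√(coordMetric g p z).det • (coordMetric g p z)⁻¹) i j) y := fun y hy i j ↦
    (isMetricAt_coordMetric g hy).contDiffAt_sqrt_det.mul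
      ((isMetricAt_coordMetric g hy).smooth_inv i j)
  refine (isMetricAt_coordMetric g hy₀).stressDiv_eq_zero
    (fun i j ↦ (hH y₀ hy₀ i j).differentiableAt (by simp)) (Eventually.of_forall hsymm) ?_
  refine euler_lagrange_of_variation hT hW hH
    (fun y hy ↦ (isMetricAt_coordMetric g hy).symm_inv.smul _) (fun y _ ↦ hsymm y) hr hball ?_
  intro η hη hc hs
  have hbT : Metric.ball y₀ r ⊆ T := Metric.ball_subset_closedBall.trans hball
  have hsT := hs.trans hbT
  obtain ⟨ε, hε, hshift⟩ := exists_domainShift_mem hT hη.continuous hc hsT c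
  have hmem : ∀ t ∈ Ioo (-ε) ε, ∀ y ∈ T, domainShift η c t y ∈ T := fun t ht ↦
    hshift t (Ioo_subset_Icc_self ht)
  -- The open set is a coordinate ball around p and the compact set is the image of the support of
  -- η, so the energy is an integral over a Euclidean ball that does not depend on t.
  have hder := hf.2 ((extChartAt (𝓡 n) p).source ∩ extChartAt (𝓡 n) p ⁻¹' Metric.ball y₀ r)
    ((extChartAt (𝓡 n) p).symm '' tsupport η) (domainVariation f p η c) ε
    ((continuousOn_extChartAt p).isOpen_inter_preimage (isOpen_extChartAt_source p)
      Metric.isOpen_ball) isClosed_closure.isCompact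
    (IsCompact.image_of_continuousOn hc ((continuousOn_extChartAt_symm p).mono hsT))
    ?_ hε
    (fun q hq ↦ (contMDiffAt_domainVariation hf.1 hη hc hsT (hmem _ hq.1) q.2).contMDiffWithinAt)
    domainVariation_zero (fun t _ x hx ↦ domainVariation_of_notMem hx)
  -- The factor 2 removes the ½ in the energy.
  · have hder2 := hder.const_mul 2
    rw [mul_zero] at hder2
    refine hder2.congr_of_eventuallyEq ?_
    filter_upwards [Ioo_mem_nhds (neg_lt_zero.2 hε) hε] with t ht
    rw [energyOn_domainVariation g gbar hf.1 hη hc hsT (hmem t ht) Metric.isOpen_ball hbT]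
    ring
  · rintro _ ⟨y, hy, rfl⟩
    refine ⟨(extChartAt (𝓡 n) p).map_target (hsT hy), ?_⟩
    rw [mem_preimage, (extChartAt (𝓡 n) p).right_inv (hsT hy)]
    exact hs hy

end FirstVariation

/-! ### The first variation of the tension field at the identity -/

section TensionDerivative

variable {n : ℕ}

theorem fderiv_fderiv_comm {E : Type*} [NormedAddCommGroup E] [NormedSpace ℝ E] {U : E → ℝ} {q : E}
    (h : ContDiffAt ℝ 2 U q) (v w : E) :
    fderiv ℝ (fun q ↦ fderiv ℝ U q v) q w = fderiv ℝ (fun q ↦ fderiv ℝ U q w) q v := by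
  have hd : DifferentiableAt ℝ (fderiv ℝ U) q :=
    (h.fderiv_right (m := 1) (by norm_num)).differentiableAt (by norm_num)
  have key : ∀ a b : E, fderiv ℝ (fun q ↦ fderiv ℝ U q a) q b = fderiv ℝ (fderiv ℝ U) q b a := by
    intro a b
    rw [fderiv_clm_apply hd (by fun_prop)]
    simp
  rw [key, key]
  exact (h.isSymmSndFDerivAt (by simp)).eq _ _

variable {U : ℝ × Rn n → ℝ} {X : Rn n → ℝ} {y z : Rn n} {t : ℝ}

theorem pd_slice (h : DifferentiableAt ℝ U (t, z)) (i : Fin n) :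
    pd i (fun z ↦ U (t, z)) z = fderiv ℝ U (t, z) (0, EuclideanSpace.single i 1) := by
  have h2 : HasFDerivAt (fun z : Rn n ↦ (t, z)) (ContinuousLinearMap.inr ℝ ℝ (Rn n)) z :=
    hasFDerivAt_prodMk_right t z
  have h3 : HasFDerivAt (fun z ↦ U (t, z)) _ z := h.hasFDerivAt.comp z h2
  rw [pd, h3.fderiv]
  simp

theorem hasDerivAt_slice (h : DifferentiableAt ℝ U (t, z)) :
    HasDerivAt (fun t ↦ U (t, z)) (fderiv ℝ U (t, z) (1, 0)) t :=
  h.hasFDerivAt.comp_hasDerivAt t ((hasDerivAt_id t).prodMk (hasDerivAt_const t z))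

theorem eventually_contDiffAt_two {q : ℝ × Rn n} (h : ContDiffAt ℝ ∞ U q) :
    ∀ᶠ q in 𝓝 q, ContDiffAt ℝ 2 U q :=
  (h.of_le (m := 2) (by norm_cast)).eventually (by simp)

theorem eventually_prodMk_zero {P : ℝ × Rn n → Prop} (h : ∀ᶠ q in 𝓝 ((0 : ℝ), y), P q) :
    ∀ᶠ z in 𝓝 y, P (0, z) :=
  (by fun_prop : ContinuousAt (fun z : Rn n ↦ ((0 : ℝ), z)) y).eventually h

theorem eventually_prodMk_left {P : ℝ × Rn n → Prop} (h : ∀ᶠ q in 𝓝 ((0 : ℝ), y), P q) :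
    ∀ᶠ t in 𝓝 (0 : ℝ), ∀ᶠ z in 𝓝 y, P (t, z) := by
  rw [nhds_prod_eq] at h
  exact h.curry

/-- Spatial and time derivatives commute. -/
theorem hasDerivAt_pd (h : ContDiffAt ℝ ∞ U (0, y))
    (hX : ∀ᶠ z in 𝓝 y, HasDerivAt (fun t ↦ U (t, z)) (X z) 0) (i : Fin n) :
    HasDerivAt (fun t ↦ pd i (fun z ↦ U (t, z)) y) (pd i X y) 0 := by
  have h2 := eventually_contDiffAt_two h
  have hp : ∀ v : ℝ × Rn n, ContDiffAt ℝ ∞ (fun q ↦ fderiv ℝ U q v) (0, y) := fun v ↦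
    (h.fderiv_right (m := ∞) (by simp)).clm_apply contDiffAt_const
  have e1 : (fun t ↦ pd i (fun z ↦ U (t, z)) y)
      =ᶠ[𝓝 0] fun t ↦ fderiv ℝ U (t, y) (0, EuclideanSpace.single i 1) := by
    filter_upwards [eventually_prodMk_left h2] with t ht
    exact pd_slice (ht.self_of_nhds.differentiableAt (by simp)) i
  have e2 : X =ᶠ[𝓝 y] fun z ↦ fderiv ℝ U (0, z) (1, 0) := by
    filter_upwards [hX, eventually_prodMk_zero h2] with z hz hz2
    exact hz.unique (hasDerivAt_slice (hz2.differentiableAt (by simp)))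
  refine HasDerivAt.congr_of_eventuallyEq ?_ e1
  rw [pd_congr e2, pd_slice (U := fun q ↦ fderiv ℝ U q (1, 0))
    ((hp _).differentiableAt (by simp)), fderiv_fderiv_comm h2.self_of_nhds]
  exact hasDerivAt_slice (U := fun q ↦ fderiv ℝ U q (0, EuclideanSpace.single i 1))
    ((hp _).differentiableAt (by simp))

/-- `hasDerivAt_pd` is applied to the spatial derivative of U. Its time derivative must be
identified at t = 0 for all z near y, not only at y, because another spatial derivative follows. -/
theorem hasDerivAt_pd_pd (h : ContDiffAt ℝ ∞ U (0, y))
    (hX : ∀ᶠ z in 𝓝 y, HasDerivAt (fun t ↦ U (t, z)) (X z) 0) (i j : Fin n) :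
    HasDerivAt (fun t ↦ pd i (pd j fun z ↦ U (t, z)) y) (pd i (pd j X) y) 0 := by
  have h2 := eventually_contDiffAt_two h
  have hp : ∀ v : ℝ × Rn n, ContDiffAt ℝ ∞ (fun q ↦ fderiv ℝ U q v) (0, y) := fun v ↦
    (h.fderiv_right (m := ∞) (by simp)).clm_apply contDiffAt_const
  have e1 : (fun t ↦ pd i (pd j fun z ↦ U (t, z)) y) =ᶠ[𝓝 0]
      fun t ↦ pd i (fun z ↦ fderiv ℝ U (t, z) (0, EuclideanSpace.single j 1)) y := by
    filter_upwards [eventually_prodMk_left h2] with t ht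
    refine pd_congr ?_
    filter_upwards [ht] with z hz
    exact pd_slice (hz.differentiableAt (by simp)) j
  refine HasDerivAt.congr_of_eventuallyEq ?_ e1
  refine hasDerivAt_pd (U := fun q ↦ fderiv ℝ U q (0, EuclideanSpace.single j 1)) (hp _) ?_ i
  have e2 : X =ᶠ[𝓝 y] fun z ↦ fderiv ℝ U (0, z) (1, 0) := by
    filter_upwards [hX, eventually_prodMk_zero h2] with z hz hz2
    exact hz.unique (hasDerivAt_slice (hz2.differentiableAt (by simp)))
  have hd : ∀ v : ℝ × Rn n, ∀ᶠ z in 𝓝 y, DifferentiableAt ℝ (fun q ↦ fderiv ℝ U q v) (0, z) :=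
    fun v ↦ by
      filter_upwards [eventually_prodMk_zero (eventually_contDiffAt_two (hp v))] with z hz
      exact hz.differentiableAt (by simp)
  filter_upwards [e2.eventuallyEq_nhds, eventually_prodMk_zero h2, hd (1, 0),
    hd (0, EuclideanSpace.single j 1)] with z hz hz2 hd1 hd2
  rw [pd_congr hz, pd_slice (U := fun q ↦ fderiv ℝ U q (1, 0)) hd1, fderiv_fderiv_comm hz2]
  exact hasDerivAt_slice (U := fun q ↦ fderiv ℝ U q (0, EuclideanSpace.single j 1)) hd2

/-- The first variation of the tension field at the identity is the trace of the Lie derivative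
of the connection. -/
theorem IsMetricAt.hasDerivAt_tension {A : Rn n → Matrix (Fin n) (Fin n) ℝ} (hA : IsMetricAt A y)
    {u : ℝ → Rn n → Rn n} {X : Rn n → Rn n}
    (hu : ContDiffAt ℝ ∞ (fun q : ℝ × Rn n ↦ u q.1 q.2) (0, y))
    (hu0 : ∀ᶠ z in 𝓝 y, u 0 z = z)
    (hX : ∀ᶠ z in 𝓝 y, HasDerivAt (fun t ↦ u t z) (X z) 0) (k : Fin n) :
    HasDerivAt (fun t ↦ ∑ i, ∑ j, (A y)⁻¹ i j *
      (pd i (pd j (fun z ↦ u t z k)) y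
        - ∑ l, metricChristoffel A l i j y * pd l (fun z ↦ u t z k) y
        + ∑ a, ∑ b, metricChristoffel A k a b (u t y) * pd i (fun z ↦ u t z a) y
          * pd j (fun z ↦ u t z b) y)) (lieTension A (fun z a ↦ X z a) k y) 0 := by
  have hua : ∀ a, ContDiffAt ℝ ∞ (fun q : ℝ × Rn n ↦ u q.1 q.2 a) (0, y) := fun a ↦
    (EuclideanSpace.proj a : Rn n →L[ℝ] ℝ).contDiff.contDiffAt.comp (0, y) hu
  have hXa : ∀ a, ∀ᶠ z in 𝓝 y, HasDerivAt (fun t ↦ u t z a) (X z a) 0 := fun a ↦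
    hX.mono fun z hz ↦ (EuclideanSpace.proj a : Rn n →L[ℝ] ℝ).hasFDerivAt.comp_hasDerivAt 0 hz
  have h0 : u 0 y = y := hu0.self_of_nhds
  have hδ : ∀ i a, pd i (fun z ↦ u 0 z a) y = if a = i then 1 else 0 := fun i a ↦ by
    have e : (fun z ↦ u 0 z a) =ᶠ[𝓝 y] fun z ↦ z a := hu0.mono fun z hz ↦ congrArg (· a) hz
    have h' : fderiv ℝ (fun z : Rn n ↦ z a) y = EuclideanSpace.proj a :=
      (EuclideanSpace.proj a : Rn n →L[ℝ] ℝ).hasFDerivAt.fderiv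
    rw [pd_congr e, pd, h']
    simp
  have d1 : ∀ i a, HasDerivAt (fun t ↦ pd i (fun z ↦ u t z a) y) (pd i (fun z ↦ X z a) y) 0 :=
    fun i a ↦ hasDerivAt_pd (U := fun q ↦ u q.1 q.2 a) (hua a) (hXa a) i
  have d2 : ∀ i j, HasDerivAt (fun t ↦ pd i (pd j fun z ↦ u t z k) y)
      (pd i (pd j fun z ↦ X z k) y) 0 :=
    fun i j ↦ hasDerivAt_pd_pd (U := fun q ↦ u q.1 q.2 k) (hua k) (hXa k) i j
  have d3 : ∀ a b, HasDerivAt (fun t ↦ metricChristoffel A k a b (u t y))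
      (∑ c, X y c * pd c (metricChristoffel A k a b) y) 0 := fun a b ↦ by
    have hd : HasFDerivAt (metricChristoffel A k a b) (fderiv ℝ (metricChristoffel A k a b) y)
        (u 0 y) := by
      rw [h0]; exact ((hA.smooth_christoffel k a b).differentiableAt (by simp)).hasFDerivAt
    rw [← fderiv_eq_sum_pd]
    exact hd.comp_hasDerivAt 0 hX.self_of_nhds
  have key := HasDerivAt.fun_sum (u := Finset.univ) fun (i : Fin n) _ ↦
    HasDerivAt.fun_sum (u := Finset.univ) fun (j : Fin n) _ ↦ HasDerivAt.const_mul ((A y)⁻¹ i j)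
      (((d2 i j).fun_sub (HasDerivAt.fun_sum (u := Finset.univ) fun (l : Fin n) _ ↦
        (d1 l k).const_mul (metricChristoffel A l i j y))).fun_add
        (HasDerivAt.fun_sum (u := Finset.univ) fun (a : Fin n) _ ↦
          HasDerivAt.fun_sum (u := Finset.univ) fun (b : Fin n) _ ↦
            ((d3 a b).fun_mul (d1 i a)).fun_mul (d1 j b)))
  refine key.congr_deriv ?_
  refine Finset.sum_congr rfl fun i _ ↦ Finset.sum_congr rfl fun j _ ↦ ?_
  rw [lieConnection]
  congr 1
  -- At t = 0 the Jacobian is the identity, so the product rule on the quadratic term leaves the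
  -- three Γ terms of `lieConnection`: one from moving the argument of Γ and one from each Jacobian
  -- factor.
  simp only [h0, hδ, Finset.sum_add_distrib, mul_ite, ite_mul, mul_one, mul_zero, zero_mul,
    Finset.sum_ite_eq', Finset.mem_univ, if_true, Finset.sum_ite_irrel,
    Finset.sum_const_zero]
  ring

end TensionDerivative

/-! ### Infinitesimal harmonic transformations and the trace of L_ξ ∇ -/

section InfinitesimalHarmonic

variable {n : ℕ} {M : Type*} [TopologicalSpace M] [ChartedSpace (Rn n) M] [IsManifold (𝓡 n) ∞ M]
  (g : RiemMetric n M) {ξ : ∀ x : M, TangentSpace (𝓡 n) x} {p : M}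

/-- The derivative depends on the family only through its initial velocity ξ, which makes the
quantifier over all families in `IsInfinitesimalHarmonic` harmless. -/
theorem hasDerivAt_coordTension {Φ : ℝ → M → M}
    (hΦ : ContMDiffAt (𝓘(ℝ, ℝ).prod (𝓡 n)) (𝓡 n) ∞ (fun q : ℝ × M ↦ Φ q.1 q.2) (0, p))
    (hev : ∀ᶠ x in 𝓝 p, Φ 0 x = x ∧
      HasMFDerivAt 𝓘(ℝ, ℝ) (𝓡 n) (fun t ↦ Φ t x) 0
        ((1 : ℝ →L[ℝ] ℝ).smulRight (ξ (Φ 0 x)))) (k : Fin n) :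
    HasDerivAt (fun t ↦ coordTension g p (Φ t) k)
      (lieTension (coordMetric g p) (coordField ξ p) k (extChartAt (𝓡 n) p p)) 0 := by
  set e := extChartAt (𝓡 n) p
  have ht : e p ∈ e.target := mem_extChartAt_target p
  have hep : e.symm (e p) = p := e.left_inv (mem_extChartAt_source p)
  have hΦp : Φ 0 p = p := hev.self_of_nhds.1
  have hcont : ContinuousAt e.symm (e p) := (contMDiffAt_chart_symm ht).continuousAt
  have hev' : ∀ᶠ z in 𝓝 (e p), z ∈ e.target ∧ (Φ 0 (e.symm z) = e.symm z ∧
      HasMFDerivAt 𝓘(ℝ, ℝ) (𝓡 n) (fun t ↦ Φ t (e.symm z)) 0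
        ((1 : ℝ →L[ℝ] ℝ).smulRight (ξ (Φ 0 (e.symm z))))) :=
    Eventually.and ((isOpen_extChartAt_target p).mem_nhds ht)
      (hcont.eventually (by rwa [hep]))
  have hu : ContDiffAt ℝ ∞ (fun q : ℝ × Rn n ↦ e (Φ q.1 (e.symm q.2))) (0, e p) := by
    have h1 : ContMDiffAt 𝓘(ℝ, ℝ × Rn n) (𝓘(ℝ, ℝ).prod (𝓡 n)) ∞
        (fun q : ℝ × Rn n ↦ (q.1, e.symm q.2)) (0, e p) :=
      contDiff_fst.contMDiff.contMDiffAt.prodMk ((contMDiffAt_chart_symm ht).comp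
        ((0 : ℝ), e p) contDiff_snd.contMDiff.contMDiffAt)
    have h2 : ContMDiffAt 𝓘(ℝ, ℝ × Rn n) (𝓡 n) ∞
        (fun q : ℝ × Rn n ↦ Φ q.1 (e.symm q.2)) (0, e p) :=
      ContMDiffAt.comp (g := fun q : ℝ × M ↦ Φ q.1 q.2) ((0 : ℝ), e p) (by simpa [hep] using hΦ) h1
    have h3 : Φ 0 (e.symm (e p)) ∈ e.source := by
      rw [hep, hΦp]; exact mem_extChartAt_source p
    exact ((contMDiffAt_chart h3).comp ((0 : ℝ), e p) h2).contDiffAt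
  refine (isMetricAt_coordMetric g ht).hasDerivAt_tension
    (u := fun t z ↦ e (Φ t (e.symm z)))
    (X := fun z ↦ chartDeriv p (e.symm z) (ξ (e.symm z))) hu ?_ ?_ k
  · filter_upwards [hev'] with z hz
    rw [hz.2.1, e.right_inv hz.1]
  · filter_upwards [hev'] with z hz
    have hs : Φ 0 (e.symm z) ∈ e.source := by rw [hz.2.1]; exact e.map_target hz.1
    have h1 := ((contMDiffAt_chart hs).mdifferentiableAt (by simp)).hasMFDerivAt.comp
      (f := fun t ↦ Φ t (e.symm z)) (0 : ℝ) hz.2.2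
    have h2 : HasFDerivAt (fun t ↦ e (Φ t (e.symm z))) (chartDeriv p (Φ 0 (e.symm z))
        ∘L (1 : ℝ →L[ℝ] ℝ).smulRight ((ξ : M → Rn n) (Φ 0 (e.symm z)))) 0 := h1.hasFDerivAt
    refine h2.hasDerivAt.congr_deriv ?_
    have h3 : chartDeriv p (Φ 0 (e.symm z)) ((1 : ℝ) • ξ (Φ 0 (e.symm z)))
        = chartDeriv p (e.symm z) (ξ (e.symm z)) := by
      rw [one_smul]
      exact congrArg (fun x ↦ chartDeriv p x ((ξ : M → Rn n) x)) hz.2.1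
    exact h3

/-- A local family of transformations generated by a smooth vector field. -/
theorem exists_generated_family
    (hξ : ∀ y ∈ (extChartAt (𝓡 n) p).target, ∀ k, ContDiffAt ℝ ∞ (fun z ↦ coordField ξ p z k) y) :
    ∃ Φ : ℝ → M → M,
      ContMDiffAt (𝓘(ℝ, ℝ).prod (𝓡 n)) (𝓡 n) ∞ (fun q : ℝ × M ↦ Φ q.1 q.2) (0, p) ∧
      ∀ᶠ x in 𝓝 p, Φ 0 x = x ∧ HasMFDerivAt 𝓘(ℝ, ℝ) (𝓡 n) (fun t ↦ Φ t x) 0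
        ((1 : ℝ →L[ℝ] ℝ).smulRight (ξ (Φ 0 x))) := by
  set e := extChartAt (𝓡 n) p
  have hp : p ∈ e.source := mem_extChartAt_source p
  have ht : e p ∈ e.target := mem_extChartAt_target p
  let X : Rn n → Rn n := fun z ↦ WithLp.toLp 2 (coordField ξ p z)
  have hXs : ContDiffAt ℝ ∞ X (e p) := contDiffAt_euclidean.2 fun k ↦ hξ _ ht k
  have hX : ∀ x ∈ e.source, X (e x) = chartDeriv p x (ξ x) := fun x hx ↦ by
    ext k
    exact congrArg (fun x ↦ chartDeriv p x ((ξ : M → Rn n) x) k) (e.left_inv hx)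
  have h0 : ∀ x ∈ e.source, e.symm (e x + (0 : ℝ) • X (e x)) = x := fun x hx ↦ by
    rw [zero_smul, add_zero, e.left_inv hx]
  -- Only the first order in t matters, so straight motion in the chart replaces the flow of ξ.
  refine ⟨fun t x ↦ e.symm (e x + t • X (e x)), ?_, ?_⟩
  · have h1 : ContMDiffAt (𝓘(ℝ, ℝ).prod (𝓡 n)) 𝓘(ℝ, ℝ × Rn n) ∞
        (fun q : ℝ × M ↦ (q.1, e q.2)) (0, p) :=
      contMDiffAt_fst.prodMk_space ((contMDiffAt_chart hp).comp (0, p) contMDiffAt_snd)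
    have h2 : ContDiffAt ℝ ∞ (fun q : ℝ × Rn n ↦ q.2 + q.1 • X q.2) ((0 : ℝ), e p) :=
      contDiffAt_snd.add (contDiffAt_fst.smul (ContDiffAt.comp (g := X) ((0 : ℝ), e p) hXs
        contDiffAt_snd))
    have h3 : e p + (0 : ℝ) • X (e p) ∈ e.target := by rwa [zero_smul, add_zero]
    exact (contMDiffAt_chart_symm h3).comp ((0 : ℝ), p)
      (ContMDiffAt.comp (g := fun q : ℝ × Rn n ↦ q.2 + q.1 • X q.2) ((0 : ℝ), p)
        h2.contMDiffAt h1)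
  · filter_upwards [(isOpen_extChartAt_source p).mem_nhds hp] with x hx
    refine ⟨h0 x hx, ?_⟩
    have h1 : HasDerivAt (fun t : ℝ ↦ e x + t • X (e x)) ((1 : ℝ) • X (e x)) 0 :=
      ((hasDerivAt_id (0 : ℝ)).smul_const (X (e x))).const_add (e x)
    have h3 : e x + (0 : ℝ) • X (e x) ∈ e.target := by
      rw [zero_smul, add_zero]; exact e.map_source hx
    have h2 := ((contMDiffAt_chart_symm h3).mdifferentiableAt (by simp)).hasMFDerivAt.comp
      (f := fun t : ℝ ↦ e x + t • X (e x)) (0 : ℝ) h1.hasFDerivAt.hasMFDerivAt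
    have h4 : (symmDeriv p (e x + (0 : ℝ) • X (e x)))
        ∘L (ContinuousLinearMap.toSpanSingleton ℝ ((1 : ℝ) • X (e x)))
        = (1 : ℝ →L[ℝ] ℝ).smulRight ((ξ : M → Rn n) (e.symm (e x + (0 : ℝ) • X (e x)))) := by
      have h5 : (ξ : M → Rn n) (e.symm (e x + (0 : ℝ) • X (e x))) = ξ x :=
        congrArg (ξ : M → Rn n) (h0 x hx)
      rw [h5, zero_smul, add_zero, one_smul, hX x hx]
      refine ContinuousLinearMap.ext_ring ?_
      have h6 := symmDeriv_chartDeriv_of_mem hx (ξ x)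
      rw [ContinuousLinearMap.comp_apply, ContinuousLinearMap.toSpanSingleton_apply_one, h6]
      exact (one_smul ℝ (ξ x : Rn n)).symm
    exact h4 ▸ h2

/-- The forward direction needs at least one generated family near each point, since otherwise the
defining condition would be vacuous; uniqueness of derivatives then gives the value. -/
theorem isInfinitesimalHarmonic_iff
    (hξ : ∀ p : M, ∀ y ∈ (extChartAt (𝓡 n) p).target, ∀ k,
      ContDiffAt ℝ ∞ (fun z ↦ coordField ξ p z k) y) :
    IsInfinitesimalHarmonic g ξ ↔ ∀ p k,
      lieTension (coordMetric g p) (coordField ξ p) k (extChartAt (𝓡 n) p p) = 0 := by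
  refine ⟨fun h p k ↦ ?_, fun h p Φ hΦ hev k ↦ ?_⟩
  · obtain ⟨Φ, hΦ, hev⟩ := exists_generated_family (hξ p)
    exact (hasDerivAt_coordTension g hΦ hev k).unique (h p Φ hΦ hev k)
  · exact (hasDerivAt_coordTension g hΦ hev k).congr_deriv (h p k)

end InfinitesimalHarmonic

/-! ### Integration by parts on the manifold and the divergence theorem -/

section DivergenceTheorem

variable {n : ℕ} {M : Type*} [TopologicalSpace M] [ChartedSpace (Rn n) M] [IsManifold (𝓡 n) ∞ M]
  (g : RiemMetric n M) {p : M} {y : Rn n}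

theorem contDiffAt_comp_symm {u : M → ℝ} (hu : ContMDiff (𝓡 n) 𝓘(ℝ, ℝ) ∞ u)
    (hy : y ∈ (extChartAt (𝓡 n) p).target) :
    ContDiffAt ℝ ∞ (fun z ↦ u ((extChartAt (𝓡 n) p).symm z)) y :=
  (hu.contMDiffAt.comp y (contMDiffAt_chart_symm hy)).contDiffAt

/-- The differential of a function in the chart at `p`. -/
theorem differential_symm {u : M → ℝ}
    (hu : MDifferentiableAt (𝓡 n) 𝓘(ℝ, ℝ) u ((extChartAt (𝓡 n) p).symm y))
    (hy : y ∈ (extChartAt (𝓡 n) p).target)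
    (w : TangentSpace (𝓡 n) ((extChartAt (𝓡 n) p).symm y)) :
    differential u ((extChartAt (𝓡 n) p).symm y) w
      = ∑ k, chartDeriv p ((extChartAt (𝓡 n) p).symm y) w k
        * pd k (fun z ↦ u ((extChartAt (𝓡 n) p).symm z)) y := by
  let L : Rn n →L[ℝ] ℝ := mfderiv (𝓡 n) 𝓘(ℝ, ℝ) u ((extChartAt (𝓡 n) p).symm y)
  have h1 : HasMFDerivAt (𝓡 n) 𝓘(ℝ, ℝ) (u ∘ (extChartAt (𝓡 n) p).symm) y (L ∘L symmDeriv p y) :=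
    hu.hasMFDerivAt.comp y
      ((contMDiffAt_chart_symm hy).mdifferentiableAt (by simp)).hasMFDerivAt
  have h2 : HasFDerivAt (fun z ↦ u ((extChartAt (𝓡 n) p).symm z)) (L ∘L symmDeriv p y) y :=
    h1.hasFDerivAt
  have h3 : ∀ v : Rn n, L v = ∑ k, chartDeriv p ((extChartAt (𝓡 n) p).symm y) v k
      * pd k (fun z ↦ u ((extChartAt (𝓡 n) p).symm z)) y := fun v ↦ by
    rw [← fderiv_eq_sum_pd, h2.fderiv, ContinuousLinearMap.comp_apply, symmDeriv_chartDeriv hy]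
  exact h3 w

theorem differential_eq {u : M → ℝ} {x : M} (hu : MDifferentiableAt (𝓡 n) 𝓘(ℝ, ℝ) u x)
    (w : TangentSpace (𝓡 n) x) :
    differential u x w = ∑ k, vecComp x w k
      * pd k (fun z ↦ u ((extChartAt (𝓡 n) x).symm z)) (extChartAt (𝓡 n) x x) := by
  -- The chart is first made independent of x, so that x can be replaced by a point `(extChartAt (𝓡
  -- n) p).symm y` without changing the chart.
  have key : ∀ p : M, x ∈ (extChartAt (𝓡 n) p).source → differential u x w
      = ∑ k, chartDeriv p x w k
        * pd k (fun z ↦ u ((extChartAt (𝓡 n) p).symm z)) (extChartAt (𝓡 n) p x) := by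
    intro p hx
    obtain ⟨y, hy, rfl⟩ : ∃ y ∈ (extChartAt (𝓡 n) p).target, (extChartAt (𝓡 n) p).symm y = x :=
      ⟨_, (extChartAt (𝓡 n) p).map_source hx, (extChartAt (𝓡 n) p).left_inv hx⟩
    rw [differential_symm hu hy, (extChartAt (𝓡 n) p).right_inv hy]
  exact key x (mem_extChartAt_source x)

theorem continuousOn_differential_sharp_symm (θ : OneForm n M) {u : M → ℝ}
    (hu : ContMDiff (𝓡 n) 𝓘(ℝ, ℝ) ∞ u) (p : M) :
    ContinuousOn (fun y ↦ differential u ((extChartAt (𝓡 n) p).symm y)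
      (sharp g θ ((extChartAt (𝓡 n) p).symm y))) (extChartAt (𝓡 n) p).target := by
  refine ContinuousOn.congr (fun y hy ↦ ?_)
    fun y hy ↦ differential_symm (hu.mdifferentiableAt (by simp)) hy _
  have h : ContDiffAt ℝ ∞ (fun y ↦ ∑ k, coordField (sharp g θ) p y k
      * pd k (fun z ↦ u ((extChartAt (𝓡 n) p).symm z)) y) y :=
    ContDiffAt.sum fun k _ ↦ (contDiffAt_coordField_sharp g θ hy k).mul
      ((contDiffAt_comp_symm hu hy).pd (by simp) k)
  exact h.continuousAt.continuousWithinAt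

theorem divForm_symm (θ : OneForm n M) (hy : y ∈ (extChartAt (𝓡 n) p).target) :
    divForm g (fun x v ↦ θ x v) ((extChartAt (𝓡 n) p).symm y)
      = -(1 / 2) * ∑ i, ∑ j, (coordMetric g p y)⁻¹ i j
        * lieMatrix (coordMetric g p) (coordField (sharp g θ) p) y i j := by
  rw [divForm_eq, metricTrace_eq g hy (isBilinAt_lieMetric g _ _),
    coordTensor_lieMetric_sharp g θ hy]

theorem contDiffAt_lieMatrix (θ : OneForm n M) (hy : y ∈ (extChartAt (𝓡 n) p).target)
    (i j : Fin n) : ContDiffAt ℝ ∞ (fun z ↦ lieMatrix (coordMetric g p)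
      (coordField (sharp g θ) p) z i j) y := by
  have hA := isMetricAt_coordMetric g hy
  have hX := contDiffAt_coordField_sharp g θ hy
  have h : ContDiffAt ℝ ∞ (fun z ↦ ∑ k, (coordField (sharp g θ) p z k
      * pd k (fun z ↦ coordMetric g p z i j) z
      + coordMetric g p z k j * pd i (fun z ↦ coordField (sharp g θ) p z k) z
      + coordMetric g p z i k * pd j (fun z ↦ coordField (sharp g θ) p z k) z)) y :=
    ContDiffAt.sum fun k _ ↦ (((hX k).mul ((hA.smooth i j).pd (by simp) k)).add
      ((hA.smooth k j).mul ((hX k).pd (by simp) i))).add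
      ((hA.smooth i k).mul ((hX k).pd (by simp) j))
  exact h

theorem contDiffAt_divForm_symm (θ : OneForm n M) (hy : y ∈ (extChartAt (𝓡 n) p).target) :
    ContDiffAt ℝ ∞ (fun y ↦ divForm g (fun x v ↦ θ x v) ((extChartAt (𝓡 n) p).symm y)) y := by
  have h : ContDiffAt ℝ ∞ (fun y ↦ -(1 / 2) * ∑ i, ∑ j, (coordMetric g p y)⁻¹ i j
      * lieMatrix (coordMetric g p) (coordField (sharp g θ) p) y i j) y :=
    contDiffAt_const.mul (ContDiffAt.sum fun i _ ↦ ContDiffAt.sum fun j _ ↦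
      ((isMetricAt_coordMetric g hy).smooth_inv i j).mul (contDiffAt_lieMatrix g θ hy i j))
  refine h.congr_of_eventuallyEq ?_
  filter_upwards [(isOpen_extChartAt_target p).mem_nhds hy] with z hz
  exact divForm_symm g θ hz

theorem continuousOn_divForm_symm (θ : OneForm n M) (p : M) :
    ContinuousOn (fun y ↦ divForm g (fun x v ↦ θ x v) ((extChartAt (𝓡 n) p).symm y))
      (extChartAt (𝓡 n) p).target := fun _ hy ↦
  (contDiffAt_divForm_symm g θ hy).continuousAt.continuousWithinAt

/-- With the weight √g, the codifferential is minus a flat divergence, so the integration by parts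
takes place in `Rn n`. -/
theorem sqrt_det_mul_divForm_symm (θ : OneForm n M) (hy : y ∈ (extChartAt (𝓡 n) p).target) :
    √(coordMetric g p y).det * divForm g (fun x v ↦ θ x v) ((extChartAt (𝓡 n) p).symm y)
      = -∑ k, pd k (fun z ↦ √(coordMetric g p z).det * coordField (sharp g θ) p z k) y := by
  have h := trace_lieMatrix (isMetricAt_coordMetric g hy)
    fun k ↦ (contDiffAt_coordField_sharp g θ hy k).differentiableAt (by simp)
  rw [divForm_symm g θ hy]
  linarith

variable [T2Space M] [CompactSpace M]

/-- A smooth function supported in a chart domain, in coordinates. -/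
theorem exists_coordinate_expression {ρ : M → ℝ} (hρ : ContMDiff (𝓡 n) 𝓘(ℝ, ℝ) ∞ ρ)
    (hs : tsupport ρ ⊆ (extChartAt (𝓡 n) p).source) :
    ∃ η : Rn n → ℝ, ContDiff ℝ ∞ η ∧ HasCompactSupport η ∧
      tsupport η ⊆ (extChartAt (𝓡 n) p).target ∧
      ∀ y ∈ (extChartAt (𝓡 n) p).target, η y = ρ ((extChartAt (𝓡 n) p).symm y) := by
  classical
  set e := extChartAt (𝓡 n) p
  have hK : IsCompact (e '' tsupport ρ) :=
    (isClosed_tsupport ρ).isCompact.image_of_continuousOn ((continuousOn_extChartAt p).mono hs)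
  have hKT : e '' tsupport ρ ⊆ e.target := by
    rintro _ ⟨x, hx, rfl⟩
    exact e.map_source (hs hx)
  let η : Rn n → ℝ := fun y ↦ if y ∈ e.target then ρ (e.symm y) else 0
  have hηK : ∀ y, y ∉ e '' tsupport ρ → η y = 0 := fun y hy ↦ by
    by_cases hyt : y ∈ e.target
    · rw [show η y = ρ (e.symm y) from if_pos hyt]
      by_contra h
      exact hy ⟨_, subset_tsupport ρ h, e.right_inv hyt⟩
    · exact if_neg hyt
  have hsupp : tsupport η ⊆ e '' tsupport ρ :=
    closure_minimal (fun y hy ↦ by_contra fun h ↦ hy (hηK y h)) hK.isClosed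
  refine ⟨η, contDiff_iff_contDiffAt.2 fun y ↦ ?_,
    HasCompactSupport.intro hK hηK, hsupp.trans hKT, fun y hy ↦ if_pos hy⟩
  by_cases hyt : y ∈ e.target
  · refine (contDiffAt_comp_symm hρ hyt).congr_of_eventuallyEq ?_
    filter_upwards [(isOpen_extChartAt_target p).mem_nhds hyt] with z hz
    exact if_pos hz
  · refine (contDiffAt_const (c := (0 : ℝ))).congr_of_eventuallyEq ?_
    filter_upwards [hK.isClosed.isOpen_compl.mem_nhds fun h ↦ hyt (hKT h)] with z hz
    exact hηK z hz

variable [MeasurableSpace M] [BorelSpace M]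

theorem integral_riemVol_of_support_subset {F : M → ℝ}
    (hs : Function.support F ⊆ (extChartAt (𝓡 n) p).source)
    (hF : ContinuousOn (fun y ↦ F ((extChartAt (𝓡 n) p).symm y)) (extChartAt (𝓡 n) p).target) :
    ∫ x, F x ∂(riemVol g) = ∫ y in (extChartAt (𝓡 n) p).target,
      √(coordMetric g p y).det * F ((extChartAt (𝓡 n) p).symm y) := by
  rw [← setIntegral_eq_integral_of_forall_compl_eq_zero (s := (extChartAt (𝓡 n) p).source)
    fun x hx ↦ by_contra fun h ↦ hx (hs h), setIntegral_riemVol g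
    (isOpen_extChartAt_source p).measurableSet subset_rfl hF,
    inter_eq_right.2 (extChartAt (𝓡 n) p).target_subset_preimage_source]

/-- Integration by parts against a function supported in a chart domain. -/
theorem integral_mul_divForm (θ : OneForm n M) {ρ : M → ℝ} (hρ : ContMDiff (𝓡 n) 𝓘(ℝ, ℝ) ∞ ρ)
    (hs : tsupport ρ ⊆ (extChartAt (𝓡 n) p).source) :
    ∫ x, ρ x * divForm g (fun x v ↦ θ x v) x ∂(riemVol g)
      = ∫ x, differential ρ x (sharp g θ x) ∂(riemVol g) := by
  set T := (extChartAt (𝓡 n) p).target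
  have hT : IsOpen T := isOpen_extChartAt_target p
  obtain ⟨η, hη, hc, hsη, hηρ⟩ := exists_coordinate_expression hρ hs
  set V : Fin n → Rn n → ℝ := fun k z ↦ √(coordMetric g p z).det * coordField (sharp g θ) p z k
  have hV : ∀ k, ∀ y ∈ T, ContDiffAt ℝ ∞ (V k) y := fun k y hy ↦
    (isMetricAt_coordMetric g hy).contDiffAt_sqrt_det.mul (contDiffAt_coordField_sharp g θ hy k)
  have hη0 : ∀ y, y ∉ T → η y = 0 := fun y hy ↦
    image_eq_zero_of_notMem_tsupport fun h ↦ hy (hsη h)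
  have hpd0 : ∀ k y, y ∉ T → pd k η y = 0 := fun k y hy ↦
    image_eq_zero_of_notMem_tsupport fun h ↦ hy (hsη (tsupport_pd_subset k η h))
  have hρc : ContinuousOn (fun y ↦ ρ ((extChartAt (𝓡 n) p).symm y)) T := fun y hy ↦
    (contDiffAt_comp_symm hρ hy).continuousAt.continuousWithinAt
  have hsupp1 : Function.support (fun x ↦ ρ x * divForm g (fun x v ↦ θ x v) x)
      ⊆ (extChartAt (𝓡 n) p).source :=
    (Function.support_mul_subset_left _ _).trans ((subset_tsupport ρ).trans hs)
  have hsupp2 : Function.support (fun x ↦ differential ρ x (sharp g θ x))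
      ⊆ (extChartAt (𝓡 n) p).source := fun x hx ↦ hs <| by
    by_contra hxs
    refine hx ?_
    have h0 : HasMFDerivAt (𝓡 n) 𝓘(ℝ, ℝ) ρ x (0 : Rn n →L[ℝ] ℝ) :=
      (hasMFDerivAt_const (0 : ℝ) x).congr_of_eventuallyEq
        (notMem_tsupport_iff_eventuallyEq.1 hxs)
    exact congrArg (fun L : Rn n →L[ℝ] ℝ ↦ L (sharp g θ x)) h0.mfderiv
  rw [integral_riemVol_of_support_subset g hsupp1 (hρc.mul (continuousOn_divForm_symm g θ p)),
    integral_riemVol_of_support_subset g hsupp2 (continuousOn_differential_sharp_symm g θ hρ p)]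
  have e1 : ∀ y ∈ T, √(coordMetric g p y).det * (ρ ((extChartAt (𝓡 n) p).symm y)
      * divForm g (fun x v ↦ θ x v) ((extChartAt (𝓡 n) p).symm y))
      = -∑ k, pd k (V k) y * η y := fun y hy ↦ by
    have := sqrt_det_mul_divForm_symm g θ hy
    rw [← hηρ y hy, mul_left_comm, this, ← Finset.sum_mul]
    ring
  have e2 : ∀ y ∈ T, √(coordMetric g p y).det * differential ρ ((extChartAt (𝓡 n) p).symm y)
      (sharp g θ ((extChartAt (𝓡 n) p).symm y)) = ∑ k, V k y * pd k η y := fun y hy ↦ by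
    have hev : η =ᶠ[𝓝 y] fun z ↦ ρ ((extChartAt (𝓡 n) p).symm z) := by
      filter_upwards [hT.mem_nhds hy] with z hz using hηρ z hz
    rw [differential_symm (hρ.mdifferentiableAt (by simp)) hy, Finset.mul_sum]
    refine Finset.sum_congr rfl fun k _ ↦ ?_
    rw [pd_congr hev, ← mul_assoc]
    rfl
  have i1 : ∀ k, Integrable fun y ↦ pd k (V k) y * η y := fun k ↦
    integrable_mul_of_tsupport_subset hT (fun y hy ↦
      ((hV k y hy).pd (k := ∞) (by simp) k).continuousAt.continuousWithinAt) hη.continuous hc hsη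
  have i2 : ∀ k, Integrable fun y ↦ V k y * pd k η y := fun k ↦
    integrable_mul_of_tsupport_subset hT (fun y hy ↦
      (hV k y hy).continuousAt.continuousWithinAt) (contDiff_pd hη k).continuous
      (hc.mono' (subset_closure.trans (tsupport_pd_subset k η)))
      ((tsupport_pd_subset k η).trans hsη)
  rw [setIntegral_congr_fun hT.measurableSet e1, setIntegral_congr_fun hT.measurableSet e2,
    setIntegral_eq_integral_of_forall_compl_eq_zero fun y hy ↦ by simp [hη0 y hy],
    setIntegral_eq_integral_of_forall_compl_eq_zero fun y hy ↦ by simp [hpd0 _ y hy],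
    integral_neg, integral_finsetSum _ fun k _ ↦ i1 k, integral_finsetSum _ fun k _ ↦ i2 k,
    ← Finset.sum_neg_distrib]
  exact Finset.sum_congr rfl fun k _ ↦ (integral_mul_pd_eq_neg hT (hV k) hη hc hsη k).symm

theorem integrable_riemVol_of_continuous {F : M → ℝ} (hF : Continuous F) :
    Integrable F (riemVol g) :=
  have := isLocallyFiniteMeasure_riemVol g
  hF.integrable_of_hasCompactSupport (HasCompactSupport.of_compactSpace F)

/-- The divergence theorem on a closed manifold. -/
theorem integral_divForm (θ : OneForm n M) :
    ∫ x, divForm g (fun x v ↦ θ x v) x ∂(riemVol g) = 0 := by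
  obtain ⟨S, -, hS⟩ := isCompact_univ.elim_nhds_subcover
    (fun p : M ↦ (extChartAt (𝓡 n) p).source) fun p _ ↦ extChartAt_source_mem_nhds p
  obtain ⟨ρ, hρ⟩ := SmoothPartitionOfUnity.exists_isSubordinate (𝓡 n) (isClosed_univ (X := M))
    (fun p : S ↦ (extChartAt (𝓡 n) (p : M)).source) (fun p ↦ isOpen_extChartAt_source _)
    (by simpa [iUnion_subtype] using hS)
  have hsum : ∀ x, ∑ p, ρ p x = 1 := fun x ↦ by
    rw [← finsum_eq_sum_of_fintype]; exact ρ.sum_eq_one (mem_univ x)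
  have hρs : ∀ p, ContMDiff (𝓡 n) 𝓘(ℝ, ℝ) ∞ (ρ p) := fun p ↦ (ρ p).contMDiff
  have hD : Continuous (divForm g fun x v ↦ θ x v) :=
    continuous_of_symm fun p ↦ continuousOn_divForm_symm g θ p
  -- The partition functions add up to 1, so their differentials add up to 0. After integration by
  -- parts only these differentials remain.
  have hd0 : ∀ x, ∑ p, differential (ρ p) x (sharp g θ x) = 0 := fun x ↦ by
    simp only [differential_eq ((hρs _).mdifferentiableAt (by simp))]
    rw [Finset.sum_comm]
    refine Finset.sum_eq_zero fun k _ ↦ ?_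
    rw [← Finset.mul_sum, ← pd_sum k fun p ↦ (contDiffAt_comp_symm (hρs p)
      (mem_extChartAt_target x)).differentiableAt (by simp)]
    simp only [hsum, pd_const, mul_zero]
  have hpt : ∀ x, divForm g (fun x v ↦ θ x v) x
      = ∑ p, ρ p x * divForm g (fun x v ↦ θ x v) x := fun x ↦ by
    rw [← Finset.sum_mul, hsum, one_mul]
  rw [integral_congr_ae (Eventually.of_forall hpt), integral_finsetSum _ fun p _ ↦
    integrable_riemVol_of_continuous g ((hρs p).continuous.fun_mul hD)]
  simp only [integral_mul_divForm g θ (hρs _) (hρ _)]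
  rw [← integral_finsetSum _ fun p _ ↦ integrable_riemVol_of_continuous g
    (continuous_of_symm fun q ↦ continuousOn_differential_sharp_symm g θ (hρs p) q)]
  simp only [hd0, integral_zero]

end DivergenceTheorem

/-! ### The York decomposition: stress divergence, trace and energy -/

section York

variable {n m : ℕ} {M N : Type*}
  [TopologicalSpace M] [ChartedSpace (Rn n) M] [IsManifold (𝓡 n) ∞ M]
  [TopologicalSpace N] [ChartedSpace (Rn m) N] [IsManifold (𝓡 m) ∞ N]
  (g : RiemMetric n M)

/-- Allows identities stated for all tangent vectors to be read off component by component. -/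
theorem exists_vecComp_eq_single (x : M) (k : Fin n) :
    ∃ w : TangentSpace (𝓡 n) x, ∀ l, vecComp x w l = if l = k then 1 else 0 := by
  have h := chartDeriv_symmDeriv (mem_extChartAt_target x)
    (EuclideanSpace.single k (1 : ℝ) : Rn n)
  rw [(extChartAt (𝓡 n) x).left_inv (mem_extChartAt_source x)] at h
  refine ⟨symmDeriv x (extChartAt (𝓡 n) x x) (EuclideanSpace.single k (1 : ℝ) : Rn n), fun l ↦ ?_⟩
  refine (congrArg (fun v : Rn n ↦ v l) h).trans ?_
  simp

/-- The divergence of a symmetric two-tensor in terms of the divergence of its stress tensor and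
the differential of its trace. -/
theorem divTensor_eq {h : ∀ x : M, TangentSpace (𝓡 n) x → TangentSpace (𝓡 n) x → ℝ} {x : M}
    (hb : ∀ x, IsBilinAt h x)
    (hd : ∀ i j, DifferentiableAt ℝ (fun z ↦ coordTensor h x z i j) (extChartAt (𝓡 n) x x))
    (hs : (coordTensor h x (extChartAt (𝓡 n) x x)).IsSymm) (w : TangentSpace (𝓡 n) x) :
    divTensor g h x w = -∑ k, (stressDiv (coordMetric g x) (coordTensor h x) k
        (extChartAt (𝓡 n) x x)
      + (1 / 2) * pd k (fun z ↦ metricTrace g h ((extChartAt (𝓡 n) x).symm z))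
        (extChartAt (𝓡 n) x x)) * vecComp x w k := by
  have ht : extChartAt (𝓡 n) x x ∈ (extChartAt (𝓡 n) x).target := mem_extChartAt_target x
  have htr : ∀ k, pd k (fun z ↦ metricTrace g h ((extChartAt (𝓡 n) x).symm z))
      (extChartAt (𝓡 n) x x) = pd k (fun z ↦ ∑ i, ∑ j, (coordMetric g x z)⁻¹ i j
        * coordTensor h x z i j) (extChartAt (𝓡 n) x x) := fun k ↦ pd_congr <| by
    filter_upwards [(isOpen_extChartAt_target x).mem_nhds ht] with z hz
    exact metricTrace_eq g hz (hb _)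
  simp only [htr, ← (isMetricAt_coordMetric g ht).divergence_eq hd hs]
  rfl

/-- S(φ) is div φ - ½ d(trace φ), and both terms vanish for a TT-tensor. -/
theorem IsTT.stressDiv_eq_zero {g : RiemMetric n M} {φ : TwoTensor n M} (hφ : IsTT g φ) (x : M)
    (k : Fin n) : stressDiv (coordMetric g x) (coordTensor (fun x v w ↦ φ x v w) x) k
      (extChartAt (𝓡 n) x x) = 0 := by
  obtain ⟨w, hw⟩ := exists_vecComp_eq_single x k
  have h := hφ.div x w
  rw [divTensor_eq g (isBilinAt_clm fun x ↦ φ x) (fun i j ↦ (contDiffAt_coordTensor φ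
    (mem_extChartAt_target x) i j).differentiableAt (by simp))
    (by ext i j; exact hφ.symm _ _ _)] at h
  simpa [hw, hφ.trace, pd_const] using h

variable (θ : OneForm n M)

theorem coordTensor_deltaStar {p : M} {y : Rn n} (hy : y ∈ (extChartAt (𝓡 n) p).target) :
    coordTensor (deltaStar g θ) p y
      = (1 / 2 : ℝ) • lieMatrix (coordMetric g p) (coordField (sharp g θ) p) y := by
  rw [← coordTensor_lieMetric_sharp g θ hy]
  rfl

theorem isBilinAt_deltaStar (x : M) : IsBilinAt (deltaStar g θ) x := by
  obtain ⟨B, hB⟩ := isBilinAt_lieMetric g (sharp g θ) x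
  refine ⟨(1 / 2 : ℝ) • B, fun v w ↦ ?_⟩
  exact congrArg (fun c : ℝ ↦ 1 / 2 * c) (hB v w)

theorem metricTrace_deltaStar (x : M) :
    metricTrace g (deltaStar g θ) x = -divForm g (fun x v ↦ θ x v) x := by
  rw [divForm_eq, metricTrace, metricTrace, neg_mul, neg_neg, Finset.mul_sum]
  refine Finset.sum_congr rfl fun i _ ↦ ?_
  rw [Finset.mul_sum]
  exact Finset.sum_congr rfl fun j _ ↦ mul_left_comm _ _ _

theorem mdifferentiableAt_divForm (x : M) :
    MDifferentiableAt (𝓡 n) 𝓘(ℝ, ℝ) (divForm g fun x v ↦ θ x v) x := by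
  have h1 : ContMDiffAt (𝓡 n) 𝓘(ℝ, ℝ) ∞ (fun x' ↦ divForm g (fun x v ↦ θ x v)
      ((extChartAt (𝓡 n) x).symm (extChartAt (𝓡 n) x x'))) x :=
    ContMDiffAt.comp (g := fun y ↦ divForm g (fun x v ↦ θ x v) ((extChartAt (𝓡 n) x).symm y)) x
      (contDiffAt_divForm_symm g θ (mem_extChartAt_target x)).contMDiffAt
      (contMDiffAt_chart (mem_extChartAt_source x))
  refine (h1.congr_of_eventuallyEq ?_).mdifferentiableAt (by simp)
  filter_upwards [(isOpen_extChartAt_source (I := 𝓡 n) x).mem_nhds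
    (mem_extChartAt_source x)] with x' hx'
  exact congrArg _ ((extChartAt (𝓡 n) x).left_inv hx').symm

theorem isSymm_lieMatrix {A : Rn n → Matrix (Fin n) (Fin n) ℝ} (hA : ∀ y, (A y).IsSymm)
    (X : Rn n → Fin n → ℝ) (y : Rn n) : (lieMatrix A X y).IsSymm := by
  ext i j
  have h : (fun z ↦ A z i j) = fun z ↦ A z j i := funext fun z ↦ (hA z).apply j i
  simp only [lieMatrix, Matrix.transpose_apply, Matrix.of_apply, h]
  refine Finset.sum_congr rfl fun k _ ↦ ?_
  rw [(hA y).apply k j, (hA y).apply k i]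
  ring

/-- The Sampson Laplacian is minus the divergence of the stress tensor of `L_ξ g`. -/
theorem sampsonLaplacian_eq (x : M) (w : TangentSpace (𝓡 n) x) :
    sampsonLaplacian g θ x w = -∑ k, stressDiv (coordMetric g x)
      (lieMatrix (coordMetric g x) (coordField (sharp g θ) x)) k (extChartAt (𝓡 n) x x)
        * vecComp x w k := by
  have ht : extChartAt (𝓡 n) x x ∈ (extChartAt (𝓡 n) x).target := mem_extChartAt_target x
  have hL := fun i j ↦ (contDiffAt_lieMatrix g θ ht i j).differentiableAt (by simp)
  have hev : coordTensor (deltaStar g θ) x =ᶠ[𝓝 (extChartAt (𝓡 n) x x)]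
      fun z ↦ (1 / 2 : ℝ) • lieMatrix (coordMetric g x) (coordField (sharp g θ) x) z := by
    filter_upwards [(isOpen_extChartAt_target x).mem_nhds ht] with z hz
    exact coordTensor_deltaStar g θ hz
  have hd : ∀ i j, DifferentiableAt ℝ (fun z ↦ coordTensor (deltaStar g θ) x z i j)
      (extChartAt (𝓡 n) x x) := fun i j ↦
    ((hL i j).const_mul (1 / 2 : ℝ)).congr_of_eventuallyEq
      (hev.mono fun z hz ↦ congrArg (fun B : Matrix (Fin n) (Fin n) ℝ ↦ B i j) hz)
  have hs : (coordTensor (deltaStar g θ) x (extChartAt (𝓡 n) x x)).IsSymm := by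
    rw [hev.self_of_nhds]
    exact (isSymm_lieMatrix (isSymm_coordMetric g x) _ _).smul _
  have hdF := (contDiffAt_divForm_symm g θ ht).differentiableAt (by simp)
  rw [sampsonLaplacian, divTensor_eq g (isBilinAt_deltaStar g θ) hd hs,
    differential_eq (mdifferentiableAt_divForm g θ x)]
  -- The trace part of 2 δδ*θ is -d(trace δ*θ) = dδθ. It cancels the term -dδθ of the Sampson
  -- Laplacian and leaves -S(L_ξ g).
  simp only [stressDiv_congr hev, stressDiv_const_smul _ hL, metricTrace_deltaStar]
  have hneg : ∀ k, pd k (fun z ↦ -divForm g (fun x v ↦ θ x v) ((extChartAt (𝓡 n) x).symm z))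
      (extChartAt (𝓡 n) x x) = -pd k (fun z ↦ divForm g (fun x v ↦ θ x v)
        ((extChartAt (𝓡 n) x).symm z)) (extChartAt (𝓡 n) x x) := fun k ↦ by
    simpa using pd_const_mul k (-1) hdF
  simp only [hneg, mul_neg, Finset.mul_sum, ← Finset.sum_neg_distrib, ← Finset.sum_sub_distrib]
  exact Finset.sum_congr rfl fun k _ ↦ by ring

/-- The stress divergence of L_ξ g is trace_g(L_ξ ∇) with its index lowered by g, and g is
invertible, so the two vanish together. -/
theorem isInfinitesimalHarmonic_sharp_iff :
    IsInfinitesimalHarmonic g (sharp g θ) ↔ ∀ (x : M) (l : Fin n), stressDiv (coordMetric g x)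
      (lieMatrix (coordMetric g x) (coordField (sharp g θ) x)) l (extChartAt (𝓡 n) x x) = 0 := by
  rw [isInfinitesimalHarmonic_iff g fun p y hy k ↦ contDiffAt_coordField_sharp g θ hy k]
  refine forall_congr' fun x ↦ ?_
  have ht : extChartAt (𝓡 n) x x ∈ (extChartAt (𝓡 n) x).target := mem_extChartAt_target x
  have hA := isMetricAt_coordMetric g ht
  simp only [hA.stressDiv_lieMatrix fun k ↦ contDiffAt_coordField_sharp g θ ht k]
  refine ⟨fun h l ↦ Finset.sum_eq_zero fun k _ ↦ by rw [h, mul_zero], fun h ↦ ?_⟩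
  have h0 : (coordMetric g x (extChartAt (𝓡 n) x x)).mulVec (fun k ↦ lieTension (coordMetric g x)
      (coordField (sharp g θ) x) k (extChartAt (𝓡 n) x x)) = 0 := funext h
  exact fun k ↦ congrFun (Matrix.eq_zero_of_mulVec_eq_zero hA.pos.ne' h0) k

theorem energyDensity_nonneg (gbar : RiemMetric m N) (f : M → N) (x : M) :
    0 ≤ energyDensity g gbar f x := by
  have ht : extChartAt (𝓡 n) x x ∈ (extChartAt (𝓡 n) x).target := mem_extChartAt_target x
  have hH : (coordTensor (pullbackMetric gbar f) x (extChartAt (𝓡 n) x x)).PosSemidef := by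
    rw [Matrix.posSemidef_iff_dotProduct_mulVec]
    refine ⟨by ext i j; exact gbar.symm _ _ _, fun v ↦ ?_⟩
    set x' := (extChartAt (𝓡 n) x).symm (extChartAt (𝓡 n) x x)
    obtain ⟨B, hB⟩ := isBilinAt_pullbackMetric (n := n) gbar f x'
    set u : Rn n := WithLp.toLp 2 v
    have hpos : 0 ≤ B (symmDeriv x (extChartAt (𝓡 n) x x) u)
        (symmDeriv x (extChartAt (𝓡 n) x x) u) := by
      rw [← hB]
      have hv : ∀ v : TangentSpace (𝓡 m) (f x'), 0 ≤ gbar.inner (f x') v v := fun v ↦ by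
        rcases eq_or_ne v 0 with rfl | h0
        · simp
        · exact (gbar.pos _ _ h0).le
      exact hv _
    rw [bilin_eq_sum] at hpos
    refine hpos.trans_eq ?_
    simp only [dotProduct, Matrix.mulVec, Finset.mul_sum]
    refine Finset.sum_congr rfl fun i _ ↦ Finset.sum_congr rfl fun j _ ↦ ?_
    have : coordTensor (pullbackMetric gbar f) x (extChartAt (𝓡 n) x x) i j
      = B (symmDeriv x (extChartAt (𝓡 n) x x) (EuclideanSpace.single i 1))
        (symmDeriv x (extChartAt (𝓡 n) x x) (EuclideanSpace.single j 1)) := hB _ _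
    rw [this, star_trivial]
    ring
  -- The energy density is the sum of all entries of the entrywise product of g⁻¹ and f^*ḡ. This
  -- product is positive semidefinite by the Schur product theorem, and the vector of ones sums its
  -- entries.
  have h := ((posDef_coordMetric g ht).inv.posSemidef.hadamard hH).dotProduct_mulVec_nonneg
    (fun _ ↦ 1)
  refine h.trans_eq ?_
  simp [dotProduct, Matrix.mulVec, energyDensity, metricTrace, coordInv]

/-- A function with vanishing differential on a connected manifold is constant. -/
theorem exists_eq_const_of_differential_eq_zero [ConnectedSpace M] {u : M → ℝ}
    (hu : ContMDiff (𝓡 n) 𝓘(ℝ, ℝ) ∞ u)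
    (h : ∀ (x : M) (w : TangentSpace (𝓡 n) x), differential u x w = 0) :
    ∃ c : ℝ, ∀ x, u x = c := by
  obtain ⟨x₀⟩ := ‹ConnectedSpace M›.toNonempty
  refine ⟨u x₀, fun x ↦ IsLocallyConstant.apply_eq_of_preconnectedSpace ?_ x x₀⟩
  refine (IsLocallyConstant.iff_eventually_eq u).2 fun p ↦ ?_
  set e := extChartAt (𝓡 n) p
  have hT : IsOpen e.target := isOpen_extChartAt_target p
  have hp : p ∈ e.source := mem_extChartAt_source p
  have hd : DifferentiableOn ℝ (fun y ↦ u (e.symm y)) e.target := fun y hy ↦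
    ((contDiffAt_comp_symm hu hy).differentiableAt (by simp)).differentiableWithinAt
  have h0 : e.target.EqOn (fderiv ℝ fun y ↦ u (e.symm y)) 0 := fun y hy ↦ by
    ext v
    have h1 := differential_symm (hu.mdifferentiableAt (by simp)) hy (symmDeriv p y v)
    have h2 := h1.symm.trans (h _ _)
    rw [chartDeriv_symmDeriv hy, ← fderiv_eq_sum_pd] at h2
    exact h2
  have hopen := hT.isOpen_inter_preimage_of_fderiv_eq_zero hd h0 {u p}
  have hmem : e p ∈ e.target ∩ (fun y ↦ u (e.symm y)) ⁻¹' {u p} :=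
    ⟨mem_extChartAt_target p, by simp [e.left_inv hp]⟩
  filter_upwards [(continuousAt_extChartAt p).preimage_mem_nhds (hopen.mem_nhds hmem),
    (isOpen_extChartAt_source p).mem_nhds hp] with x hx hxs
  have := hx.2
  rwa [mem_preimage, e.left_inv hxs] at this

variable {g θ} {gbar : RiemMetric m N} {f : M → N} {lam : M → ℝ} {φ : TwoTensor n M}

/-- The trace of a York decomposition of the pullback metric. -/
theorem energyDensity_of_york (hφ : IsTT g φ)
    (hdec : ∀ (x : M) (v w : TangentSpace (𝓡 n) x),
      pullbackMetric gbar f x v w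
        = (deltaStar g θ x v w + lam x * g.inner x v w) + φ x v w) (x : M) :
    energyDensity g gbar f x = -divForm g (fun x v ↦ θ x v) x + n * lam x := by
  have ht : extChartAt (𝓡 n) x x ∈ (extChartAt (𝓡 n) x).target := mem_extChartAt_target x
  have hx := (extChartAt (𝓡 n) x).left_inv (mem_extChartAt_source x)
  have hc : ∀ i j, coordTensor (pullbackMetric gbar f) x (extChartAt (𝓡 n) x x) i j
      = coordTensor (deltaStar g θ) x (extChartAt (𝓡 n) x x) i j
        + lam x * coordMetric g x (extChartAt (𝓡 n) x x) i j
        + coordTensor (fun x v w ↦ φ x v w) x (extChartAt (𝓡 n) x x) i j := fun i j ↦ by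
    refine (hdec _ _ _).trans ?_
    rw [congrArg lam hx]
    rfl
  have h1 := metricTrace_deltaStar g θ x
  have h2 := hφ.trace x
  have h3 := (isMetricAt_coordMetric g ht).sum_inv_mul_self
  rw [← h1, ← h3, ← add_zero (metricTrace g (deltaStar g θ) x + _), ← h2, energyDensity]
  simp only [metricTrace, coordInv, hc, mul_add, Finset.sum_add_distrib, Finset.sum_mul]
  congr 2
  exact Finset.sum_congr rfl fun i _ ↦ Finset.sum_congr rfl fun j _ ↦ by ring

variable [T2Space M] [CompactSpace M] [MeasurableSpace M] [BorelSpace M]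

/-- S applied to the decomposition reads 0 = ½ S(L_ξ g) + (1 - n/2) dλ + 0; doubling gives the
coefficient n - 2. -/
theorem stressDiv_lieMatrix_of_york (hf : IsHarmonicMap g gbar f)
    (hlam : ContMDiff (𝓡 n) 𝓘(ℝ, ℝ) ∞ lam) (hφ : IsTT g φ)
    (hdec : ∀ (x : M) (v w : TangentSpace (𝓡 n) x),
      pullbackMetric gbar f x v w
        = (deltaStar g θ x v w + lam x * g.inner x v w) + φ x v w) (x : M) (k : Fin n) :
    stressDiv (coordMetric g x) (lieMatrix (coordMetric g x) (coordField (sharp g θ) x)) k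
        (extChartAt (𝓡 n) x x)
      = (n - 2) * pd k (fun z ↦ lam ((extChartAt (𝓡 n) x).symm z)) (extChartAt (𝓡 n) x x) := by
  have ht : extChartAt (𝓡 n) x x ∈ (extChartAt (𝓡 n) x).target := mem_extChartAt_target x
  have hA := isMetricAt_coordMetric g ht
  have hL := fun i j ↦ (contDiffAt_lieMatrix g θ ht i j).differentiableAt (by simp)
  have hl := (contDiffAt_comp_symm hlam ht).differentiableAt (by simp)
  have hφd := fun i j ↦ (contDiffAt_coordTensor φ ht i j).differentiableAt (by simp)
  have hev : coordTensor (pullbackMetric gbar f) x =ᶠ[𝓝 (extChartAt (𝓡 n) x x)]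
      fun z ↦ ((1 / 2 : ℝ) • lieMatrix (coordMetric g x) (coordField (sharp g θ) x) z
        + lam ((extChartAt (𝓡 n) x).symm z) • coordMetric g x z)
        + coordTensor (fun x v w ↦ φ x v w) x z := by
    filter_upwards [(isOpen_extChartAt_target x).mem_nhds ht] with z hz
    rw [← coordTensor_deltaStar g θ hz]
    ext i j
    exact hdec _ _ _
  have h1 : ∀ i j, DifferentiableAt ℝ (fun z ↦ ((1 / 2 : ℝ) • lieMatrix (coordMetric g x)
      (coordField (sharp g θ) x) z) i j) (extChartAt (𝓡 n) x x) :=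
    fun i j ↦ (hL i j).const_mul (1 / 2 : ℝ)
  have h2 : ∀ i j, DifferentiableAt ℝ (fun z ↦ (lam ((extChartAt (𝓡 n) x).symm z)
      • coordMetric g x z) i j) (extChartAt (𝓡 n) x x) :=
    fun i j ↦ hl.fun_mul (hA.differentiableAt i j)
  have h3 : ∀ i j, DifferentiableAt ℝ (fun z ↦ ((1 / 2 : ℝ) • lieMatrix (coordMetric g x)
      (coordField (sharp g θ) x) z + lam ((extChartAt (𝓡 n) x).symm z) • coordMetric g x z) i j)
      (extChartAt (𝓡 n) x x) := fun i j ↦ (h1 i j).fun_add (h2 i j)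
  have h := stressDiv_pullbackMetric_eq_zero hf x k
  rw [stressDiv_congr hev, stressDiv_add h3 hφd,
    stressDiv_add h1 h2, stressDiv_const_smul _ hL, hA.stressDiv_smul_metric hl,
    hφ.stressDiv_eq_zero] at h
  linarith

/-- The energy of a map for which the York decomposition of the pullback metric has constant
scalar part. -/
theorem energy_of_york (hφ : IsTT g φ)
    (hdec : ∀ (x : M) (v w : TangentSpace (𝓡 n) x),
      pullbackMetric gbar f x v w
        = (deltaStar g θ x v w + lam x * g.inner x v w) + φ x v w) {c : ℝ}
    (hc : ∀ x, lam x = c) :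
    energy g gbar f = (n : ℝ) / 2 * c * (riemVol g).real univ := by
  have := isLocallyFiniteMeasure_riemVol g
  have hD : Continuous (divForm g fun x v ↦ θ x v) :=
    continuous_of_symm fun p ↦ continuousOn_divForm_symm g θ p
  have hi : Integrable (fun x ↦ -divForm g (fun x v ↦ θ x v) x) (riemVol g) :=
    (integrable_riemVol_of_continuous g hD).neg
  rw [energy, energyOn, setIntegral_univ]
  simp only [energyDensity_of_york hφ hdec, hc]
  rw [integral_add hi
    (integrable_riemVol_of_continuous g continuous_const), integral_neg, integral_divForm,
    integral_const, smul_eq_mul]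
  ring

end York

end RiemGeom

end

/-! ### The theorem -/

theorem corollary2 {n m : ℕ} (hn : 2 ≤ n) (hm : 2 ≤ m) {M N : Type*}
    [TopologicalSpace M] [ChartedSpace (Rn n) M] [IsManifold (𝓡 n) ∞ M]
    [T2Space M] [CompactSpace M] [ConnectedSpace M] [MeasurableSpace M] [BorelSpace M]
    [TopologicalSpace N] [ChartedSpace (Rn m) N] [IsManifold (𝓡 m) ∞ N]
    [T2Space N] [SecondCountableTopology N]
    (g : RiemMetric n M) (gbar : RiemMetric m N) (hgbar : IsCompleteMetric gbar)
    (f : M → N) (hf : IsHarmonicMap g gbar f)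
    (θ : OneForm n M) (lam : M → ℝ) (hlam : ContMDiff (𝓡 n) 𝓘(ℝ, ℝ) ∞ lam)
    (φ : TwoTensor n M) (hφ : IsTT g φ)
    (hdec : ∀ (x : M) (v w : TangentSpace (𝓡 n) x),
      pullbackMetric gbar f x v w
        = (deltaStar g θ x v w + lam x * g.inner x v w) + φ x v w) :
    (∀ (x : M) (w : TangentSpace (𝓡 n) x),
      sampsonLaplacian g θ x w = -((n : ℝ) - 2) * differential lam x w) ∧
    (n = 2 → IsInfinitesimalHarmonic g (sharp g θ)) ∧
    (2 < n → (IsInfinitesimalHarmonic g (sharp g θ) ↔ ∃ c : ℝ, ∀ x, lam x = c)) ∧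
    (2 < n → IsInfinitesimalHarmonic g (sharp g θ) →
      ∃ c : ℝ, 0 ≤ c ∧ (∀ x, lam x = c) ∧
        energy g gbar f = (n : ℝ) / 2 * c * (riemVol g).real univ) := by
  have hstress := stressDiv_lieMatrix_of_york hf hlam hφ hdec
  have hS : ∀ (x : M) (w : TangentSpace (𝓡 n) x),
      sampsonLaplacian g θ x w = -((n : ℝ) - 2) * differential lam x w := fun x w ↦ by
    rw [sampsonLaplacian_eq, differential_eq (hlam.mdifferentiableAt (by simp)), Finset.mul_sum,
      ← Finset.sum_neg_distrib]
    refine Finset.sum_congr rfl fun k _ ↦ ?_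
    rw [hstress]
    ring
  have hconst : 2 < n → IsInfinitesimalHarmonic g (sharp g θ) → ∃ c : ℝ, ∀ x, lam x = c := by
    intro hn' h
    have hn0 : (n : ℝ) - 2 ≠ 0 := sub_ne_zero.2 (by exact_mod_cast hn'.ne')
    refine exists_eq_const_of_differential_eq_zero hlam fun x w ↦ ?_
    rw [differential_eq (hlam.mdifferentiableAt (by simp))]
    refine Finset.sum_eq_zero fun k _ ↦ ?_
    have h0 := (isInfinitesimalHarmonic_sharp_iff g θ).1 h x k
    rw [hstress] at h0
    rw [(mul_eq_zero.1 h0).resolve_left hn0, mul_zero]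
  refine ⟨hS, fun hn2 ↦ ?_, fun hn' ↦ ⟨hconst hn', ?_⟩, fun hn' h ↦ ?_⟩
  · refine (isInfinitesimalHarmonic_sharp_iff g θ).2 fun x l ↦ ?_
    rw [hstress]
    simp [hn2]
  · rintro ⟨c, hc⟩
    refine (isInfinitesimalHarmonic_sharp_iff g θ).2 fun x l ↦ ?_
    rw [hstress]
    simp only [hc, pd_const, mul_zero]
  · obtain ⟨c, hc⟩ := hconst hn' h
    have hE := energy_of_york hφ hdec hc
    refine ⟨c, ?_, hc, hE⟩
    -- Local finiteness and compactness make the volume finite. This matters because `Measure.real`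
    -- takes the value 0 on sets of infinite measure, and the sign of c is obtained by dividing a
    -- nonnegative energy by a positive volume.
    have := isLocallyFiniteMeasure_riemVol g
    have hvol : 0 < (riemVol g).real univ :=
      ENNReal.toReal_pos (riemVol_univ_pos g).ne' (measure_ne_top _ _)
    have hE0 : 0 ≤ energy g gbar f := by
      rw [energy, energyOn]
      exact mul_nonneg (by norm_num) (integral_nonneg fun x ↦ energyDensity_nonneg g gbar f x)
    have hn0 : (0 : ℝ) < n / 2 := by
      have : (2 : ℝ) < n := by exact_mod_cast hn'
      linarith
    rw [hE] at hE0
    by_contra! hneg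
    have h1 : (n : ℝ) / 2 * c * (riemVol g).real univ < 0 :=
      mul_neg_of_neg_of_pos (mul_neg_of_pos_of_neg hn0 hneg) hvol
    linarith
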